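/- All Hilbert spaces are finite-dimensional and complex. Let $\mathsf Q=\mathbb C^2$, let $X,Z$ be the Pauli operators and $H$ the Hadamard operator, $|y^\theta\rangle=H^\theta|y\rangle$ for $y,\theta\in\mathbb Z_2$, and $|\beta\rangle=\cos\frac\pi8|0\rangle+\sin\frac\pi8|1\rangle$ (the Breidbart state). For $n\ge 1$, a strategy $\mathtt S=(\mathsf B,\mathsf C,B,C,\rho)$ for $\mathtt{TFKW}^n$, the $n$-fold parallel repetition of the TFKW monogamy-of-entanglement game, consists of POVMs $(B^\theta_x)_{x\in\mathbb Z_2^n}$ on $\mathsf B$ and $(C^\theta_x)_{x\in\mathbb Z_2^n}$ on $\mathsf C$ for each $\theta\in\mathbb Z_2^n$, and a density operator $\rho$ on $\mathsf Q^{\otimes n}\otimes\mathsf B\otimes\mathsf C$. With $A^\theta_x=|x_1^{\theta_1}\rangle\langle x_1^{\theta_1}|\otimes\cdots\otimes|x_n^{\theta_n}\rangle\langle x_n^{\theta_n}|$, and writing $P^\theta_{y,i}=\sum_{x\in\mathbb Z_2^n:\,x_i=y}P^\theta_x$ for $P=A,B,C$, its $i$-th winning probability is \[ \mathfrak w^i_{\mathtt{TFKW}^n}(\mathtt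 S)=\frac1{2^n}\sum_{\theta\in\mathbb Z_2^n}\sum_{y\in\mathbb Z_2}\operatorname{Tr}\big[(A^\theta_{y,i}\otimes B^\theta_{y,i}\otimes C^\theta_{y,i})\rho\big]. \] \textbf{Theorem.} There is a universal constant $K\ge 0$ such that the following holds. Let $n\ge1$ and $\varepsilon,\eta\in[0,1]$, and let $\mathtt S=(\mathsf B,\mathsf C,B,C,\rho)$ be a random (mixed) strategy for $\mathtt{TFKW}^n$, that is, $\mathsf B$ and $\mathsf C$ are fixed while $B=B(\omega)$, $C=C(\omega)$ and $\rho=\rho(\omega)$ depend measurably on a point $\omega$ of a probability space $\Omega$ (for instance, a finite one). Suppose that for each $i\in\{1,\dots,n\}$, with probability at least $1-\eta$, the $i$-th game wins with probability $\mathfrak w^i_{\mathtt{TFKW}^n}(\mathtt S)\ge\cos^2\frac\pi8-\varepsilon$. Then there are Hilbert spaces $\mathsf B'$, $\mathsf C'$, $\mathsf R$, isometries $V:\mathsf B\to\mathsf B'$ and $W:\mathsf C\to\mathsf C'$, and, for each $\omega\in\Omega$, a unit vector \[ |\phi\rangle=\sum_{t\in(\mathbb Z_2^2)^n}X^{t_{10}}Z^{t_{11}}|\beta\rangle\otimes\cdots\otimes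 X^{t_{n0}}Z^{t_{n1}}|\beta\rangle\otimes|\psi_t\rangle , \] where the vectors $|\psi_t\rangle\in\mathsf B'\otimes\mathsf C'\otimes\mathsf R$ (which, like $|\phi\rangle$, depend on $\omega$) have, for distinct $t$, orthogonal supports both on $\mathsf B'$ and on $\mathsf C'$, such that the trace distance $\|\sigma-\tau\|_{\mathrm{Tr}}=\frac12\operatorname{Tr}|\sigma-\tau|$ below is an integrable random variable and its expected value satisfies \[ \mathbb E\,\big\|(V\otimes W)\rho(V\otimes W)^\dagger-\operatorname{Tr}_{\mathsf R}|\phi\rangle\langle\phi|\big\|_{\mathrm{Tr}}\le Kn^3\sqrt\varepsilon+n\eta . \] -/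

import Mathlib

open Matrix MeasureTheory
open scoped Kronecker MatrixOrder ComplexOrder

/-! Finite registers are finite types `A`; the Hilbert space of `A` is `ℂ^A` with its canonical
orthonormal basis, operators are matrices, the joint register of `A` and `B` is `A × B`, and the
tensor product of operators is the Kronecker product. -/

namespace MoE

noncomputable section

/-- A positive operator-valued measurement with outcomes in `Y` on the register `A`. -/
def IsPOVM {Y A : Type*} [Fintype Y] [Fintype A] [DecidableEq A] (P : Y → Matrix A A ℂ) : Prop :=
  (∀ y, (P y).PosSemidef) ∧ ∑ y, P y = 1

/-- A density operator (mixed quantum state) on the register `A`. -/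
def IsDensity {A : Type*} [Fintype A] (ρ : Matrix A A ℂ) : Prop :=
  ρ.PosSemidef ∧ ρ.trace = 1

/-- The trace distance `½ Tr |ρ - σ|`, where `|L| = √(L† L)`. -/
def traceDist {A : Type*} [Fintype A] [DecidableEq A] (ρ σ : Matrix A A ℂ) : ℝ :=
  (1 / 2) * (CFC.sqrt ((ρ - σ)ᴴ * (ρ - σ))).trace.re

/-- The tensor product `M₁ ⊗ ⋯ ⊗ Mₙ` of operators on the register `A`, as an operator on the
register `Aⁿ`. -/
def tensor {A : Type*} {n : ℕ} (M : Fin n → Matrix A A ℂ) :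
    Matrix (Fin n → A) (Fin n → A) ℂ :=
  Matrix.of fun x y => ∏ i, M i (x i) (y i)

theorem tensor_one {A : Type*} [DecidableEq A] {n : ℕ} :
    tensor (fun _ : Fin n => (1 : Matrix A A ℂ)) = 1 := by
  ext x y
  simp [tensor, one_apply, Finset.prod_ite_zero, funext_iff]

theorem tensor_mul {A : Type*} [Fintype A] [DecidableEq A] {n : ℕ} (M N : Fin n → Matrix A A ℂ) :
    tensor (fun i => M i * N i) = tensor M * tensor N := by
  ext x y
  simp only [tensor, of_apply, mul_apply, ← Finset.prod_mul_distrib]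
  exact Fintype.prod_sum (fun i a => M i (x i) a * N i a (y i))

theorem tensor_conjTranspose {A : Type*} {n : ℕ} (M : Fin n → Matrix A A ℂ) :
    tensor (fun i => (M i)ᴴ) = (tensor M)ᴴ := by
  ext x y
  simp [tensor, conjTranspose_apply]

theorem tensor_posSemidef {A : Type*} [Fintype A] [DecidableEq A] {n : ℕ}
    {M : Fin n → Matrix A A ℂ} (hM : ∀ i, (M i).PosSemidef) : (tensor M).PosSemidef := by
  choose N hN using fun i => CStarAlgebra.nonneg_iff_eq_star_mul_self.mp (hM i).nonneg
  have h : M = fun i => (N i)ᴴ * N i := funext hN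
  rw [h, tensor_mul, tensor_conjTranspose]
  exact posSemidef_conjTranspose_mul_self _

theorem tensor_sum {A Y : Type*} [Fintype Y] [DecidableEq Y] {n : ℕ}
    (M : Fin n → Y → Matrix A A ℂ) :
    ∑ y : Fin n → Y, tensor (fun i => M i (y i)) = tensor (fun i => ∑ y, M i y) := by
  ext x z
  simp only [tensor, Matrix.sum_apply, of_apply]
  exact (Fintype.prod_sum (fun i y => M i y (x i) (z i))).symm

/-- A monogamy-of-entanglement game: questions `Θ`, answers `Y`, Alice's register `A`, the
distribution of the questions, and Alice's measurements. -/
structure Game (Θ Y A : Type) [Fintype Θ] [Fintype Y] [Fintype A] [DecidableEq A] where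
  prob : Θ → ℝ
  prob_nonneg : ∀ θ, 0 ≤ prob θ
  prob_sum : ∑ θ, prob θ = 1
  alice : Θ → Y → Matrix A A ℂ
  alice_povm : ∀ θ, IsPOVM (alice θ)

/-- A quantum strategy for a game, with Bob's register `B` and Charlie's register `C`. -/
structure Strategy {Θ Y A : Type} [Fintype Θ] [Fintype Y] [Fintype A] [DecidableEq A]
    (G : Game Θ Y A) (B C : Type*) [Fintype B] [DecidableEq B] [Fintype C] [DecidableEq C] where
  bob : Θ → Y → Matrix B B ℂ
  bob_povm : ∀ θ, IsPOVM (bob θ)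
  charlie : Θ → Y → Matrix C C ℂ
  charlie_povm : ∀ θ, IsPOVM (charlie θ)
  state : Matrix (A × B × C) (A × B × C) ℂ
  state_density : IsDensity state

/-- The `n`-fold parallel repetition of a game. -/
def Game.parallel {Θ Y A : Type} [Fintype Θ] [DecidableEq Θ] [Fintype Y] [DecidableEq Y]
    [Fintype A] [DecidableEq A] (G : Game Θ Y A) (n : ℕ) :
    Game (Fin n → Θ) (Fin n → Y) (Fin n → A) where
  prob θ := ∏ i, G.prob (θ i)
  prob_nonneg θ := Finset.prod_nonneg fun i _ => G.prob_nonneg (θ i)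
  prob_sum := by
    rw [← Fintype.prod_sum (fun (_ : Fin n) θ => G.prob θ)]
    simp [G.prob_sum]
  alice θ y := tensor fun i => G.alice (θ i) (y i)
  alice_povm θ :=
    ⟨fun y => tensor_posSemidef fun i => (G.alice_povm (θ i)).1 (y i), by
      rw [tensor_sum (fun i y => G.alice (θ i) y)]
      simp only [(G.alice_povm _).2]
      exact tensor_one⟩

/-- The coarse-graining of a measurement with outcomes in `Yⁿ` to the `i`-th answer:
`P_{y,i} = ∑_{x : x_i = y} P_x`. -/
def marginal {Y A : Type*} [Fintype Y] [DecidableEq Y] {n : ℕ}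
    (P : (Fin n → Y) → Matrix A A ℂ) (i : Fin n) (y : Y) : Matrix A A ℂ :=
  ∑ x with x i = y, P x

/-- The `i`-th winning probability of a strategy for the `n`-fold parallel repetition. The traces
are real because the operators involved are positive. -/
def Strategy.winProb {Θ Y A : Type} [Fintype Θ] [DecidableEq Θ] [Fintype Y] [DecidableEq Y]
    [Fintype A] [DecidableEq A] {G : Game Θ Y A} {n : ℕ} {B C : Type*} [Fintype B] [DecidableEq B]
    [Fintype C] [DecidableEq C] (S : Strategy (G.parallel n) B C) (i : Fin n) : ℝ :=
  ∑ θ, (G.parallel n).prob θ * ∑ y,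
    ((marginal ((G.parallel n).alice θ) i y ⊗ₖ
      (marginal (S.bob θ) i y ⊗ₖ marginal (S.charlie θ) i y)) * S.state).trace.re

/-- The Hadamard operator. -/
def hadamardGate : Matrix (Fin 2) (Fin 2) ℂ :=
  !![1 / (√2 : ℝ), 1 / (√2 : ℝ); 1 / (√2 : ℝ), -(1 / (√2 : ℝ))]

/-- The Pauli operator `X`. -/
def pauliX : Matrix (Fin 2) (Fin 2) ℂ := !![0, 1; 1, 0]

/-- The Pauli operator `Z`. -/
def pauliZ : Matrix (Fin 2) (Fin 2) ℂ := !![1, 0; 0, -1]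

/-- The Breidbart state `|β⟩ = cos(π/8)|0⟩ + sin(π/8)|1⟩`. -/
def breidbart : Fin 2 → ℂ := ![(Real.cos (Real.pi / 8) : ℝ), (Real.sin (Real.pi / 8) : ℝ)]

/-- The conjugate-coding (Wiesner, BB84) state `|y^θ⟩ = H^θ |y⟩` of one qubit. -/
def wiesner (θ y : Fin 2) : Fin 2 → ℂ := (hadamardGate ^ (θ : ℕ)) *ᵥ Pi.single y 1

theorem sqrt_two_inv_mul : (1 / (√2 : ℝ) : ℂ) * (1 / (√2 : ℝ)) = 1 / 2 := by
  rw [← Complex.ofReal_one, ← Complex.ofReal_div, ← Complex.ofReal_mul, div_mul_div_comm,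
    Real.mul_self_sqrt (by norm_num)]
  norm_num

theorem wiesner_sum (θ : Fin 2) :
    ∑ y, vecMulVec (wiesner θ y) (star (wiesner θ y)) = 1 := by
  have h := sqrt_two_inv_mul
  have hs : star (1 / (√2 : ℝ) : ℂ) = 1 / (√2 : ℝ) := by simp
  fin_cases θ
  · ext i j
    fin_cases i <;> fin_cases j <;> simp [wiesner, vecMulVec_apply]
  · ext i j
    fin_cases i <;> fin_cases j <;>
      simp [wiesner, vecMulVec_apply, hadamardGate] <;> simp at h <;> simp [h] <;> norm_num

/-- The TFKW game: Alice measures a qubit in the computational or the Hadamard basis, chosen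
uniformly, with `A^θ_y = |y^θ⟩⟨y^θ|`. -/
def tfkw : Game (Fin 2) (Fin 2) (Fin 2) where
  prob _ := 1 / 2
  prob_nonneg _ := by norm_num
  prob_sum := by simp
  alice θ y := vecMulVec (wiesner θ y) (star (wiesner θ y))
  alice_povm θ := ⟨fun _ => posSemidef_vecMulVec_self_star _, wiesner_sum θ⟩

/-- The vector `∑_t X^{t_{10}} Z^{t_{11}}|β⟩ ⊗ ⋯ ⊗ X^{t_{n0}} Z^{t_{n1}}|β⟩ ⊗ |ψ_t⟩`, the sum being
over `t ∈ (ℤ₂²)ⁿ`. -/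
def wbVector {n : ℕ} {B C R : Type*} (ψ : (Fin n → Fin 2 → Fin 2) → B × C × R → ℂ) :
    (Fin n → Fin 2) × B × C × R → ℂ :=
  fun p => ∑ t, (∏ i, ((pauliX ^ (t i 0 : ℕ) * pauliZ ^ (t i 1 : ℕ)) *ᵥ breidbart) (p.1 i)) *
    ψ t p.2

/-- The support on `B` of a vector in `B ⊗ C ⊗ R`: the smallest subspace `S` of `ℂ^B` such that the
vector lies in `S ⊗ C ⊗ R` (equivalently, the range of its reduced operator on `B`). -/
def supportLeft {B C R : Type*} [Fintype B] (v : B × C × R → ℂ) :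
    Submodule ℂ (EuclideanSpace ℂ B) :=
  Submodule.span ℂ (Set.range fun q : C × R => WithLp.toLp 2 fun b => v (b, q.1, q.2))

/-- The support on `C` of a vector in `B ⊗ C ⊗ R`. -/
def supportRight {B C R : Type*} [Fintype C] (v : B × C × R → ℂ) :
    Submodule ℂ (EuclideanSpace ℂ C) :=
  Submodule.span ℂ (Set.range fun q : B × R => WithLp.toLp 2 fun c => v (q.1, c, q.2))

/-- The partial trace over the last register `R`. -/
def partialTrace {A B C R : Type*} [Fintype R]
    (M : Matrix (A × B × C × R) (A × B × C × R) ℂ) : Matrix (A × B × C) (A × B × C) ℂ :=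
  Matrix.of fun p q => ∑ r, M (p.1, p.2.1, p.2.2, r) (q.1, q.2.1, q.2.2, r)

/-- `(V ⊗ W) ρ (V ⊗ W)†`, where `V` and `W` act on Bob's and Charlie's registers and Alice's register
is left alone. -/
def conjLocal {A B C B' C' : Type*} [Fintype A] [DecidableEq A] [Fintype B] [Fintype C]
    (V : Matrix B' B ℂ) (W : Matrix C' C ℂ) (ρ : Matrix (A × B × C) (A × B × C) ℂ) :
    Matrix (A × B' × C') (A × B' × C') ℂ :=
  ((1 : Matrix A A ℂ) ⊗ₖ (V ⊗ₖ W)) * ρ * ((1 : Matrix A A ℂ) ⊗ₖ (V ⊗ₖ W))ᴴ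

end

end MoE

/-! Write each player's binary answer as a ±1 observable. For two questions with different i-th
bits, Alice's observables a, a' in game i anticommute, while Bob's b and Charlie's c' commute with
them and with each other. Hence `ab` and `a'c'` anticommute, and the squared norm of `abψ + a'c'ψ -
√2ψ` is exactly a multiple of `√2 - ⟨ab⟩ - ⟨a'c'⟩`. Agreement of all three players is at most
agreement of Alice with one of them, so this square bounds the score by the optimal value, and
near-optimality forces the square to be small (`IsTriple.norm_sum_sub_le`). It also forces `bψ ≈ cψ`
(`IsTriple.norm_sub_le`).

Two consequences drive the proof. Since `abψ ≈ √2ψ - a'c'ψ`, the vector `bψ` hardly depends on which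
question, among those with the same partner, produced b (`IsTriple.dist_of_partner`). An averaging
argument selects one question θ for which θ, its complement and the questions differing from θ in
one bit are nearly optimal in the pairings that are needed (`IsFamily.exists_pairDeficit_le`). The
question θ with bit i flipped interpolates between θ and its complement: its i-th and j-th
observables come from one measurement, so they commute. This transfers to approximate consistency of
Bob and Charlie for θ even after an observable for the complement was applied
(`IsFamily.exists_question`).

Bob and Charlie each measure for θ and then for its complement and record the outcomes, two bits per
game. Consistency of single bits controls whole measurements without a factor exponential in n
(`IsPVM.sum_norm_sub_sq_le`), and an operator commuting with Charlie's measurement nearly commutes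
with Bob's (`IsPVM.sum_commutator_le`). Thus the records t nearly coincide, and given t, Alice's
i-th qubit nearly satisfies `√2ψ = ∑ₑ ±aₑψ`, which characterizes the conjugated Breidbart state.
Projecting onto equal records and these states of Alice yields the required form
(`sum_norm_sub_rounded_le`, `exists_question_rounding`).

General strategies reduce to this by Naimark dilation and purification. The question θ, the
dilations and the recording isometries depend on ω, but V and W must not. In large enough fixed
registers, a further local isometry turns the ω-dependent isometry into a fixed embedding, and it
preserves the form of the rounded vector (`exists_isometry_mul_eq`, `Strategy.exists_rounding`). For
integrability, the approximating vector is chosen as a minimizer over the compact set of admissible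
vectors: the minimal distance is an infimum of continuous functions of the state, hence measurable,
even if the minimizer is not. A union bound over the n games gives `nη`. -/

namespace MoE

noncomputable section

/-! ### One pair of complementary questions: sums of squares -/

section Abstract

variable {H : Type*} [NormedAddCommGroup H] [InnerProductSpace ℂ H]

/-- The real part of the inner product. -/
def reInner (x y : H) : ℝ := (inner ℂ x y).re

theorem reInner_comm (x y : H) : reInner x y = reInner y x := by
  rw [reInner, reInner, ← inner_conj_symm, Complex.conj_re]

theorem reInner_self (x : H) : reInner x x = ‖x‖ ^ 2 := by
  exact (norm_sq_eq_re_inner (𝕜 := ℂ) x).symm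

theorem reInner_add_left (x y z : H) : reInner (x + y) z = reInner x z + reInner y z := by
  simp [reInner]

theorem reInner_add_right (x y z : H) : reInner x (y + z) = reInner x y + reInner x z := by
  simp [reInner]

theorem reInner_sub_left (x y z : H) : reInner (x - y) z = reInner x z - reInner y z := by
  simp [reInner]

theorem reInner_sub_right (x y z : H) : reInner x (y - z) = reInner x y - reInner x z := by
  simp [reInner]

theorem reInner_neg_right (x y : H) : reInner x (-y) = -reInner x y := by
  simp [reInner, inner_neg_right]

theorem reInner_smul_left (r : ℝ) (x y : H) : reInner ((r : ℂ) • x) y = r * reInner x y := by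
  simp [reInner]

theorem reInner_smul_right (r : ℝ) (x y : H) : reInner x ((r : ℂ) • y) = r * reInner x y := by
  simp [reInner]

/-- A self-adjoint involution: an observable with outcomes `±1`. -/
structure IsReflection (b : H →L[ℂ] H) : Prop where
  symm : ∀ u v, inner ℂ (b u) v = inner ℂ u (b v)
  sq : ∀ u, b (b u) = u

theorem IsReflection.reInner {b : H →L[ℂ] H} (hb : IsReflection b) (u v : H) :
    reInner (b u) v = MoE.reInner u (b v) := by
  rw [MoE.reInner, MoE.reInner, hb.symm]

theorem IsReflection.reInner_map {b : H →L[ℂ] H} (hb : IsReflection b) (u v : H) :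
    MoE.reInner (b u) (b v) = MoE.reInner u v := by
  rw [hb.reInner, hb.sq]

theorem IsReflection.norm {b : H →L[ℂ] H} (hb : IsReflection b) (u : H) : ‖b u‖ = ‖u‖ := by
  have := hb.reInner_map u u
  rw [reInner_self, reInner_self] at this
  exact (sq_eq_sq₀ (norm_nonneg _) (norm_nonneg _)).mp this

/-- The probability that three commuting observables have the same outcome. -/
def agreeProb (a b c : H →L[ℂ] H) (ψ : H) : ℝ :=
  (‖ψ‖ ^ 2 + reInner (a ψ) (b ψ) + reInner (a ψ) (c ψ) + reInner (b ψ) (c ψ)) / 4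

theorem agreeProb_comm (a b c : H →L[ℂ] H) (ψ : H) : agreeProb a b c ψ = agreeProb a c b ψ := by
  rw [agreeProb, agreeProb, reInner_comm (b ψ)]
  ring

/-- The operator `1 + ab - bc - ac` is four times the projection onto the event `a = b ≠ c`, so the
difference of the two sides is a multiple of a squared norm. -/
theorem agreeProb_le {a b c : H →L[ℂ] H} (ha : IsReflection a) (hb : IsReflection b)
    (hc : IsReflection c) (hab : ∀ u, a (b u) = b (a u)) (hac : ∀ u, a (c u) = c (a u))
    (hbc : ∀ u, b (c u) = c (b u)) (ψ : H) :
    agreeProb a b c ψ ≤ (‖ψ‖ ^ 2 + reInner (a ψ) (b ψ)) / 2 := by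
  have h := sq_nonneg ‖ψ + a (b ψ) - b (c ψ) - a (c ψ)‖
  rw [← reInner_self] at h
  simp only [reInner_add_left, reInner_add_right, reInner_sub_left, reInner_sub_right] at h
  simp only [reInner_self, ha.norm, hb.norm, hc.norm] at h
  have e1 : reInner ψ (a (b ψ)) = reInner (a ψ) (b ψ) := (ha.reInner _ _).symm
  have e2 : reInner ψ (b (c ψ)) = reInner (b ψ) (c ψ) := (hb.reInner _ _).symm
  have e3 : reInner ψ (a (c ψ)) = reInner (a ψ) (c ψ) := (ha.reInner _ _).symm
  have e4 : reInner (a (b ψ)) (b (c ψ)) = reInner (a ψ) (c ψ) := by rw [hab, hb.reInner_map]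
  have e5 : reInner (a (b ψ)) (a (c ψ)) = reInner (b ψ) (c ψ) := ha.reInner_map _ _
  have e6 : reInner (b (c ψ)) (a (c ψ)) = reInner (a ψ) (b ψ) := by
    rw [hbc, hac, hc.reInner_map, reInner_comm]
  rw [reInner_comm (a (b ψ)) ψ, reInner_comm (b (c ψ)) ψ, reInner_comm (a (c ψ)) ψ,
    reInner_comm (b (c ψ)) (a (b ψ)), reInner_comm (a (c ψ)) (a (b ψ)),
    reInner_comm (a (c ψ)) (b (c ψ)), e1, e2, e3, e4, e5, e6] at h
  rw [agreeProb]
  linarith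

/-- The observables of Alice, Bob and Charlie for two questions that are complementary for
Alice. -/
structure IsTriple (a a' b b' c c' : H →L[ℂ] H) : Prop where
  refl_a : IsReflection a
  refl_a' : IsReflection a'
  refl_b : IsReflection b
  refl_b' : IsReflection b'
  refl_c : IsReflection c
  refl_c' : IsReflection c'
  anti : ∀ u, a (a' u) = -a' (a u)
  ab : ∀ u, a (b u) = b (a u)
  ab' : ∀ u, a (b' u) = b' (a u)
  a'b : ∀ u, a' (b u) = b (a' u)
  a'b' : ∀ u, a' (b' u) = b' (a' u)
  ac : ∀ u, a (c u) = c (a u)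
  ac' : ∀ u, a (c' u) = c' (a u)
  a'c : ∀ u, a' (c u) = c (a' u)
  a'c' : ∀ u, a' (c' u) = c' (a' u)
  bc : ∀ u, b (c u) = c (b u)
  bc' : ∀ u, b (c' u) = c' (b u)
  b'c : ∀ u, b' (c u) = c (b' u)
  b'c' : ∀ u, b' (c' u) = c' (b' u)

/-- The amount by which a pair of complementary questions misses the optimal score. -/
def deficit (a a' b b' c c' : H →L[ℂ] H) (ψ : H) : ℝ :=
  1 + √2 / 2 - agreeProb a b c ψ - agreeProb a' b' c' ψ

variable {a a' b b' c c' : H →L[ℂ] H} {ψ : H}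

theorem IsTriple.swapBC (h : IsTriple a a' b b' c c') : IsTriple a a' c c' b b' :=
  ⟨h.1, h.2, h.5, h.6, h.3, h.4, h.7, h.12, h.13, h.14, h.15, h.8, h.9, h.10, h.11,
    fun u => (h.bc u).symm, fun u => (h.b'c u).symm, fun u => (h.bc' u).symm,
    fun u => (h.b'c' u).symm⟩

theorem IsTriple.swapQ (h : IsTriple a a' b b' c c') : IsTriple a' a b' b c' c :=
  ⟨h.2, h.1, h.4, h.3, h.6, h.5, fun u => by rw [h.anti, neg_neg], h.a'b', h.a'b, h.ab', h.ab,
    h.a'c', h.a'c, h.ac', h.ac, h.b'c', h.b'c, h.bc', h.bc⟩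

theorem deficit_swapQ : deficit a' a b' b c' c ψ = deficit a a' b b' c c' ψ := by
  rw [deficit, deficit]; ring

/-- The unit vectors `abψ` and `a'c'ψ` have zero real inner product because `ab` and `a'c'`
anticommute; expanding the square then even gives equality. -/
theorem IsTriple.sq_norm_le (h : IsTriple a a' b b' c c') (hψ : ‖ψ‖ = 1) :
    ‖a (b ψ) + a' (c' ψ) - ((√2 : ℝ) : ℂ) • ψ‖ ^ 2 ≤
      2 * √2 * (√2 - (reInner (a ψ) (b ψ) + reInner (a' ψ) (c' ψ))) := by
  rw [← reInner_self]
  simp only [reInner_add_left, reInner_add_right, reInner_sub_left, reInner_sub_right,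
    reInner_smul_left, reInner_smul_right]
  simp only [reInner_self, h.refl_a.norm, h.refl_a'.norm, h.refl_b.norm, h.refl_c'.norm, hψ]
  have e1 : reInner (a (b ψ)) ψ = reInner (a ψ) (b ψ) := by rw [h.refl_a.reInner, reInner_comm]
  have e2 : reInner (a' (c' ψ)) ψ = reInner (a' ψ) (c' ψ) := by rw [h.refl_a'.reInner, reInner_comm]
  have e3 : reInner (a (b ψ)) (a' (c' ψ)) = 0 := by
    have : reInner (a (b ψ)) (a' (c' ψ)) = -reInner (a (b ψ)) (a' (c' ψ)) := by
      conv_lhs => rw [h.ab, h.refl_b.reInner, h.refl_a.reInner, ← h.a'b, h.anti, reInner_neg_right,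
        ← h.refl_a'.reInner, h.bc', h.ac', ← h.refl_c'.reInner, ← h.a'c', reInner_comm]
    linarith
  have s := Real.sq_sqrt (show (0:ℝ) ≤ 2 by norm_num)
  rw [reInner_comm ψ (a (b ψ)), reInner_comm ψ (a' (c' ψ)), reInner_comm (a' (c' ψ)) (a (b ψ)),
    e1, e2, e3]
  nlinarith [s]

/-- Monogamy enters here: the first agreement is relaxed to Alice and Bob, the second to Alice and
Charlie, so that the operators of `IsTriple.sq_norm_le` appear. -/
theorem IsTriple.sqrt_two_sub_le (h : IsTriple a a' b b' c c') (hψ : ‖ψ‖ = 1) :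
    √2 - (reInner (a ψ) (b ψ) + reInner (a' ψ) (c' ψ)) ≤ 2 * deficit a a' b b' c c' ψ := by
  have h1 := agreeProb_le h.refl_a h.refl_b h.refl_c h.ab h.ac h.bc ψ
  have h2 := agreeProb_le h.refl_a' h.refl_c' h.refl_b' h.a'c' h.a'b' (fun u => (h.b'c' u).symm) ψ
  rw [agreeProb_comm] at h2
  rw [hψ] at h1 h2
  rw [deficit]
  linarith

theorem IsTriple.deficit_nonneg (h : IsTriple a a' b b' c c') (hψ : ‖ψ‖ = 1) :
    0 ≤ deficit a a' b b' c c' ψ := by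
  have h1 := (sq_nonneg _).trans (h.sq_norm_le hψ)
  have h2 := h.sqrt_two_sub_le hψ
  have : 0 < 2 * √2 := by positivity
  have := (mul_nonneg_iff_of_pos_left this).mp h1
  linarith

/-- The two preceding bounds combine to the factor `4√2 ≤ 8` in front of the deficit. -/
theorem IsTriple.norm_sum_sub_le (h : IsTriple a a' b b' c c') (hψ : ‖ψ‖ = 1) {κ : ℝ}
    (hκ : 0 ≤ κ) (hd : 8 * deficit a a' b b' c c' ψ ≤ κ ^ 2) :
    ‖a (b ψ) + a' (c' ψ) - ((√2 : ℝ) : ℂ) • ψ‖ ≤ κ := by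
  have h1 := h.sq_norm_le hψ
  have h2 := h.sqrt_two_sub_le hψ
  have h3 := h.deficit_nonneg hψ
  have h4 : √2 ≤ 2 := by rw [Real.sqrt_le_left (by norm_num)]; norm_num
  have h5 : 0 < √2 := by positivity
  refine abs_le_of_sq_le_sq' ?_ hκ |>.2
  nlinarith

/-- The first agreement is kept exact, which retains the term `⟨bc⟩`; the second is relaxed once to
Charlie and once to Bob. As `⟨ab⟩ + ⟨a'c'⟩` and `⟨ac⟩ + ⟨a'b'⟩` are at most `√2`, this leaves `1 -
⟨bc⟩ ≤ 4 · deficit`. -/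
theorem IsTriple.norm_sub_le (h : IsTriple a a' b b' c c') (hψ : ‖ψ‖ = 1) {κ : ℝ}
    (hκ : 0 ≤ κ) (hd : 8 * deficit a a' b b' c c' ψ ≤ κ ^ 2) : ‖b ψ - c ψ‖ ≤ κ := by
  have h1 : agreeProb a' b' c' ψ ≤ _ :=
    agreeProb_le h.refl_a' h.refl_b' h.refl_c' h.a'b' h.a'c' h.b'c' ψ
  have h1' : agreeProb a' c' b' ψ ≤ _ :=
    agreeProb_le h.refl_a' h.refl_c' h.refl_b' h.a'c' h.a'b' (fun u => (h.b'c' u).symm) ψ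
  rw [agreeProb_comm] at h1'
  have h2 := (sq_nonneg _).trans (h.sq_norm_le hψ)
  have h3 := (sq_nonneg _).trans (h.swapBC.sq_norm_le hψ)
  have h5 : 0 < 2 * √2 := by positivity
  have h2 := (mul_nonneg_iff_of_pos_left h5).mp h2
  have h3 := (mul_nonneg_iff_of_pos_left h5).mp h3
  refine abs_le_of_sq_le_sq' ?_ hκ |>.2
  rw [← reInner_self]
  simp only [reInner_sub_left, reInner_sub_right]
  simp only [reInner_self, h.refl_b.norm, h.refl_c.norm]
  rw [reInner_comm (c ψ), hψ]
  rw [hψ] at h1 h1'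
  have h6 : agreeProb a b c ψ = (1 + reInner (a ψ) (b ψ) + reInner (a ψ) (c ψ) +
    reInner (b ψ) (c ψ)) / 4 := by rw [agreeProb, hψ]; norm_num
  have h7 : deficit a a' b b' c c' ψ = 1 + √2 / 2 - agreeProb a b c ψ - agreeProb a' b' c' ψ := rfl
  nlinarith

end Abstract

/-! ### All questions of the repeated game: choice of a good question -/

section Family

variable {H : Type*} [NormedAddCommGroup H] [InnerProductSpace ℂ H]

theorem IsReflection.dist_map {b : H →L[ℂ] H} (hb : IsReflection b) (u v : H) :
    dist (b u) (b v) = dist u v := by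
  rw [dist_eq_norm, dist_eq_norm, ← map_sub, hb.norm]

theorem IsReflection.dist_le {b : H →L[ℂ] H} (hb : IsReflection b) {u v : H} {r : ℝ}
    (h : dist u v ≤ r) : dist (b u) (b v) ≤ r := by
  rwa [hb.dist_map]

theorem fin_two_add_one_add_one (e : Fin 2) : e + 1 + 1 = e := by
  revert e
  decide

/-- All bits of a question flipped. -/
def flipAll {n : ℕ} : Equiv.Perm (Fin n → Fin 2) :=
  Function.Involutive.toPerm (fun θ i => θ i + 1) fun θ => by
    funext i
    exact fin_two_add_one_add_one _

/-- The bit `j` of a question flipped. -/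
def flipAt {n : ℕ} (j : Fin n) : Equiv.Perm (Fin n → Fin 2) :=
  Function.Involutive.toPerm (fun θ => Function.update θ j (θ j + 1)) fun θ => by
    funext i
    by_cases h : i = j
    · subst h
      simp only [Function.update_self, fin_two_add_one_add_one]
    · simp [h]

theorem flipAll_apply {n : ℕ} (θ : Fin n → Fin 2) (i : Fin n) : flipAll θ i = θ i + 1 := rfl

theorem flipAt_self {n : ℕ} (θ : Fin n → Fin 2) (i : Fin n) : flipAt i θ i = θ i + 1 :=
  Function.update_self ..

theorem flipAt_of_ne {n : ℕ} (θ : Fin n → Fin 2) {i j : Fin n} (h : i ≠ j) :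
    flipAt j θ i = θ i :=
  Function.update_of_ne h ..

theorem fin_two_add_one_ne (e : Fin 2) : e + 1 ≠ e := by
  revert e
  decide

theorem fin_two_ne_add_one (e : Fin 2) : e ≠ e + 1 := (fin_two_add_one_ne e).symm

/-- The observables of the three players in an `n`-fold parallel repetition: Alice has a pair of
anticommuting observables for each `i`, while the `i`-th observables of Bob and Charlie may depend
on the whole question. -/
structure IsFamily {n : ℕ} (a : Fin n → Fin 2 → H →L[ℂ] H)
    (b c : (Fin n → Fin 2) → Fin n → H →L[ℂ] H) : Prop where
  refl_a : ∀ i e, IsReflection (a i e)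
  refl_b : ∀ θ i, IsReflection (b θ i)
  refl_c : ∀ θ i, IsReflection (c θ i)
  anti : ∀ i e e', e ≠ e' → ∀ u, a i e (a i e' u) = -a i e' (a i e u)
  ab : ∀ i e θ j u, a i e (b θ j u) = b θ j (a i e u)
  ac : ∀ i e θ j u, a i e (c θ j u) = c θ j (a i e u)
  bc : ∀ θ i θ' j u, b θ i (c θ' j u) = c θ' j (b θ i u)
  bb : ∀ θ i j u, b θ i (b θ j u) = b θ j (b θ i u)

variable {n : ℕ} {a : Fin n → Fin 2 → H →L[ℂ] H} {b c : (Fin n → Fin 2) → Fin n → H →L[ℂ] H}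
  {ψ : H}

theorem IsFamily.isTriple (h : IsFamily a b c) (i : Fin n) {θ θ' : Fin n → Fin 2}
    (hθ : θ i ≠ θ' i) :
    IsTriple (a i (θ i)) (a i (θ' i)) (b θ i) (b θ' i) (c θ i) (c θ' i) :=
  ⟨h.refl_a _ _, h.refl_a _ _, h.refl_b _ _, h.refl_b _ _, h.refl_c _ _, h.refl_c _ _,
    h.anti _ _ _ hθ, h.ab _ _ _ _, h.ab _ _ _ _, h.ab _ _ _ _, h.ab _ _ _ _, h.ac _ _ _ _,
    h.ac _ _ _ _, h.ac _ _ _ _, h.ac _ _ _ _, h.bc _ _ _ _, h.bc _ _ _ _, h.bc _ _ _ _,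
    h.bc _ _ _ _⟩

/-- The deficit of a family in the `i`-th game for a pair of questions. -/
def pairDeficit (a : Fin n → Fin 2 → H →L[ℂ] H) (b c : (Fin n → Fin 2) → Fin n → H →L[ℂ] H)
    (ψ : H) (i : Fin n) (θ θ' : Fin n → Fin 2) : ℝ :=
  deficit (a i (θ i)) (a i (θ' i)) (b θ i) (b θ' i) (c θ i) (c θ' i) ψ

/-- A permutation of the questions does not change the average score, and twice the optimal score
`cos²(π/8)` is `1 + √2/2`, the constant in `deficit`. -/
theorem sum_pairDeficit_le {ε : ℝ} {i : Fin n}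
    (hw : Real.cos (Real.pi / 8) ^ 2 - ε ≤
      ∑ θ, (1 / 2 : ℝ) ^ n * agreeProb (a i (θ i)) (b θ i) (c θ i) ψ)
    (σ τ : Equiv.Perm (Fin n → Fin 2)) :
    ∑ θ, pairDeficit a b c ψ i (σ θ) (τ θ) ≤ 2 ^ n * (2 * ε) := by
  have hc : Real.cos (Real.pi / 8) ^ 2 = (1 + √2 / 2) / 2 := by
    rw [Real.cos_sq, show 2 * (Real.pi / 8) = Real.pi / 4 by ring, Real.cos_pi_div_four]
    ring
  simp only [pairDeficit, deficit, Finset.sum_sub_distrib]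
  rw [Equiv.sum_comp σ (fun θ => agreeProb (a i (θ i)) (b θ i) (c θ i) ψ),
    Equiv.sum_comp τ (fun θ => agreeProb (a i (θ i)) (b θ i) (c θ i) ψ)]
  rw [← Finset.mul_sum, hc, one_div, inv_pow, inv_mul_eq_div, le_div_iff₀ (by positivity)] at hw
  simp
  linarith

/-- Averaging: each of the `n(n+1)` kinds of pairs has average deficit at most `2ε`, so some θ has
total deficit at most `2n(n+1)ε`, and all summands are nonnegative. -/
theorem IsFamily.exists_pairDeficit_le (h : IsFamily a b c) (hψ : ‖ψ‖ = 1) {ε : ℝ}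
    (hw : ∀ i, Real.cos (Real.pi / 8) ^ 2 - ε ≤
      ∑ θ, (1 / 2 : ℝ) ^ n * agreeProb (a i (θ i)) (b θ i) (c θ i) ψ) :
    ∃ θ : Fin n → Fin 2,
      (∀ i, pairDeficit a b c ψ i θ (flipAll θ) ≤ 2 * n * (n + 1) * ε) ∧
      (∀ i, pairDeficit a b c ψ i (flipAt i θ) θ ≤ 2 * n * (n + 1) * ε) ∧
      (∀ i j, i ≠ j → pairDeficit a b c ψ i (flipAt j θ) (flipAll θ) ≤ 2 * n * (n + 1) * ε) := by
  -- The second index is the game. Its pair is θ and its complement for `none`; for `some j`, one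
  -- member is θ with bit j flipped, and the partner is whichever of θ and the complement has the
  -- other bit in that game.
  let σ : Option (Fin n) × Fin n → Equiv.Perm (Fin n → Fin 2)
    | (none, _) => 1
    | (some j, _) => flipAt j
  let τ : Option (Fin n) × Fin n → Equiv.Perm (Fin n → Fin 2)
    | (none, _) => flipAll
    | (some j, i) => if i = j then 1 else flipAll
  have hne : ∀ k θ, σ k θ k.2 ≠ τ k θ k.2 := by
    rintro ⟨_ | j, i⟩ θ
    · exact fin_two_ne_add_one _
    · by_cases hij : i = j
      · subst hij
        simpa [σ, τ, flipAt_self] using fin_two_add_one_ne _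
      · simpa [σ, τ, hij, flipAt_of_ne, flipAll_apply] using fin_two_ne_add_one _
  have hnn : ∀ k θ, 0 ≤ pairDeficit a b c ψ k.2 (σ k θ) (τ k θ) := fun k θ =>
    (h.isTriple k.2 (hne k θ)).deficit_nonneg hψ
  obtain ⟨θ, -, hθ⟩ : ∃ θ ∈ (Finset.univ : Finset (Fin n → Fin 2)),
      ∑ k, pairDeficit a b c ψ k.2 (σ k θ) (τ k θ) ≤ 2 * n * (n + 1) * ε := by
    refine Finset.exists_le_of_sum_le Finset.univ_nonempty ?_
    rw [Finset.sum_comm]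
    refine (Finset.sum_le_sum fun k _ => sum_pairDeficit_le (hw k.2) (σ k) (τ k)).trans
      (le_of_eq ?_)
    simp
    ring
  have hk : ∀ k, pairDeficit a b c ψ k.2 (σ k θ) (τ k θ) ≤ 2 * n * (n + 1) * ε := fun k =>
    (Finset.single_le_sum (fun k _ => hnn k θ) (Finset.mem_univ k)).trans hθ
  refine ⟨θ, fun i => hk (none, i), fun i => ?_, fun i j hij => ?_⟩
  · simpa [σ, τ] using hk (some i, i)
  · simpa [σ, τ, hij] using hk (some j, i)

theorem IsTriple.dist_sum_le {a a' b b' c c' : H →L[ℂ] H} (h : IsTriple a a' b b' c c')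
    (hψ : ‖ψ‖ = 1) {κ : ℝ} (hκ : 0 ≤ κ) (hd : 8 * deficit a a' b b' c c' ψ ≤ κ ^ 2) :
    dist (a (b ψ)) (((√2 : ℝ) : ℂ) • ψ - a' (c' ψ)) ≤ κ := by
  rw [dist_eq_norm, sub_sub_eq_add_sub]
  exact h.norm_sum_sub_le hψ hκ hd

/-- Bob's answers to a question hardly depend on the bits of the question for the other games. -/
theorem IsTriple.dist_of_partner {a a' b₁ b₂ b' c₁ c₂ c' : H →L[ℂ] H}
    (h₁ : IsTriple a a' b₁ b' c₁ c') (h₂ : IsTriple a a' b₂ b' c₂ c') (hψ : ‖ψ‖ = 1) {κ : ℝ}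
    (hκ : 0 ≤ κ) (hd₁ : 8 * deficit a a' b₁ b' c₁ c' ψ ≤ κ ^ 2)
    (hd₂ : 8 * deficit a a' b₂ b' c₂ c' ψ ≤ κ ^ 2) : dist (b₁ ψ) (b₂ ψ) ≤ 2 * κ := by
  rw [← h₁.refl_a.dist_map]
  refine (dist_triangle_right _ _ _).trans
    ((add_le_add (h₁.dist_sum_le hψ hκ hd₁) (h₂.dist_sum_le hψ hκ hd₂)).trans_eq ?_)
  ring

/-- Within one game no interpolating question is available. Instead `bψ` is replaced by `ay` with `y
= √2ψ - a'c'ψ`, which involves no observable for the first question except Alice's. Both sides are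
then reduced to `c'ay` and `b'ay`, which are compared through `b'ψ ≈ c'ψ`. -/
theorem IsTriple.dist_swap_le {a a' b b' c c' : H →L[ℂ] H} (h : IsTriple a a' b b' c c')
    (hψ : ‖ψ‖ = 1) {κ : ℝ} (hκ : 0 ≤ κ) (hd : 8 * deficit a a' b b' c c' ψ ≤ κ ^ 2) :
    dist (b (b' ψ)) (c (b' ψ)) ≤ 7 * κ := by
  have hd' : 8 * deficit a' a b' b c' c ψ ≤ κ ^ 2 := by rwa [deficit_swapQ]
  have e1 : dist (b ψ) (c ψ) ≤ κ := dist_eq_norm (b ψ) _ ▸ h.norm_sub_le hψ hκ hd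
  have e2 : dist (b' ψ) (c' ψ) ≤ κ := dist_eq_norm (b' ψ) _ ▸ h.swapQ.norm_sub_le hψ hκ hd'
  have e3 := h.dist_sum_le hψ hκ hd
  set y := ((√2 : ℝ) : ℂ) • ψ - a' (c' ψ) with hy
  have e4 : dist (b ψ) (a y) ≤ κ := by rw [← h.refl_a.dist_map, h.refl_a.sq]; exact e3
  have x1 : dist (b (b' ψ)) (c' (b ψ)) ≤ κ := by rw [← h.bc']; exact h.refl_b.dist_le e2
  have x2 : dist (c' (b ψ)) (c' (a y)) ≤ κ := h.refl_c'.dist_le e4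
  have y1 : dist (c (b' ψ)) (b' (b ψ)) ≤ κ := by
    rw [← h.b'c, dist_comm]; exact h.refl_b'.dist_le e1
  have y2 : dist (b' (b ψ)) (b' (a y)) ≤ κ := h.refl_b'.dist_le e4
  -- The two terms of y contribute `√2κ` and κ.
  have z : dist (c' (a y)) (b' (a y)) ≤ 3 * κ := by
    have hc' : c' (a y) = ((√2 : ℝ) : ℂ) • a (c' ψ) - a (a' (c' (c' ψ))) := by
      rw [hy, ← h.ac']
      simp only [map_sub, map_smul]
      rw [← h.a'c']
    have hb' : b' (a y) = ((√2 : ℝ) : ℂ) • a (b' ψ) - a (a' (c' (b' ψ))) := by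
      rw [hy, ← h.ab']
      simp only [map_sub, map_smul]
      rw [← h.a'b', h.b'c']
    rw [hc', hb']
    refine (dist_sub_sub_le _ _ _ _).trans ?_
    rw [dist_smul₀, h.refl_a.dist_map, h.refl_a.dist_map, h.refl_a'.dist_map,
      h.refl_c'.dist_map, dist_comm, Complex.norm_real, Real.norm_of_nonneg (by positivity)]
    have : √2 ≤ 2 := by rw [Real.sqrt_le_left (by norm_num)]; norm_num
    nlinarith [dist_nonneg (x := b' ψ) (y := c' ψ)]
  have t1 := dist_triangle4 (b (b' ψ)) (c' (b ψ)) (c' (a y)) (b' (a y))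
  have t2 := dist_triangle4 (b (b' ψ)) (b' (a y)) (b' (b ψ)) (c (b' ψ))
  rw [dist_comm (b' (a y)), dist_comm (b' (b ψ)) (c (b' ψ))] at t2
  linarith

/-- Near-optimal strategies have a question for which the answers of Bob and Charlie to it and to
the complementary question are nearly consistent and nearly commute. -/
theorem IsFamily.exists_question (h : IsFamily a b c) (hψ : ‖ψ‖ = 1) {ε : ℝ} (hε : 0 ≤ ε)
    (hn : 1 ≤ n) (hw : ∀ i, Real.cos (Real.pi / 8) ^ 2 - ε ≤
      ∑ θ, (1 / 2 : ℝ) ^ n * agreeProb (a i (θ i)) (b θ i) (c θ i) ψ) :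
    ∃ θ : Fin n → Fin 2, ∃ κ, 0 ≤ κ ∧ κ = 6 * n * √ε ∧
      (∀ i, dist (b θ i ψ) (c θ i ψ) ≤ κ) ∧
      (∀ i, dist (b (flipAll θ) i ψ) (c (flipAll θ) i ψ) ≤ κ) ∧
      (∀ i, dist (a i (θ i) (b θ i ψ) + a i (flipAll θ i) (b (flipAll θ) i ψ))
        (((√2 : ℝ) : ℂ) • ψ) ≤ 2 * κ) ∧
      (∀ i j, dist (b θ j (b (flipAll θ) i ψ)) (c θ j (b (flipAll θ) i ψ)) ≤ 11 * κ) ∧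
      (∀ i j, dist (b θ j (c (flipAll θ) i ψ)) (c θ j (c (flipAll θ) i ψ)) ≤ 13 * κ) := by
  obtain ⟨θ, h1, h2, h3⟩ := h.exists_pairDeficit_le hψ hw
  have hκ : 0 ≤ 6 * n * √ε := by positivity
  refine ⟨θ, _, hκ, rfl, ?_⟩
  set κ := 6 * n * √ε with hκdef
  -- Since `n + 1 ≤ 2n`, the left side is at most `32n²ε`; hence the factor 6 in κ.
  have hκ2 : 8 * (2 * n * (n + 1) * ε) ≤ κ ^ 2 := by
    have hn' : (1 : ℝ) ≤ n := by exact_mod_cast hn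
    rw [hκdef, mul_pow, Real.sq_sqrt hε]
    have : (n : ℝ) * (n + 1) ≤ 2 * n ^ 2 := by nlinarith
    nlinarith [mul_le_mul_of_nonneg_right this hε, mul_nonneg (sq_nonneg (n : ℝ)) hε]
  have k1 := fun i => (mul_le_mul_of_nonneg_left (h1 i) (by norm_num : (0:ℝ) ≤ 8)).trans hκ2
  have k2 := fun i => (mul_le_mul_of_nonneg_left (h2 i) (by norm_num : (0:ℝ) ≤ 8)).trans hκ2
  have k3 := fun i j hij =>
    (mul_le_mul_of_nonneg_left (h3 i j hij) (by norm_num : (0:ℝ) ≤ 8)).trans hκ2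
  have T1 : ∀ i, IsTriple (a i (θ i)) (a i (flipAll θ i)) (b θ i) (b (flipAll θ) i) (c θ i)
      (c (flipAll θ) i) := fun i => h.isTriple i (fin_two_ne_add_one _)
  have T2 : ∀ i, IsTriple (a i (flipAt i θ i)) (a i (θ i)) (b (flipAt i θ) i) (b θ i)
      (c (flipAt i θ) i) (c θ i) := fun i => h.isTriple i (by
        rw [flipAt_self]; exact fin_two_add_one_ne _)
  have T3 : ∀ i j, i ≠ j → IsTriple (a i (flipAt j θ i)) (a i (flipAll θ i)) (b (flipAt j θ) i)
      (b (flipAll θ) i) (c (flipAt j θ) i) (c (flipAll θ) i) := fun i j hij => h.isTriple i (by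
        rw [flipAt_of_ne _ hij]; exact fin_two_ne_add_one _)
  have k1' : ∀ i, 8 * deficit (a i (flipAll θ i)) (a i (θ i)) (b (flipAll θ) i) (b θ i)
      (c (flipAll θ) i) (c θ i) ψ ≤ κ ^ 2 := fun i => by
    rw [deficit_swapQ]; exact k1 i
  have r1 : ∀ i, dist (b θ i ψ) (c θ i ψ) ≤ κ := fun i =>
    dist_eq_norm (b θ i ψ) _ ▸ (T1 i).norm_sub_le hψ hκ (k1 i)
  have r1' : ∀ i, dist (b (flipAll θ) i ψ) (c (flipAll θ) i ψ) ≤ κ := fun i =>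
    dist_eq_norm (b (flipAll θ) i ψ) _ ▸ (T1 i).swapQ.norm_sub_le hψ hκ (k1' i)
  have r2 : ∀ i, dist (b (flipAt i θ) i ψ) (c (flipAt i θ) i ψ) ≤ κ := fun i =>
    dist_eq_norm (b (flipAt i θ) i ψ) _ ▸ (T2 i).norm_sub_le hψ hκ (k2 i)
  -- Common partner θ in game i.
  have s1 : ∀ i, dist (b (flipAll θ) i ψ) (b (flipAt i θ) i ψ) ≤ 2 * κ := fun i => by
    have t := T2 i
    have k := k2 i
    simp only [pairDeficit] at k
    have e : flipAt i θ i = flipAll θ i := by rw [flipAt_self, flipAll_apply]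
    rw [e] at t k
    exact (T1 i).swapQ.dist_of_partner t hψ hκ (k1' i) k
  -- Common partner, the complement of θ, in game i.
  have s2 : ∀ i j, i ≠ j → dist (b θ i ψ) (b (flipAt j θ) i ψ) ≤ 2 * κ := fun i j hij => by
    have t := T3 i j hij
    have k := k3 i j hij
    simp only [pairDeficit] at k
    rw [flipAt_of_ne θ hij] at t k
    exact (T1 i).dist_of_partner t hψ hκ (k1 i) k
  have main : ∀ i j, dist (b θ j (b (flipAll θ) i ψ)) (c θ j (b (flipAll θ) i ψ)) ≤ 11 * κ := by
    intro i j
    by_cases hij : j = i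
    · subst hij
      exact ((T1 j).dist_swap_le hψ hκ (k1 j)).trans (by linarith)
    -- θ₁ agrees with the complement in game i and with θ in game j. Errors `6κ` and `5κ` bring the
    -- two vectors to `b θ₁ j (b θ₁ i ψ)`; the second path uses that these two observables commute.
    · set θ₁ := flipAt i θ
      have x1 : dist (b θ j (b (flipAll θ) i ψ)) (b θ j (b θ₁ i ψ)) ≤ 2 * κ :=
        (h.refl_b _ _).dist_le (s1 i)
      have x2 : dist (b θ j (b θ₁ i ψ)) (c θ₁ i (b θ j ψ)) ≤ κ := by
        rw [← h.bc]; exact (h.refl_b _ _).dist_le (r2 i)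
      have x3 : dist (c θ₁ i (b θ j ψ)) (c θ₁ i (b θ₁ j ψ)) ≤ 2 * κ :=
        (h.refl_c _ _).dist_le (s2 j i hij)
      have x4 : dist (c θ₁ i (b θ₁ j ψ)) (b θ₁ j (b θ₁ i ψ)) ≤ κ := by
        rw [← h.bc, dist_comm]; exact (h.refl_b _ _).dist_le (r2 i)
      have y1 : dist (c θ j (b (flipAll θ) i ψ)) (b θ₁ i (c θ j ψ)) ≤ 2 * κ := by
        rw [h.bc]; exact (h.refl_c _ _).dist_le (s1 i)
      have y2 : dist (b θ₁ i (c θ j ψ)) (b θ₁ i (b θ j ψ)) ≤ κ := by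
        rw [dist_comm]; exact (h.refl_b _ _).dist_le (r1 j)
      have y3 : dist (b θ₁ i (b θ j ψ)) (b θ₁ j (b θ₁ i ψ)) ≤ 2 * κ := by
        rw [h.bb θ₁ j i]; exact (h.refl_b _ _).dist_le (s2 j i hij)
      have t1 := dist_triangle4 (b θ j (b (flipAll θ) i ψ)) (b θ j (b θ₁ i ψ)) (c θ₁ i (b θ j ψ))
        (c θ₁ i (b θ₁ j ψ))
      have t2 := dist_triangle4 (c θ j (b (flipAll θ) i ψ)) (b θ₁ i (c θ j ψ)) (b θ₁ i (b θ j ψ))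
        (b θ₁ j (b θ₁ i ψ))
      have t3 := dist_triangle (b θ j (b (flipAll θ) i ψ)) (c θ₁ i (b θ₁ j ψ))
        (b θ₁ j (b θ₁ i ψ))
      have t4 := dist_triangle_right (b θ j (b (flipAll θ) i ψ)) (c θ j (b (flipAll θ) i ψ))
        (b θ₁ j (b θ₁ i ψ))
      linarith
  refine ⟨r1, r1', fun i => ?_, main, fun i j => ?_⟩
  · have t := (T1 i).dist_sum_le hψ hκ (k1 i)
    have e : dist (a i (flipAll θ i) (b (flipAll θ) i ψ)) (a i (flipAll θ i) (c (flipAll θ) i ψ))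
      ≤ κ := (h.refl_a _ _).dist_le (r1' i)
    have t' := dist_add_add_le (a i (θ i) (b θ i ψ)) (a i (flipAll θ i) (b (flipAll θ) i ψ))
      (((√2 : ℝ) : ℂ) • ψ - a i (flipAll θ i) (c (flipAll θ) i ψ))
      (a i (flipAll θ i) (c (flipAll θ) i ψ))
    rw [sub_add_cancel] at t'
    linarith
  · have e1 : dist (b θ j (c (flipAll θ) i ψ)) (b θ j (b (flipAll θ) i ψ)) ≤ κ := by
      rw [dist_comm]; exact (h.refl_b _ _).dist_le (r1' i)
    have e2 : dist (c θ j (b (flipAll θ) i ψ)) (c θ j (c (flipAll θ) i ψ)) ≤ κ :=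
      (h.refl_c _ _).dist_le (r1' i)
    have t := dist_triangle4 (b θ j (c (flipAll θ) i ψ)) (b θ j (b (flipAll θ) i ψ))
      (c θ j (b (flipAll θ) i ψ)) (c θ j (c (flipAll θ) i ψ))
    linarith [main i j]

end Family

/-! ### Projective measurements of bit strings versus their single-bit observables -/

section Projective

/-- The sign `(-1)^e` of a bit. -/
def bitSign (e : Fin 2) : ℝ := (-1) ^ (e : ℕ)

theorem bitSign_mul_self (e : Fin 2) : bitSign e * bitSign e = 1 := by
  rw [bitSign, ← pow_add, Even.neg_one_pow ⟨_, rfl⟩]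

theorem bitSign_sub_sq (e e' : Fin 2) :
    (bitSign e - bitSign e') ^ 2 = if e = e' then 0 else 4 := by
  fin_cases e <;> fin_cases e' <;> norm_num [bitSign]

variable {H : Type*} [NormedAddCommGroup H] [InnerProductSpace ℂ H]

/-- A projection-valued measurement. -/
structure IsPVM {X : Type*} [Fintype X] [DecidableEq X] (P : X → H →L[ℂ] H) : Prop where
  symm : ∀ x u v, inner ℂ (P x u) v = inner ℂ u (P x v)
  mul : ∀ x y u, P x (P y u) = if x = y then P x u else 0
  sum : ∀ u, ∑ x, P x u = u

section

variable {X : Type*} [Fintype X] [DecidableEq X] {P : X → H →L[ℂ] H}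

theorem IsPVM.norm_sq (hP : IsPVM P) (x : X) (u : H) : ‖P x u‖ ^ 2 = reInner (P x u) u := by
  rw [← reInner_self, reInner, reInner, hP.symm, hP.symm, hP.mul, if_pos rfl]

theorem IsPVM.sum_norm_sq (hP : IsPVM P) (u : H) : ∑ x, ‖P x u‖ ^ 2 = ‖u‖ ^ 2 := by
  simp only [hP.norm_sq, reInner]
  rw [← Complex.re_sum, ← sum_inner, hP.sum, ← reInner_self, reInner]

end

variable {n : ℕ}

/-- The `i`-th observable of a measurement whose outcomes are strings of bits. -/
def observable (P : (Fin n → Fin 2) → H →L[ℂ] H) (i : Fin n) : H →L[ℂ] H :=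
  ∑ x, ((bitSign (x i) : ℝ) : ℂ) • P x

theorem observable_apply (P : (Fin n → Fin 2) → H →L[ℂ] H) (i : Fin n) (u : H) :
    observable P i u = ∑ x, ((bitSign (x i) : ℝ) : ℂ) • P x u := by
  simp [observable, _root_.sum_apply]

variable {P Q P' Q' : (Fin n → Fin 2) → H →L[ℂ] H}

theorem IsPVM.apply_observable (hP : IsPVM P) (i : Fin n) (x : Fin n → Fin 2) (u : H) :
    P x (observable P i u) = ((bitSign (x i) : ℝ) : ℂ) • P x u := by
  simp [observable_apply, hP.mul]

theorem IsPVM.isReflection (hP : IsPVM P) (i : Fin n) : IsReflection (observable P i) where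
  symm u v := by
    simp only [observable_apply, sum_inner, inner_sum, inner_smul_left, inner_smul_right, hP.symm,
      Complex.conj_ofReal]
  sq u := by
    conv_lhs => rw [observable_apply]
    simp only [hP.apply_observable, smul_smul, ← Complex.ofReal_mul, bitSign_mul_self]
    simpa using hP.sum u

theorem IsPVM.observable_comm (hP : IsPVM P) (i j : Fin n) (u : H) :
    observable P i (observable P j u) = observable P j (observable P i u) := by
  rw [observable_apply P i (observable P j u), observable_apply P j (observable P i u)]
  simp only [hP.apply_observable, smul_smul, mul_comm]

theorem observable_commute {T : H →L[ℂ] H} (h : ∀ x u, P x (T u) = T (P x u)) (i : Fin n)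
    (u : H) : observable P i (T u) = T (observable P i u) := by
  simp [observable_apply, h, map_sum, map_smul]

/-- The event that two strings differ has probability at most the sum of the probabilities that
they differ at the single bits. -/
theorem one_le_sum_bitSign {x y : Fin n → Fin 2} (h : x ≠ y) :
    4 ≤ ∑ j, (bitSign (x j) - bitSign (y j)) ^ 2 := by
  obtain ⟨j, hj⟩ := Function.ne_iff.mp h
  refine le_trans ?_ (Finset.single_le_sum (fun j _ => sq_nonneg _) (Finset.mem_univ j))
  rw [bitSign_sub_sq, if_neg hj]

/-- For the joint distribution `‖P x (Q y w)‖²` of the commuting measurements, the left side is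
twice the weight of `x ≠ y`, and the j-th norm on the right is four times the weight of `x j ≠ y j`.
The claim is a union bound over bits. -/
theorem IsPVM.sum_norm_sub_sq_le (hP : IsPVM P) (hQ : IsPVM Q)
    (hPQ : ∀ x y u, P x (Q y u) = Q y (P x u)) (w : H) :
    ∑ x, ‖P x w - Q x w‖ ^ 2 ≤ (1 / 2) * ∑ j, ‖observable P j w - observable Q j w‖ ^ 2 := by
  have e1 : ∀ x, ‖P x w - Q x w‖ ^ 2 = ‖P x w‖ ^ 2 + ‖Q x w‖ ^ 2 - 2 * ‖P x (Q x w)‖ ^ 2 := by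
    intro x
    have : ‖P x (Q x w)‖ ^ 2 = reInner (P x w) (Q x w) := by
      rw [hP.norm_sq, reInner, reInner, hPQ, hQ.symm, hQ.mul, if_pos rfl]
    rw [this, ← reInner_self, ← reInner_self, ← reInner_self, reInner_sub_left, reInner_sub_right,
      reInner_sub_right, reInner_comm (Q x w)]
    ring
  have e2 : ‖w‖ ^ 2 = ∑ y, ∑ x, ‖P x (Q y w)‖ ^ 2 := by
    simp only [hP.sum_norm_sq, hQ.sum_norm_sq]
  have e3 : ∀ j, ‖observable P j w - observable Q j w‖ ^ 2 =
      ∑ y, ∑ x, (bitSign (x j) - bitSign (y j)) ^ 2 * ‖P x (Q y w)‖ ^ 2 := by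
    intro j
    rw [← hQ.sum_norm_sq]
    refine Finset.sum_congr rfl fun y _ => ?_
    rw [← hP.sum_norm_sq]
    refine Finset.sum_congr rfl fun x _ => ?_
    have : P x (Q y (observable P j w - observable Q j w)) =
        ((bitSign (x j) - bitSign (y j) : ℝ) : ℂ) • P x (Q y w) := by
      rw [map_sub, map_sub, hQ.apply_observable, hPQ, hP.apply_observable, map_smul, map_smul,
        ← hPQ, ← sub_smul, Complex.ofReal_sub]
    rw [this, norm_smul, mul_pow, Complex.norm_real, Real.norm_eq_abs, sq_abs]
  have e4 : ∑ j, ‖observable P j w - observable Q j w‖ ^ 2 =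
      ∑ y, ∑ x, (∑ j, (bitSign (x j) - bitSign (y j)) ^ 2) * ‖P x (Q y w)‖ ^ 2 := by
    simp only [e3, Finset.sum_mul]
    rw [Finset.sum_comm]
    exact Finset.sum_congr rfl fun y _ => Finset.sum_comm
  have e5 : ∑ x, ‖P x (Q x w)‖ ^ 2 =
      ∑ y, ∑ x, if x = y then ‖P x (Q y w)‖ ^ 2 else 0 := by
    simp
  have e6 : ∑ x, ‖P x w - Q x w‖ ^ 2 = 2 * (‖w‖ ^ 2 - ∑ x, ‖P x (Q x w)‖ ^ 2) := by
    simp only [e1, Finset.sum_sub_distrib, Finset.sum_add_distrib, hP.sum_norm_sq,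
      hQ.sum_norm_sq, ← Finset.mul_sum]
    ring
  rw [e6, e5, e4, e2, ← Finset.sum_sub_distrib, Finset.mul_sum, Finset.mul_sum]
  refine Finset.sum_le_sum fun y _ => ?_
  rw [← Finset.sum_sub_distrib, Finset.mul_sum, Finset.mul_sum]
  refine Finset.sum_le_sum fun x _ => ?_
  split_ifs with hxy
  · rw [sub_self, mul_zero]
    positivity
  · have := one_le_sum_bitSign hxy
    nlinarith [sq_nonneg ‖P x (Q y w)‖]

/-- As T commutes with each `Q x`, its commutator with `P x` equals its commutator with `P x - Q x`,
which the preceding lemma controls at `u` and `T u`. -/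
theorem IsPVM.sum_commutator_le (hP : IsPVM P) (hQ : IsPVM Q)
    (hPQ : ∀ x y u, P x (Q y u) = Q y (P x u)) {T : H →L[ℂ] H} (hT : IsReflection T)
    (hTQ : ∀ x u, T (Q x u) = Q x (T u)) (u : H) :
    ∑ x, ‖T (P x u) - P x (T u)‖ ^ 2 ≤
      ∑ j, ‖observable P j u - observable Q j u‖ ^ 2 +
        ∑ j, ‖observable P j (T u) - observable Q j (T u)‖ ^ 2 := by
  have h1 := hP.sum_norm_sub_sq_le hQ hPQ u
  have h2 := hP.sum_norm_sub_sq_le hQ hPQ (T u)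
  have h3 : ∑ x, ‖T (P x u) - P x (T u)‖ ^ 2 ≤
      2 * ∑ x, ‖P x u - Q x u‖ ^ 2 + 2 * ∑ x, ‖P x (T u) - Q x (T u)‖ ^ 2 := by
    rw [Finset.mul_sum, Finset.mul_sum, ← Finset.sum_add_distrib]
    refine Finset.sum_le_sum fun x _ => ?_
    have : T (P x u) - P x (T u) = T (P x u - Q x u) - (P x (T u) - Q x (T u)) := by
      rw [map_sub, hTQ]
      abel
    rw [this]
    have := norm_sub_le (T (P x u - Q x u)) (P x (T u) - Q x (T u))
    rw [hT.norm] at this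
    have := pow_le_pow_left₀ (norm_nonneg _) this 2
    nlinarith [sq_nonneg (‖P x u - Q x u‖ - ‖P x (T u) - Q x (T u)‖)]
  linarith

end Projective

/-! ### Recording joint outcomes and rounding the recorded state -/

section Rounding

variable {H : Type*} [NormedAddCommGroup H] [InnerProductSpace ℂ H] {n : ℕ}

theorem norm_add₃_sq_le {E : Type*} [SeminormedAddCommGroup E] (x y z : E) :
    ‖x + y + z‖ ^ 2 ≤ 3 * (‖x‖ ^ 2 + ‖y‖ ^ 2 + ‖z‖ ^ 2) := by
  have h := pow_le_pow_left₀ (norm_nonneg _) (norm_add₃_le (a := x) (b := y) (c := z)) 2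
  nlinarith [sq_nonneg (‖x‖ - ‖y‖), sq_nonneg (‖x‖ - ‖z‖), sq_nonneg (‖y‖ - ‖z‖)]

/-- The joint outcomes `t` are recorded by `K` on Bob's side and by `L` on Charlie's side. If on `ψ`
the bits of the outcomes are close to observables with vectors `β i e` and `γ i e` that are close
to each other and nearly optimally correlated with Alice, then the recorded state is close to its
projection to equal outcomes and to the corresponding states of Alice. -/
theorem sum_norm_sub_rounded_le {a : Fin n → Fin 2 → H →L[ℂ] H}
    {K L : (Fin n → Fin 2 → Fin 2) → H →L[ℂ] H} {Γ : (Fin n → Fin 2 → Fin 2) → H →L[ℂ] H}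
    (ha : ∀ i e, IsReflection (a i e))
    (hK : ∀ u, ∑ t, ‖K t u‖ ^ 2 = ‖u‖ ^ 2) (hL : ∀ u, ∑ t, ‖L t u‖ ^ 2 = ‖u‖ ^ 2)
    (hKL : ∀ t s u, K t (L s u) = L s (K t u))
    (haK : ∀ i e t u, a i e (K t u) = K t (a i e u))
    (haL : ∀ i e t u, a i e (L t u) = L t (a i e u))
    (hΓ : ∀ t u, ‖u - Γ t u‖ ^ 2 ≤ ∑ i, (1 / 4) *
      ‖u - ((1 / √2 : ℝ) : ℂ) • ∑ e, ((bitSign (t i e) : ℝ) : ℂ) • a i e u‖ ^ 2)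
    {ψ : H} {β γ : Fin n → Fin 2 → H} {α κ : ℝ}
    (hβ : ∀ i e, ∑ t, ‖((bitSign (t i e) : ℝ) : ℂ) • K t ψ - K t (β i e)‖ ^ 2 ≤ α)
    (hγ : ∀ i e, ∑ t, ‖((bitSign (t i e) : ℝ) : ℂ) • L t ψ - L t (γ i e)‖ ^ 2 ≤ α)
    (hβγ : ∀ i e, ‖β i e - γ i e‖ ≤ κ)
    (hopt : ∀ i, ‖((√2 : ℝ) : ℂ) • ψ - ∑ e, a i e (β i e)‖ ≤ 2 * κ) :
    ∑ t, ∑ s, ‖K t (L s ψ) - if t = s then Γ t (K t (L s ψ)) else 0‖ ^ 2 ≤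
      n * (4 * α + 3 * κ ^ 2) := by
  have hKLsum : ∀ u, ∑ t, ∑ s, ‖K t (L s u)‖ ^ 2 = ‖u‖ ^ 2 := by
    intro u
    rw [Finset.sum_comm]
    simp only [hK, hL]
  have hLsum : ∀ f : (Fin n → Fin 2 → Fin 2) → H,
      ∑ t, ∑ s, ‖L s (f t)‖ ^ 2 = ∑ t, ‖f t‖ ^ 2 := by simp only [hL, implies_true]
  have hKsum : ∀ f : (Fin n → Fin 2 → Fin 2) → H,
      ∑ t, ∑ s, ‖K t (f s)‖ ^ 2 = ∑ s, ‖f s‖ ^ 2 := by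
    intro f
    rw [Finset.sum_comm]
    simp only [hK]
  -- The weight of records differing in the bit `(i, e)`: the two signs are traded for `β i e` and
  -- `γ i e`, which are close.
  have hA : ∀ i e, ∑ t, ∑ s, ((bitSign (t i e) - bitSign (s i e)) ^ 2 * ‖K t (L s ψ)‖ ^ 2) ≤
      3 * (2 * α + κ ^ 2) := by
    intro i e
    have hts : ∀ t s, (bitSign (t i e) - bitSign (s i e)) ^ 2 * ‖K t (L s ψ)‖ ^ 2 ≤
        3 * (‖L s (((bitSign (t i e) : ℝ) : ℂ) • K t ψ - K t (β i e))‖ ^ 2 +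
          ‖K t (L s (β i e - γ i e))‖ ^ 2 +
          ‖K t (((bitSign (s i e) : ℝ) : ℂ) • L s ψ - L s (γ i e))‖ ^ 2) := by
      intro t s
      have : ((bitSign (t i e) - bitSign (s i e) : ℝ) : ℂ) • K t (L s ψ) =
          L s (((bitSign (t i e) : ℝ) : ℂ) • K t ψ - K t (β i e)) + K t (L s (β i e - γ i e)) +
          -K t (((bitSign (s i e) : ℝ) : ℂ) • L s ψ - L s (γ i e)) := by
        simp only [map_sub, map_smul, ← hKL, Complex.ofReal_sub, sub_smul]
        abel
      have h2 := norm_add₃_sq_le (L s (((bitSign (t i e) : ℝ) : ℂ) • K t ψ - K t (β i e)))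
        (K t (L s (β i e - γ i e)))
        (-K t (((bitSign (s i e) : ℝ) : ℂ) • L s ψ - L s (γ i e)))
      rw [← this, norm_smul, mul_pow, Complex.norm_real, Real.norm_eq_abs, sq_abs, norm_neg] at h2
      exact h2
    refine (Finset.sum_le_sum fun t _ => Finset.sum_le_sum fun s _ => hts t s).trans ?_
    simp only [← Finset.mul_sum, Finset.sum_add_distrib, hLsum, hKLsum, hKsum]
    have h1 := hβ i e
    have h2 := hγ i e
    have h3 := pow_le_pow_left₀ (norm_nonneg _) (hβγ i e) 2
    linarith
  -- The optimality relation `√2ψ ≈ ∑ₑ aₑ βₑ` survives the recording, which converts `βₑ` into the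
  -- recorded sign.
  have hG : ∀ i, ∑ t, ∑ s, ‖K t (L s ψ) -
      ((1 / √2 : ℝ) : ℂ) • ∑ e, ((bitSign (t i e) : ℝ) : ℂ) • a i e (K t (L s ψ))‖ ^ 2 ≤
      3 * (2 * κ ^ 2 + α) := by
    intro i
    have h2 : (1 / √2 : ℝ) ^ 2 = 1 / 2 := by
      rw [div_pow, Real.sq_sqrt (by norm_num)]; norm_num
    have hnorm : ∀ w : H, ‖((1 / √2 : ℝ) : ℂ) • w‖ ^ 2 = (1 / 2) * ‖w‖ ^ 2 := by
      intro w
      rw [norm_smul, mul_pow, Complex.norm_real, Real.norm_eq_abs, sq_abs, h2]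
    have hts : ∀ t s, ‖K t (L s ψ) -
        ((1 / √2 : ℝ) : ℂ) • ∑ e, ((bitSign (t i e) : ℝ) : ℂ) • a i e (K t (L s ψ))‖ ^ 2 ≤
        3 * ((1 / 2) * ‖K t (L s (((√2 : ℝ) : ℂ) • ψ - ∑ e, a i e (β i e)))‖ ^ 2 +
          (1 / 2) * ‖L s (((bitSign (t i 0) : ℝ) : ℂ) • K t ψ - K t (β i 0))‖ ^ 2 +
          (1 / 2) * ‖L s (((bitSign (t i 1) : ℝ) : ℂ) • K t ψ - K t (β i 1))‖ ^ 2) := by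
      intro t s
      have hs : ((1 / √2 : ℝ) : ℂ) * ((√2 : ℝ) : ℂ) = 1 := by
        rw [← Complex.ofReal_mul, one_div, inv_mul_cancel₀ (by positivity), Complex.ofReal_one]
      have : K t (L s ψ) -
        ((1 / √2 : ℝ) : ℂ) • ∑ e, ((bitSign (t i e) : ℝ) : ℂ) • a i e (K t (L s ψ)) =
          ((1 / √2 : ℝ) : ℂ) • K t (L s (((√2 : ℝ) : ℂ) • ψ - ∑ e, a i e (β i e))) +
          -(((1 / √2 : ℝ) : ℂ) •
            a i 0 (L s (((bitSign (t i 0) : ℝ) : ℂ) • K t ψ - K t (β i 0)))) +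
          -(((1 / √2 : ℝ) : ℂ) •
            a i 1 (L s (((bitSign (t i 1) : ℝ) : ℂ) • K t ψ - K t (β i 1)))) := by
        simp only [map_sub, map_smul, ← hKL, Fin.sum_univ_two, map_add, haK, haL, smul_sub,
          smul_add, smul_smul, hs, one_smul]
        abel
      have h3 := norm_add₃_sq_le
          (((1 / √2 : ℝ) : ℂ) • K t (L s (((√2 : ℝ) : ℂ) • ψ - ∑ e, a i e (β i e))))
          (-(((1 / √2 : ℝ) : ℂ) •
            a i 0 (L s (((bitSign (t i 0) : ℝ) : ℂ) • K t ψ - K t (β i 0)))))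
          (-(((1 / √2 : ℝ) : ℂ) •
            a i 1 (L s (((bitSign (t i 1) : ℝ) : ℂ) • K t ψ - K t (β i 1)))))
      rw [← this] at h3
      simpa only [norm_neg, hnorm, (ha i _).norm] using h3
    refine (Finset.sum_le_sum fun t _ => Finset.sum_le_sum fun s _ => hts t s).trans ?_
    simp only [← Finset.mul_sum, Finset.sum_add_distrib, hLsum, hKLsum]
    have h1 := hβ i 0
    have h2 := hβ i 1
    have h3 := pow_le_pow_left₀ (norm_nonneg _) (hopt i) 2
    nlinarith
  -- Equal records are charged to Alice's defect; unequal ones to a differing bit, whose squared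
  -- sign difference 4 cancels the factor `1/4`.
  have hterm : ∀ t s, ‖K t (L s ψ) - if t = s then Γ t (K t (L s ψ)) else 0‖ ^ 2 ≤
      ∑ i, ((1 / 4) * ∑ e, ((bitSign (t i e) - bitSign (s i e)) ^ 2 * ‖K t (L s ψ)‖ ^ 2) +
        (1 / 4) * ‖K t (L s ψ) - ((1 / √2 : ℝ) : ℂ) •
          ∑ e, ((bitSign (t i e) : ℝ) : ℂ) • a i e (K t (L s ψ))‖ ^ 2) := by
    intro t s
    rw [Finset.sum_add_distrib]
    split_ifs with hts
    · refine (hΓ t _).trans (le_add_of_nonneg_left ?_)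
      positivity
    · rw [sub_zero]
      refine le_trans ?_ (le_add_of_nonneg_right (by positivity))
      obtain ⟨i, hi⟩ := Function.ne_iff.mp hts
      obtain ⟨e, he⟩ := Function.ne_iff.mp hi
      refine le_trans ?_ (Finset.single_le_sum (fun i _ => by positivity) (Finset.mem_univ i))
      refine le_trans ?_ (mul_le_mul_of_nonneg_left
        (Finset.single_le_sum (fun e _ => by positivity) (Finset.mem_univ e)) (by norm_num))
      rw [bitSign_sub_sq, if_neg he]
      linarith
  refine (Finset.sum_le_sum fun t _ => Finset.sum_le_sum fun s _ => hterm t s).trans ?_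
  have hswap : ∀ f : Fin n → (Fin n → Fin 2 → Fin 2) → (Fin n → Fin 2 → Fin 2) → ℝ,
      ∑ t, ∑ s, ∑ i, f i t s = ∑ i, ∑ t, ∑ s, f i t s := by
    intro f
    rw [Finset.sum_comm (s := (Finset.univ : Finset (Fin n)))]
    exact Finset.sum_congr rfl fun t _ => Finset.sum_comm
  rw [hswap]
  have hi : ∀ i : Fin n, ∑ t, ∑ s,
      ((1 / 4) * ∑ e, ((bitSign (t i e) - bitSign (s i e)) ^ 2 * ‖K t (L s ψ)‖ ^ 2) +
        (1 / 4) * ‖K t (L s ψ) - ((1 / √2 : ℝ) : ℂ) •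
          ∑ e, ((bitSign (t i e) : ℝ) : ℂ) • a i e (K t (L s ψ))‖ ^ 2) ≤
      4 * α + 3 * κ ^ 2 := by
    intro i
    have hα : 0 ≤ α := (Finset.sum_nonneg fun t _ => sq_nonneg _).trans (hβ i 0)
    have h0 := hA i 0
    have h1 := hA i 1
    have h2 := hG i
    simp only [Fin.sum_univ_two, Finset.sum_add_distrib, ← Finset.mul_sum] at h0 h1 h2 ⊢
    linarith
  refine (Finset.sum_le_sum fun i _ => hi i).trans_eq ?_
  simp [mul_add]

/-- The part of the joint outcome `t` that belongs to the question `θ`. -/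
def outcome (θ : Fin n → Fin 2) (t : Fin n → Fin 2 → Fin 2) : Fin n → Fin 2 := fun i => t i (θ i)

/-- A joint outcome consists of the outcomes for a question and for the complementary question. -/
def outcomeEquiv (θ : Fin n → Fin 2) :
    (Fin n → Fin 2 → Fin 2) ≃ (Fin n → Fin 2) × (Fin n → Fin 2) where
  toFun t := (outcome θ t, outcome (flipAll θ) t)
  invFun p i e := if e = θ i then p.1 i else p.2 i
  left_inv t := by
    funext i e
    by_cases h : e = θ i
    · simp [h, outcome]
    · have : e = flipAll θ i := by
        rw [flipAll_apply]
        generalize θ i = f at h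
        revert e f
        decide
      simp [this, outcome, flipAll_apply, fin_two_add_one_ne]
  right_inv p := by
    refine Prod.ext (funext fun i => ?_) (funext fun i => ?_)
    · simp [outcome]
    · simp [outcome, flipAll_apply, fin_two_add_one_ne]

theorem sum_outcome {M : Type*} [AddCommMonoid M] (θ : Fin n → Fin 2)
    (f : (Fin n → Fin 2) → (Fin n → Fin 2) → M) :
    ∑ t, f (outcome θ t) (outcome (flipAll θ) t) = ∑ x, ∑ y, f x y := by
  rw [← Fintype.sum_prod_type', ← Equiv.sum_comp (outcomeEquiv θ)]
  rfl

variable {P P' Q Q' : (Fin n → Fin 2) → H →L[ℂ] H} {θ : Fin n → Fin 2}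

theorem sum_norm_sq_sequential (hP : IsPVM P) (hP' : IsPVM P') (θ : Fin n → Fin 2) (u : H) :
    ∑ t, ‖P' (outcome (flipAll θ) t) (P (outcome θ t) u)‖ ^ 2 = ‖u‖ ^ 2 := by
  rw [sum_outcome θ (fun x y => ‖P' y (P x u)‖ ^ 2)]
  simp only [hP.sum_norm_sq, hP'.sum_norm_sq]

/-- The observables of the second measurement are recorded correctly up to commutators. -/
theorem sum_sequential_le (hP : IsPVM P) (hP' : IsPVM P') (hQ : IsPVM Q)
    (hPQ : ∀ x y u, P x (Q y u) = Q y (P x u)) (hP'Q : ∀ x y u, P' x (Q y u) = Q y (P' x u))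
    {ψ : H} {r r' : ℝ} (hr : ∀ j, dist (observable P j ψ) (observable Q j ψ) ≤ r)
    (hr' : ∀ i j, dist (observable P j (observable P' i ψ))
      (observable Q j (observable P' i ψ)) ≤ r') (i : Fin n) (e : Fin 2) :
    ∑ t, ‖((bitSign (t i e) : ℝ) : ℂ) • P' (outcome (flipAll θ) t) (P (outcome θ t) ψ) -
      P' (outcome (flipAll θ) t) (P (outcome θ t)
        (if e = θ i then observable P i ψ else observable P' i ψ))‖ ^ 2 ≤
      n * (r ^ 2 + r' ^ 2) := by
  -- The measurement for θ acts first on ψ, so its bits are recorded exactly; only bits of the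
  -- complementary question cost a commutator.
  by_cases h : e = θ i
  · simp only [if_pos h, hP.apply_observable, map_smul]
    simp only [h, outcome]
    simp
    positivity
  · have he : e = flipAll θ i := by
      rw [flipAll_apply]
      generalize θ i = f at h
      revert e f
      decide
    simp only [if_neg h]
    have : ∀ t, ‖((bitSign (t i e) : ℝ) : ℂ) • P' (outcome (flipAll θ) t) (P (outcome θ t) ψ) -
        P' (outcome (flipAll θ) t) (P (outcome θ t) (observable P' i ψ))‖ ^ 2 =
        ‖P' (outcome (flipAll θ) t) (observable P' i (P (outcome θ t) ψ) -
          P (outcome θ t) (observable P' i ψ))‖ ^ 2 := by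
      intro t
      rw [map_sub, hP'.apply_observable, he]
      rfl
    simp only [this]
    rw [sum_outcome θ (fun x y => ‖P' y (observable P' i (P x ψ) -
          P x (observable P' i ψ))‖ ^ 2)]
    simp only [hP'.sum_norm_sq]
    refine (hP.sum_commutator_le hQ hPQ (hP'.isReflection i)
      (fun x u => observable_commute (fun y u => hP'Q y x u) i u) ψ).trans ?_
    rw [mul_add]
    refine add_le_add ?_ ?_
    · refine (Finset.sum_le_card_nsmul _ _ (r ^ 2) fun j _ => ?_).trans_eq (by simp)
      rw [← dist_eq_norm]
      exact pow_le_pow_left₀ dist_nonneg (hr j) 2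
    · refine (Finset.sum_le_card_nsmul _ _ (r' ^ 2) fun j _ => ?_).trans_eq (by simp)
      rw [← dist_eq_norm]
      exact pow_le_pow_left₀ dist_nonneg (hr' i j) 2

end Rounding

/-! ### Rigidity for measurements on one joint Hilbert space -/

section Rigidity

variable {H : Type*} [NormedAddCommGroup H] [InnerProductSpace ℂ H] {n : ℕ}

/-- Rigidity in terms of the measurements of Bob and Charlie on the joint Hilbert space: for a
suitable question `θ`, recording the outcomes for `θ` and for its complement changes a near-optimal
state into one that is close to its projection by `Γ`. -/
theorem exists_question_rounding {a : Fin n → Fin 2 → H →L[ℂ] H}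
    {P Q : (Fin n → Fin 2) → (Fin n → Fin 2) → H →L[ℂ] H}
    (ha : ∀ i e, IsReflection (a i e))
    (hanti : ∀ i e e', e ≠ e' → ∀ u, a i e (a i e' u) = -a i e' (a i e u))
    (hP : ∀ θ, IsPVM (P θ)) (hQ : ∀ θ, IsPVM (Q θ))
    (haP : ∀ i e θ x u, a i e (P θ x u) = P θ x (a i e u))
    (haQ : ∀ i e θ x u, a i e (Q θ x u) = Q θ x (a i e u))
    (hPQ : ∀ θ x θ' y u, P θ x (Q θ' y u) = Q θ' y (P θ x u))
    {ψ : H} (hψ : ‖ψ‖ = 1) {ε : ℝ} (hε : 0 ≤ ε) (hn : 1 ≤ n)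
    (hw : ∀ i, Real.cos (Real.pi / 8) ^ 2 - ε ≤ ∑ θ, (1 / 2 : ℝ) ^ n *
      agreeProb (a i (θ i)) (observable (P θ) i) (observable (Q θ) i) ψ)
    {Γ : (Fin n → Fin 2 → Fin 2) → H →L[ℂ] H}
    (hΓ : ∀ t u, ‖u - Γ t u‖ ^ 2 ≤ ∑ i, (1 / 4) *
      ‖u - ((1 / √2 : ℝ) : ℂ) • ∑ e, ((bitSign (t i e) : ℝ) : ℂ) • a i e u‖ ^ 2) :
    ∃ θ : Fin n → Fin 2, ∀ K L : (Fin n → Fin 2 → Fin 2) → H →L[ℂ] H,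
      (∀ t u, K t u = P (flipAll θ) (outcome (flipAll θ) t) (P θ (outcome θ t) u)) →
      (∀ t u, L t u = Q (flipAll θ) (outcome (flipAll θ) t) (Q θ (outcome θ t) u)) →
      ∑ t, ∑ s, ‖K t (L s ψ) - if t = s then Γ t (K t (L s ψ)) else 0‖ ^ 2 ≤
        (157 * n ^ 2 * √ε) ^ 2 := by
  have hfam : IsFamily a (fun θ i => observable (P θ) i) (fun θ i => observable (Q θ) i) :=
    { refl_a := ha
      refl_b := fun θ i => (hP θ).isReflection i
      refl_c := fun θ i => (hQ θ).isReflection i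
      anti := hanti
      ab := fun i e θ j u => (observable_commute (fun x u => (haP i e θ x u).symm) j u).symm
      ac := fun i e θ j u => (observable_commute (fun x u => (haQ i e θ x u).symm) j u).symm
      bc := fun θ i θ' j u => observable_commute
        (fun x u => (observable_commute (fun y u => (hPQ θ x θ' y u).symm) j u).symm) i u
      bb := fun θ i j u => (hP θ).observable_comm i j u }
  obtain ⟨θ, κ, hκ, hκn, h1, h2, h3, h4, h5⟩ := hfam.exists_question hψ hε hn hw
  refine ⟨θ, fun K L hK hL => ?_⟩
  have hn' : (1 : ℝ) ≤ n := by exact_mod_cast hn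
  have key := sum_norm_sub_rounded_le (a := a) (K := K) (L := L) (Γ := Γ) ha
    (fun u => by simp only [hK]; exact sum_norm_sq_sequential (hP θ) (hP (flipAll θ)) θ u)
    (fun u => by simp only [hL]; exact sum_norm_sq_sequential (hQ θ) (hQ (flipAll θ)) θ u)
    (fun t s u => by simp only [hK, hL, hPQ]) (fun i e t u => by simp only [hK, haP])
    (fun i e t u => by simp only [hL, haQ]) hΓ (ψ := ψ)
    (β := fun i e => if e = θ i then observable (P θ) i ψ else observable (P (flipAll θ)) i ψ)
    (γ := fun i e => if e = θ i then observable (Q θ) i ψ else observable (Q (flipAll θ)) i ψ)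
    -- 13 is forced by Charlie's side; Bob's side would allow 11.
    (α := n * (κ ^ 2 + (13 * κ) ^ 2)) (κ := κ)
    (fun i e => by
      simp only [hK]
      refine (sum_sequential_le (hP θ) (hP (flipAll θ)) (hQ θ) (hPQ θ · θ) (hPQ _ · θ) h1 h4
        i e).trans ?_
      refine mul_le_mul_of_nonneg_left ?_ (by positivity)
      nlinarith)
    (fun i e => by
      simp only [hL]
      exact sum_sequential_le (hQ θ) (hQ (flipAll θ)) (hP θ)
        (fun x y u => (hPQ θ y θ x u).symm) (fun x y u => (hPQ θ y _ x u).symm)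
        (fun j => by rw [dist_comm]; exact h1 j) (fun i j => by rw [dist_comm]; exact h5 i j) i e)
    (fun i e => by
      rw [← dist_eq_norm]
      by_cases h : e = θ i
      · simpa only [if_pos h] using h1 i
      · simpa only [if_neg h] using h2 i)
    (fun i => by
      rw [← dist_eq_norm, dist_comm]
      convert h3 i using 2
      rw [Fin.sum_univ_two]
      simp only [flipAll_apply]
      generalize θ i = e
      fin_cases e
      · simp
      · simp [add_comm])
  -- The bound is at most `(680 + 3) n² κ²` with `κ² = 36n²ε`, and `683 · 36 = 24588 ≤ 157²`.
  refine key.trans ?_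
  have h6 : κ ^ 2 = 36 * n ^ 2 * ε := by
    rw [hκn, mul_pow, mul_pow, Real.sq_sqrt hε]; norm_num
  have h7 : (157 * n ^ 2 * √ε) ^ 2 = 24649 * n ^ 4 * ε := by
    rw [mul_pow, mul_pow, Real.sq_sqrt hε]; ring
  have h8 : (n : ℝ) ≤ n ^ 2 := by nlinarith
  rw [h7]
  have h9 : (n : ℝ) * (4 * (n * (κ ^ 2 + (13 * κ) ^ 2)) + 3 * κ ^ 2) =
      680 * n ^ 2 * κ ^ 2 + 3 * n * κ ^ 2 := by ring
  rw [h9]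
  have h10 : (n : ℝ) * κ ^ 2 ≤ n ^ 2 * κ ^ 2 := mul_le_mul_of_nonneg_right h8 (sq_nonneg _)
  have h11 : (n : ℝ) ^ 2 * κ ^ 2 = 36 * (n ^ 4 * ε) := by rw [h6]; ring
  have h12 : 0 ≤ (n : ℝ) ^ 4 * ε := by positivity
  linarith

/-- An orthogonal projection. -/
structure IsProjection (p : H →L[ℂ] H) : Prop where
  symm : ∀ u v, inner ℂ (p u) v = inner ℂ u (p v)
  idem : ∀ u, p (p u) = p u

/-- Pythagoras for `u - pqu = (u - pu) + p(u - qu)`. Iterated, it bounds the defect of a product of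
projections by the sum of their defects, with no cross terms. -/
theorem IsProjection.norm_sub_sq_le {p q : H →L[ℂ] H} (hp : IsProjection p) (u : H) :
    ‖u - p (q u)‖ ^ 2 ≤ ‖u - p u‖ ^ 2 + ‖u - q u‖ ^ 2 := by
  have hort : ∀ w, inner ℂ (u - p u) (p w) = 0 := fun w => by
    rw [← hp.symm, map_sub, hp.idem, sub_self, inner_zero_left]
  have e : u - p (q u) = (u - p u) + p (u - q u) := by
    rw [map_sub]
    abel
  rw [e, sq, norm_add_sq_eq_norm_sq_add_norm_sq_of_inner_eq_zero _ _ (hort _), ← sq, ← sq]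
  refine add_le_add_right (pow_le_pow_left₀ (norm_nonneg _) ?_ 2) _
  set w := u - q u
  have h1 : ‖p w‖ ^ 2 = reInner (p w) w := by
    rw [← reInner_self, reInner, reInner, ← hp.symm, hp.idem]
  have h2 : reInner (p w) w ≤ ‖p w‖ * ‖w‖ :=
    (Complex.re_le_norm _).trans (norm_inner_le_norm _ _)
  by_contra! h
  nlinarith [norm_nonneg w]

end Rigidity

/-! ### Local matrices as operators on the joint space with a reference system -/

section Lift

/-- Operators on the left factor of a product register. -/
def kronLeft (X Y : Type*) [Fintype X] [DecidableEq X] [Fintype Y] [DecidableEq Y] :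
    Matrix X X ℂ →⋆ₐ[ℂ] Matrix (X × Y) (X × Y) ℂ where
  toFun M := M ⊗ₖ 1
  map_one' := one_kronecker_one
  map_mul' M N := by rw [← mul_kronecker_mul, one_mul]
  map_zero' := zero_kronecker _
  map_add' M N := add_kronecker _ _ _
  commutes' r := by
    rw [Algebra.algebraMap_eq_smul_one, Algebra.algebraMap_eq_smul_one, smul_kronecker,
      one_kronecker_one]
  map_star' M := by
    simp only [star_eq_conjTranspose, conjTranspose_kronecker, conjTranspose_one]

/-- Operators on the right factor of a product register. -/
def kronRight (X Y : Type*) [Fintype X] [DecidableEq X] [Fintype Y] [DecidableEq Y] :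
    Matrix Y Y ℂ →⋆ₐ[ℂ] Matrix (X × Y) (X × Y) ℂ where
  toFun M := 1 ⊗ₖ M
  map_one' := one_kronecker_one
  map_mul' M N := by rw [← mul_kronecker_mul, one_mul]
  map_zero' := kronecker_zero _
  map_add' M N := kronecker_add _ _ _
  commutes' r := by
    rw [Algebra.algebraMap_eq_smul_one, Algebra.algebraMap_eq_smul_one, kronecker_smul,
      one_kronecker_one]
  map_star' M := by
    simp only [star_eq_conjTranspose, conjTranspose_kronecker, conjTranspose_one]

variable (A B C R : Type*) [Fintype A] [DecidableEq A] [Fintype B] [DecidableEq B]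
  [Fintype C] [DecidableEq C] [Fintype R] [DecidableEq R]

/-- Alice's operators on the Hilbert space of all players and a reference system. -/
def liftA : Matrix A A ℂ →⋆ₐ[ℂ]
    (EuclideanSpace ℂ (A × B × C × R) →L[ℂ] EuclideanSpace ℂ (A × B × C × R)) :=
  (toEuclideanCLM (n := A × B × C × R) (𝕜 := ℂ) : _ →⋆ₐ[ℂ] _).comp (kronLeft A (B × C × R))

/-- Bob's operators on the Hilbert space of all players and a reference system. -/
def liftB : Matrix B B ℂ →⋆ₐ[ℂ]
    (EuclideanSpace ℂ (A × B × C × R) →L[ℂ] EuclideanSpace ℂ (A × B × C × R)) :=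
  (toEuclideanCLM (n := A × B × C × R) (𝕜 := ℂ) : _ →⋆ₐ[ℂ] _).comp
    ((kronRight A (B × C × R)).comp (kronLeft B (C × R)))

/-- Charlie's operators on the Hilbert space of all players and a reference system. -/
def liftC : Matrix C C ℂ →⋆ₐ[ℂ]
    (EuclideanSpace ℂ (A × B × C × R) →L[ℂ] EuclideanSpace ℂ (A × B × C × R)) :=
  (toEuclideanCLM (n := A × B × C × R) (𝕜 := ℂ) : _ →⋆ₐ[ℂ] _).comp
    ((kronRight A (B × C × R)).comp ((kronRight B (C × R)).comp (kronLeft C R)))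

variable {A B C R}

theorem liftA_ofLp (M : Matrix A A ℂ) (u : EuclideanSpace ℂ (A × B × C × R))
    (p : A × B × C × R) : liftA A B C R M u p = ∑ a, M p.1 a * u (a, p.2) := by
  change ((M ⊗ₖ (1 : Matrix (B × C × R) (B × C × R) ℂ)) *ᵥ u.ofLp) p = _
  simp [mulVec, dotProduct, Fintype.sum_prod_type, kroneckerMap_apply, one_apply, Prod.ext_iff,
    ite_and, Finset.sum_ite_eq, Finset.mul_sum]

theorem liftB_ofLp (M : Matrix B B ℂ) (u : EuclideanSpace ℂ (A × B × C × R))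
    (p : A × B × C × R) : liftB A B C R M u p = ∑ b, M p.2.1 b * u (p.1, b, p.2.2) := by
  change (((1 : Matrix A A ℂ) ⊗ₖ (M ⊗ₖ (1 : Matrix (C × R) (C × R) ℂ))) *ᵥ u.ofLp) p = _
  obtain ⟨a, b, c, r⟩ := p
  simp [mulVec, dotProduct, Fintype.sum_prod_type, kroneckerMap_apply, one_apply, Prod.ext_iff,
    ite_and, Finset.sum_ite_eq]

theorem liftC_ofLp (M : Matrix C C ℂ) (u : EuclideanSpace ℂ (A × B × C × R))
    (p : A × B × C × R) :
    liftC A B C R M u p = ∑ c, M p.2.2.1 c * u (p.1, p.2.1, c, p.2.2.2) := by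
  change (((1 : Matrix A A ℂ) ⊗ₖ ((1 : Matrix B B ℂ) ⊗ₖ (M ⊗ₖ (1 : Matrix R R ℂ)))) *ᵥ u.ofLp) p = _
  obtain ⟨a, b, c, r⟩ := p
  simp [mulVec, dotProduct, Fintype.sum_prod_type, kroneckerMap_apply, one_apply, Prod.ext_iff,
    ite_and, Finset.sum_ite_eq]

theorem liftAB_comm (M : Matrix A A ℂ) (N : Matrix B B ℂ) (u : EuclideanSpace ℂ (A × B × C × R)) :
    liftA A B C R M (liftB A B C R N u) = liftB A B C R N (liftA A B C R M u) := by
  ext p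
  simp only [liftA_ofLp, liftB_ofLp, Finset.mul_sum]
  rw [Finset.sum_comm]
  simp only [mul_left_comm]

theorem liftAC_comm (M : Matrix A A ℂ) (N : Matrix C C ℂ) (u : EuclideanSpace ℂ (A × B × C × R)) :
    liftA A B C R M (liftC A B C R N u) = liftC A B C R N (liftA A B C R M u) := by
  ext p
  simp only [liftA_ofLp, liftC_ofLp, Finset.mul_sum]
  rw [Finset.sum_comm]
  simp only [mul_left_comm]

theorem liftBC_comm (M : Matrix B B ℂ) (N : Matrix C C ℂ) (u : EuclideanSpace ℂ (A × B × C × R)) :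
    liftB A B C R M (liftC A B C R N u) = liftC A B C R N (liftB A B C R M u) := by
  ext p
  simp only [liftB_ofLp, liftC_ofLp, Finset.mul_sum]
  rw [Finset.sum_comm]
  simp only [mul_left_comm]

/-- A projection-valued measurement by matrices. -/
structure IsMatrixPVM {X Y : Type*} [Fintype X] [DecidableEq X] [Fintype Y] [DecidableEq Y]
    (P : Y → Matrix X X ℂ) : Prop where
  herm : ∀ y, (P y)ᴴ = P y
  mul : ∀ y z, P y * P z = if y = z then P y else 0
  sum : ∑ y, P y = 1

theorem starAlgHom_symm {X H : Type*} [Fintype X] [DecidableEq X] [NormedAddCommGroup H]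
    [InnerProductSpace ℂ H] [CompleteSpace H] (φ : Matrix X X ℂ →⋆ₐ[ℂ] (H →L[ℂ] H))
    {M : Matrix X X ℂ} (hM : Mᴴ = M) (u v : H) : inner ℂ (φ M u) v = inner ℂ u (φ M v) := by
  conv_rhs => rw [← hM, ← star_eq_conjTranspose, map_star, ContinuousLinearMap.star_eq_adjoint,
    ContinuousLinearMap.adjoint_inner_right]

theorem IsMatrixPVM.map {X Y H : Type*} [Fintype X] [DecidableEq X] [Fintype Y] [DecidableEq Y]
    [NormedAddCommGroup H] [InnerProductSpace ℂ H] [CompleteSpace H] {P : Y → Matrix X X ℂ}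
    (hP : IsMatrixPVM P) (φ : Matrix X X ℂ →⋆ₐ[ℂ] (H →L[ℂ] H)) : IsPVM (fun y => φ (P y)) where
  symm y := starAlgHom_symm φ (hP.herm y)
  mul x y u := by
    rw [← mul_apply_eq_comp, ← map_mul, hP.mul]
    split_ifs <;> simp
  sum u := by
    rw [← _root_.sum_apply, ← map_sum, hP.sum, map_one,
      one_apply_eq_self]

end Lift

/-! ### Single-site operators and Alice's Pauli observables -/

section Alice

variable {n : ℕ}

/-- An operator on the `i`-th of `n` copies of a register. -/
def siteOp {X : Type*} [DecidableEq X] (i : Fin n) (M : Matrix X X ℂ) :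
    Matrix (Fin n → X) (Fin n → X) ℂ :=
  tensor fun j => if j = i then M else 1

variable {X : Type*} [Fintype X] [DecidableEq X]

theorem siteOp_one (i : Fin n) : siteOp i (1 : Matrix X X ℂ) = 1 := by
  simp only [siteOp, ite_self]
  exact tensor_one

theorem siteOp_mul (i : Fin n) (M N : Matrix X X ℂ) :
    siteOp i (M * N) = siteOp i M * siteOp i N := by
  rw [siteOp, siteOp, siteOp, ← tensor_mul]
  congr 1
  funext j
  split_ifs <;> simp

theorem siteOp_conjTranspose (i : Fin n) (M : Matrix X X ℂ) : siteOp i Mᴴ = (siteOp i M)ᴴ := by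
  rw [siteOp, siteOp, ← tensor_conjTranspose]
  congr 1
  funext j
  split_ifs <;> simp

theorem siteOp_apply (i : Fin n) (M : Matrix X X ℂ) (x y : Fin n → X) :
    siteOp i M x y = M (x i) (y i) * ∏ j ∈ Finset.univ.erase i, (1 : Matrix X X ℂ) (x j) (y j) := by
  rw [siteOp, tensor, of_apply, ← Finset.mul_prod_erase _ _ (Finset.mem_univ i), if_pos rfl]
  congr 1
  exact Finset.prod_congr rfl fun j hj => by rw [if_neg (Finset.ne_of_mem_erase hj)]

theorem siteOp_add (i : Fin n) (M N : Matrix X X ℂ) :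
    siteOp i (M + N) = siteOp i M + siteOp i N := by
  ext x y
  simp only [siteOp_apply, Matrix.add_apply, add_mul]

theorem siteOp_smul (i : Fin n) (r : ℂ) (M : Matrix X X ℂ) :
    siteOp i (r • M) = r • siteOp i M := by
  ext x y
  simp only [siteOp_apply, Matrix.smul_apply, smul_eq_mul, mul_assoc]

/-- Coarse-graining a product measurement with signs to one of its factors. -/
theorem sum_smul_tensor {Y : Type*} [Fintype Y] [DecidableEq Y] (M : Fin n → Y → Matrix X X ℂ)
    (hM : ∀ j, ∑ y, M j y = 1) (i : Fin n) (f : Y → ℂ) :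
    ∑ x : Fin n → Y, f (x i) • tensor (fun j => M j (x j)) =
      siteOp i (∑ y, f y • M i y) := by
  have h := tensor_sum (fun (j : Fin n) (y : Y) => if j = i then f y • M j y else M j y)
  have h1 : (fun j => ∑ y, if j = i then f y • M j y else M j y) =
      fun j => if j = i then ∑ y, f y • M i y else 1 := by
    funext j
    split_ifs with hj
    · rw [hj]
    · exact hM j
  rw [h1] at h
  rw [siteOp, ← h]
  refine Finset.sum_congr rfl fun x _ => ?_
  ext p q
  simp only [tensor, of_apply, Matrix.smul_apply, smul_eq_mul]
  rw [← Finset.mul_prod_erase _ _ (Finset.mem_univ i),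
    ← Finset.mul_prod_erase _ _ (Finset.mem_univ i), if_pos rfl, Matrix.smul_apply, smul_eq_mul,
    mul_assoc]
  congr 2
  exact Finset.prod_congr rfl fun j hj => by rw [if_neg (Finset.ne_of_mem_erase hj)]

/-- Alice's observable for the question `e` of one TFKW game. -/
def qubitObservable (e : Fin 2) : Matrix (Fin 2) (Fin 2) ℂ := if e = 0 then pauliZ else pauliX

theorem sum_bitSign_alice (e : Fin 2) :
    ∑ y, ((bitSign y : ℝ) : ℂ) • tfkw.alice e y = qubitObservable e := by
  have h := sqrt_two_inv_mul
  fin_cases e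
  · ext i j
    fin_cases i <;> fin_cases j <;>
      simp [qubitObservable, tfkw, bitSign, wiesner, vecMulVec_apply, pauliZ]
  · ext i j
    fin_cases i <;> fin_cases j <;>
      simp [qubitObservable, tfkw, bitSign, wiesner, vecMulVec_apply, pauliX, hadamardGate] <;>
      simp at h <;> simp [h] <;> norm_num

theorem alice_isMatrixPVM (e : Fin 2) : IsMatrixPVM (tfkw.alice e) where
  herm y := (tfkw.alice_povm e).1 y |>.1
  mul y z := by
    have h := sqrt_two_inv_mul
    fin_cases e <;> fin_cases y <;> fin_cases z <;> ext i j <;> fin_cases i <;> fin_cases j <;>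
      simp [tfkw, wiesner, vecMulVec_apply, hadamardGate, Matrix.mul_apply] <;>
      simp at h <;> simp [h] <;> norm_num
  sum := (tfkw.alice_povm e).2

end Alice

/-! ### Winning probabilities in terms of observables -/

section Marginals

variable {H : Type*} [NormedAddCommGroup H] [InnerProductSpace ℂ H] {n : ℕ}

theorem IsPVM.sum_marginal {P : (Fin n → Fin 2) → H →L[ℂ] H} (hP : IsPVM P) (i : Fin n)
    (y : Fin 2) (u : H) :
    ∑ x with x i = y, P x u =
      (1 / 2 : ℂ) • (u + ((bitSign y : ℝ) : ℂ) • observable P i u) := by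
  conv_rhs => rw [← hP.sum u]
  rw [observable_apply, Finset.smul_sum, ← Finset.sum_add_distrib, Finset.smul_sum,
    Finset.sum_filter]
  refine Finset.sum_congr rfl fun x _ => ?_
  rw [hP.sum u, smul_smul, ← one_smul ℂ (P x u), smul_smul, ← add_smul, smul_smul,
    ← Complex.ofReal_mul]
  generalize x i = z
  fin_cases y <;> fin_cases z <;> norm_num [bitSign]

/-- Each coarse-grained projection is `½(1 ± observable)`; in the sum over the two outcomes the
terms of odd degree cancel. -/
theorem sum_inner_marginal {P Q S : (Fin n → Fin 2) → H →L[ℂ] H} (hP : IsPVM P) (hQ : IsPVM Q)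
    (hS : IsPVM S) (hPQ : ∀ x y u, P x (Q y u) = Q y (P x u)) (i : Fin n) (ψ : H) :
    ∑ y, reInner ψ (∑ x with x i = y, P x (∑ z with z i = y, Q z (∑ w with w i = y, S w ψ))) =
      agreeProb (observable P i) (observable Q i) (observable S i) ψ := by
  simp only [hP.sum_marginal, hQ.sum_marginal, hS.sum_marginal]
  set a := observable P i
  set b := observable Q i
  set c := observable S i
  have e1 : reInner ψ (a (b ψ)) = reInner (a ψ) (b ψ) := ((hP.isReflection i).reInner _ _).symm
  have e2 : reInner ψ (a (c ψ)) = reInner (a ψ) (c ψ) := ((hP.isReflection i).reInner _ _).symm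
  have e3 : reInner ψ (b (c ψ)) = reInner (b ψ) (c ψ) := ((hQ.isReflection i).reInner _ _).symm
  have half : (1 / 2 : ℂ) = ((1 / 2 : ℝ) : ℂ) := by norm_num
  rw [agreeProb, ← e1, ← e2, ← e3, ← reInner_self]
  simp only [Fin.sum_univ_two, half, map_add, map_smul, reInner_add_right, reInner_smul_right]
  norm_num [bitSign]
  ring

end Marginals

/-! ### Alice's concrete measurements and the Breidbart projections -/

section Concrete

variable {n : ℕ}

theorem parallel_alice_isMatrixPVM (θ : Fin n → Fin 2) :
    IsMatrixPVM ((tfkw.parallel n).alice θ) where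
  herm x := ((tfkw.parallel n).alice_povm θ).1 x |>.1
  mul x y := by
    change tensor _ * tensor _ = _
    rw [← tensor_mul]
    simp only [(alice_isMatrixPVM _).mul]
    split_ifs with h
    · subst h
      simp only [if_true]
      rfl
    · obtain ⟨i, hi⟩ := Function.ne_iff.mp h
      ext p q
      simp only [tensor, of_apply, Matrix.zero_apply]
      refine Finset.prod_eq_zero (Finset.mem_univ i) ?_
      rw [if_neg hi, Matrix.zero_apply]
  sum := ((tfkw.parallel n).alice_povm θ).2

variable {B C R : Type*} [Fintype B] [DecidableEq B]
  [Fintype C] [DecidableEq C] [Fintype R] [DecidableEq R]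

theorem observable_alice (θ : Fin n → Fin 2) (i : Fin n) :
    observable (fun x => liftA (Fin n → Fin 2) B C R ((tfkw.parallel n).alice θ x)) i =
      liftA (Fin n → Fin 2) B C R (siteOp i (qubitObservable (θ i))) := by
  rw [← sum_bitSign_alice, ← sum_smul_tensor (fun j y => tfkw.alice (θ j) y)
    (fun j => (tfkw.alice_povm (θ j)).2) i (fun y => ((bitSign y : ℝ) : ℂ)), map_sum]
  simp only [map_smul]
  rfl

theorem qubitObservable_anti {e e' : Fin 2} (h : e ≠ e') :
    qubitObservable e * qubitObservable e' = -(qubitObservable e' * qubitObservable e) := by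
  fin_cases e <;> fin_cases e' <;> simp [qubitObservable, pauliX, pauliZ] at h ⊢

theorem liftA_siteOp_anti (i : Fin n) {e e' : Fin 2} (h : e ≠ e')
    (u : EuclideanSpace ℂ ((Fin n → Fin 2) × B × C × R)) :
    liftA (Fin n → Fin 2) B C R (siteOp i (qubitObservable e))
        (liftA (Fin n → Fin 2) B C R (siteOp i (qubitObservable e')) u) =
      -liftA (Fin n → Fin 2) B C R (siteOp i (qubitObservable e'))
        (liftA (Fin n → Fin 2) B C R (siteOp i (qubitObservable e)) u) := by
  rw [← mul_apply_eq_comp, ← map_mul, ← mul_apply_eq_comp, ← map_mul,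
    ← siteOp_mul, ← siteOp_mul, qubitObservable_anti h, ← neg_one_smul ℂ, siteOp_smul, map_smul,
    _root_.smul_apply, neg_one_smul]

/-- The conjugated Breidbart state `X^{τ₀} Z^{τ₁}|β⟩`. -/
def breidbartState (τ : Fin 2 → Fin 2) : Fin 2 → ℂ :=
  (pauliX ^ (τ 0 : ℕ) * pauliZ ^ (τ 1 : ℕ)) *ᵥ breidbart

/-- The projection to `X^{τ₀} Z^{τ₁}|β⟩`. -/
def breidbartProj (τ : Fin 2 → Fin 2) : Matrix (Fin 2) (Fin 2) ℂ :=
  vecMulVec (breidbartState τ) (star (breidbartState τ))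

/-- This identity links the algebraic relation `√2u = ∑ₑ ±aₑu` to the Breidbart states: the defect
`u - Πu` of the projection is half of `u - (1/√2)∑ₑ ±aₑu`. -/
theorem breidbartProj_eq (τ : Fin 2 → Fin 2) :
    breidbartProj τ = (1 / 2 : ℂ) • (1 + ((1 / √2 : ℝ) : ℂ) •
      ∑ e, ((bitSign (τ e) : ℝ) : ℂ) • qubitObservable e) := by
  have h1 : Real.cos (Real.pi / 8) * Real.cos (Real.pi / 8) = 1 / 2 + 1 / √2 / 2 := by
    rw [← sq, Real.cos_sq, show 2 * (Real.pi / 8) = Real.pi / 4 by ring, Real.cos_pi_div_four,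
      Real.sqrt_div_self']
  have h2 : Real.sin (Real.pi / 8) * Real.sin (Real.pi / 8) = 1 / 2 - 1 / √2 / 2 := by
    rw [← sq, Real.sin_sq, sq, h1]; ring
  have h3 : Real.cos (Real.pi / 8) * Real.sin (Real.pi / 8) = 1 / √2 / 2 := by
    have := Real.sin_two_mul (Real.pi / 8)
    rw [show 2 * (Real.pi / 8) = Real.pi / 4 by ring, Real.sin_pi_div_four,
      Real.sqrt_div_self'] at this
    linarith
  rw [breidbartProj, breidbartState, breidbart, Fin.sum_univ_two]
  generalize (1 / √2 : ℝ) = r at *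
  generalize Real.cos (Real.pi / 8) = c at *
  generalize Real.sin (Real.pi / 8) = s at *
  have h1 : (c : ℂ) * c = 1 / 2 + r / 2 := by rw [← Complex.ofReal_mul, h1]; push_cast; ring
  have h2 : (s : ℂ) * s = 1 / 2 - r / 2 := by rw [← Complex.ofReal_mul, h2]; push_cast; ring
  have h3 : (c : ℂ) * s = r / 2 := by rw [← Complex.ofReal_mul, h3]; push_cast; rfl
  have h3' := (mul_comm (s : ℂ) c).trans h3
  generalize τ 0 = e, τ 1 = f
  ext i j
  fin_cases e <;> fin_cases f <;> fin_cases i <;> fin_cases j <;>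
    simp [vecMulVec_apply, pauliX, pauliZ, qubitObservable, bitSign, Matrix.mul_apply, mulVec,
      dotProduct, Fin.sum_univ_two, h1, h2, h3, h3'] <;> ring

theorem breidbartState_norm (τ : Fin 2 → Fin 2) :
    star (breidbartState τ) ⬝ᵥ breidbartState τ = 1 := by
  have h : (breidbartProj τ).trace = 1 := by
    rw [breidbartProj_eq, trace_smul, trace_add, trace_smul, trace_sum]
    simp [qubitObservable, pauliX, pauliZ, trace_fin_two]
  rw [← h, breidbartProj, trace_vecMulVec, dotProduct_comm]

end Concrete

/-! ### Projective strategies as observables on a purification -/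

section ProjectiveStrategy

variable {n : ℕ} {B C R : Type*} [Fintype B] [DecidableEq B]
  [Fintype C] [DecidableEq C] [Fintype R] [DecidableEq R]

theorem breidbartProj_conjTranspose (τ : Fin 2 → Fin 2) :
    (breidbartProj τ)ᴴ = breidbartProj τ := by
  rw [breidbartProj, conjTranspose_vecMulVec, star_star]

theorem breidbartProj_mul_self (τ : Fin 2 → Fin 2) :
    breidbartProj τ * breidbartProj τ = breidbartProj τ := by
  rw [breidbartProj, vecMulVec_mul_vecMulVec, breidbartState_norm, one_smul]

theorem isProjection_liftA_siteOp (i : Fin n) (τ : Fin 2 → Fin 2) :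
    IsProjection (liftA (Fin n → Fin 2) B C R (siteOp i (breidbartProj τ))) where
  symm := starAlgHom_symm _ (by rw [← siteOp_conjTranspose, breidbartProj_conjTranspose])
  idem u := by
    rw [← mul_apply_eq_comp, ← map_mul, ← siteOp_mul, breidbartProj_mul_self]

/-- Induction over the set of sites already projected, adding one site by
`IsProjection.norm_sub_sq_le`. -/
theorem norm_sub_tensor_sq_le (t : Fin n → Fin 2 → Fin 2)
    (u : EuclideanSpace ℂ ((Fin n → Fin 2) × B × C × R)) (s : Finset (Fin n)) :
    ‖u - liftA (Fin n → Fin 2) B C R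
        (tensor fun i => if i ∈ s then breidbartProj (t i) else 1) u‖ ^ 2 ≤
      ∑ i ∈ s, ‖u - liftA (Fin n → Fin 2) B C R (siteOp i (breidbartProj (t i))) u‖ ^ 2 := by
  induction s using Finset.induction_on with
  | empty =>
    simp only [Finset.notMem_empty, if_false, tensor_one, map_one,
      one_apply_eq_self, sub_self]
    simp
  | insert i s hi ih =>
    rw [Finset.sum_insert hi]
    have e : (tensor fun j => if j ∈ insert i s then breidbartProj (t j) else 1) =
        siteOp i (breidbartProj (t i)) *
          tensor fun j => if j ∈ s then breidbartProj (t j) else 1 := by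
      rw [siteOp, ← tensor_mul]
      congr 1
      funext j
      by_cases hj : j = i
      · subst hj
        simp [hi]
      · simp [hj]
    rw [e, map_mul, mul_apply_eq_comp]
    exact ((isProjection_liftA_siteOp i (t i)).norm_sub_sq_le u).trans
      (add_le_add le_rfl ih)

theorem norm_sub_breidbart_sq_le (t : Fin n → Fin 2 → Fin 2)
    (u : EuclideanSpace ℂ ((Fin n → Fin 2) × B × C × R)) :
    ‖u - liftA (Fin n → Fin 2) B C R (tensor fun i => breidbartProj (t i)) u‖ ^ 2 ≤
      ∑ i, (1 / 4) * ‖u - ((1 / √2 : ℝ) : ℂ) • ∑ e, ((bitSign (t i e) : ℝ) : ℂ) •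
        liftA (Fin n → Fin 2) B C R (siteOp i (qubitObservable e)) u‖ ^ 2 := by
  have h := norm_sub_tensor_sq_le t u Finset.univ
  simp only [Finset.mem_univ, if_true] at h
  refine h.trans_eq (Finset.sum_congr rfl fun i _ => ?_)
  have e : u - liftA (Fin n → Fin 2) B C R (siteOp i (breidbartProj (t i))) u =
      (1 / 2 : ℂ) • (u - ((1 / √2 : ℝ) : ℂ) • ∑ e, ((bitSign (t i e) : ℝ) : ℂ) •
        liftA (Fin n → Fin 2) B C R (siteOp i (qubitObservable e)) u) := by
    rw [breidbartProj_eq, siteOp_smul, siteOp_add, siteOp_one, siteOp_smul, Fin.sum_univ_two,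
      Fin.sum_univ_two, siteOp_add, siteOp_smul, siteOp_smul]
    simp only [map_smul, map_add, map_one, _root_.smul_apply,
      _root_.add_apply, one_apply_eq_self]
    module
  rw [e, norm_smul, mul_pow]
  norm_num

theorem isReflection_liftA_siteOp (i : Fin n) (e : Fin 2) :
    IsReflection (liftA (Fin n → Fin 2) B C R (siteOp i (qubitObservable e))) := by
  have := ((parallel_alice_isMatrixPVM (fun _ : Fin n => e)).map
    (liftA (Fin n → Fin 2) B C R)).isReflection i
  rwa [observable_alice] at this

theorem reInner_liftA {A : Type*} [Fintype A] [DecidableEq A] (M : Matrix A A ℂ)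
    (N : Matrix B B ℂ) (O : Matrix C C ℂ) (ψ : EuclideanSpace ℂ (A × B × C × R)) :
    reInner ψ (liftA A B C R M (liftB A B C R N (liftC A B C R O ψ))) =
      ((M ⊗ₖ (N ⊗ₖ O)) * partialTrace (vecMulVec ψ.ofLp (star ψ.ofLp))).trace.re := by
  rw [reInner, PiLp.inner_apply]
  congr 1
  simp only [liftA_ofLp, liftB_ofLp, liftC_ofLp, trace, diag_apply, mul_apply, partialTrace,
    of_apply, vecMulVec_apply, Fintype.sum_prod_type, kroneckerMap_apply, Pi.star_apply,
    RCLike.inner_apply, Finset.mul_sum, Finset.sum_mul]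
  refine Finset.sum_congr rfl fun a _ => Finset.sum_congr rfl fun b _ =>
    Finset.sum_congr rfl fun c _ => ?_
  rw [Finset.sum_comm]
  refine Finset.sum_congr rfl fun a' _ => ?_
  rw [Finset.sum_comm]
  refine Finset.sum_congr rfl fun b' _ => ?_
  rw [Finset.sum_comm]
  refine Finset.sum_congr rfl fun c' _ => Finset.sum_congr rfl fun r _ => ?_
  simp only [starRingEnd_apply]
  ring

theorem marginal_map {X H : Type*} [Fintype X] [DecidableEq X] [NormedAddCommGroup H]
    [InnerProductSpace ℂ H] [CompleteSpace H] (φ : Matrix X X ℂ →⋆ₐ[ℂ] (H →L[ℂ] H))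
    (P : (Fin n → Fin 2) → Matrix X X ℂ) (i : Fin n) (y : Fin 2) (u : H) :
    φ (marginal P i y) u = ∑ x with x i = y, φ (P x) u := by
  rw [marginal, map_sum, _root_.sum_apply]

theorem winProb_eq (S : Strategy (tfkw.parallel n) B C)
    (hB : ∀ θ, IsMatrixPVM (S.bob θ)) (hC : ∀ θ, IsMatrixPVM (S.charlie θ))
    (ψ : EuclideanSpace ℂ ((Fin n → Fin 2) × B × C × R))
    (hψ : partialTrace (vecMulVec ψ.ofLp (star ψ.ofLp)) = S.state) (i : Fin n) :
    S.winProb i = ∑ θ, (1 / 2 : ℝ) ^ n *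
      agreeProb (liftA (Fin n → Fin 2) B C R (siteOp i (qubitObservable (θ i))))
        (observable (fun x => liftB (Fin n → Fin 2) B C R (S.bob θ x)) i)
        (observable (fun x => liftC (Fin n → Fin 2) B C R (S.charlie θ x)) i) ψ := by
  rw [Strategy.winProb]
  refine Finset.sum_congr rfl fun θ _ => ?_
  congr 1
  · simp [Game.parallel, tfkw]
  · rw [← observable_alice, ← sum_inner_marginal
      ((parallel_alice_isMatrixPVM θ).map (liftA (Fin n → Fin 2) B C R))
      ((hB θ).map (liftB (Fin n → Fin 2) B C R)) ((hC θ).map (liftC (Fin n → Fin 2) B C R))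
      (fun x y u => liftAB_comm _ _ _)]
    refine Finset.sum_congr rfl fun y _ => ?_
    rw [← hψ, ← reInner_liftA]
    simp only [marginal_map]

end ProjectiveStrategy

/-! ### Recording isometries and the rounded vector -/

section ApplyLocal

/-- `(V ⊗ W)|ψ⟩`, where `V` and `W` act on Bob's and Charlie's registers. -/
def applyLocal {A B C B' C' R : Type*} [Fintype B] [Fintype C] (V : Matrix B' B ℂ)
    (W : Matrix C' C ℂ) (ψ : A × B × C × R → ℂ) : A × B' × C' × R → ℂ :=
  fun p => ∑ b, ∑ c, V p.2.1 b * W p.2.2.1 c * ψ (p.1, b, c, p.2.2.2)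

/-- The vectors have mutually orthogonal supports on `B` and on `C`. -/
def OrthogonalSupports {T B C R : Type*} [Fintype B] [Fintype C] (φ : T → B × C × R → ℂ) : Prop :=
  (∀ t t', t ≠ t' → supportLeft (φ t) ⟂ supportLeft (φ t')) ∧
    ∀ t t', t ≠ t' → supportRight (φ t) ⟂ supportRight (φ t')

theorem supportLeft_isOrtho_iff {B C R : Type*} [Fintype B] (u v : B × C × R → ℂ) :
    supportLeft u ⟂ supportLeft v ↔
      ∀ c r c' r', ∑ b, star (u (b, c, r)) * v (b, c', r') = 0 := by
  rw [supportLeft, supportLeft, Submodule.isOrtho_span]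
  constructor
  · intro h x r x' r'
    rw [← h ⟨(x, r), rfl⟩ ⟨(x', r'), rfl⟩, PiLp.inner_apply]
    exact Finset.sum_congr rfl fun y _ => mul_comm _ _
  · rintro h _ ⟨⟨x, r⟩, rfl⟩ _ ⟨⟨x', r'⟩, rfl⟩
    rw [← h x r x' r', PiLp.inner_apply]
    exact Finset.sum_congr rfl fun y _ => mul_comm _ _

theorem supportRight_isOrtho_iff {B C R : Type*} [Fintype C] (u v : B × C × R → ℂ) :
    supportRight u ⟂ supportRight v ↔
      ∀ b r b' r', ∑ c, star (u (b, c, r)) * v (b', c, r') = 0 := by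
  rw [supportRight, supportRight, Submodule.isOrtho_span]
  constructor
  · intro h x r x' r'
    rw [← h ⟨(x, r), rfl⟩ ⟨(x', r'), rfl⟩, PiLp.inner_apply]
    exact Finset.sum_congr rfl fun y _ => mul_comm _ _
  · rintro h _ ⟨⟨x, r⟩, rfl⟩ _ ⟨⟨x', r'⟩, rfl⟩
    rw [← h x r x' r', PiLp.inner_apply]
    exact Finset.sum_congr rfl fun y _ => mul_comm _ _

variable {n : ℕ} {B C R T : Type*} [Fintype B] [DecidableEq B]
  [Fintype C] [DecidableEq C] [Fintype R] [DecidableEq R] [Fintype T]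

/-- The isometry that applies Kraus operators and records which one. -/
def recordIsometry (K : T → Matrix B B ℂ) : Matrix (B × T) B ℂ := of fun p b => K p.2 p.1 b

theorem recordIsometry_isometry {K : T → Matrix B B ℂ} (hK : ∑ t, (K t)ᴴ * K t = 1) :
    (recordIsometry K)ᴴ * recordIsometry K = 1 := by
  rw [← hK]
  ext b b'
  simp only [mul_apply, conjTranspose_apply, recordIsometry, of_apply, Matrix.sum_apply,
    Fintype.sum_prod_type]
  exact Finset.sum_comm

theorem IsMatrixPVM.sum_sequential {P P' : (Fin n → Fin 2) → Matrix B B ℂ} (hP : IsMatrixPVM P)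
    (hP' : IsMatrixPVM P') (θ : Fin n → Fin 2) :
    ∑ t, (P' (outcome (flipAll θ) t) * P (outcome θ t))ᴴ *
      (P' (outcome (flipAll θ) t) * P (outcome θ t)) = 1 := by
  rw [sum_outcome θ (fun x y => (P' y * P x)ᴴ * (P' y * P x))]
  have h : ∀ x y, (P' y * P x)ᴴ * (P' y * P x) = P x * P' y * P x := fun x y => by
    rw [conjTranspose_mul, hP.herm, hP'.herm, ← mul_assoc, mul_assoc (P x), hP'.mul, if_pos rfl]
  simp only [h, ← Finset.sum_mul, ← Finset.mul_sum, hP'.sum, mul_one, hP.mul, if_true, hP.sum]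

theorem applyLocal_recordIsometry (K : T → Matrix B B ℂ) (L : T → Matrix C C ℂ)
    {A : Type*} [Fintype A] [DecidableEq A]
    (ψ : EuclideanSpace ℂ (A × B × C × R)) (a : A) (b : B) (t : T) (c : C) (s : T) (r : R) :
    applyLocal (recordIsometry K) (recordIsometry L) ψ.ofLp (a, (b, t), (c, s), r) =
      liftB A B C R (K t) (liftC A B C R (L s) ψ) (a, b, c, r) := by
  simp only [applyLocal, recordIsometry, of_apply, liftB_ofLp, liftC_ofLp, Finset.mul_sum,
    mul_assoc]

/-- The unnormalized vectors `|ψ_t⟩`. -/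
def roundedVector (v : (Fin n → Fin 2 → Fin 2) → (Fin n → Fin 2 → Fin 2) →
      EuclideanSpace ℂ ((Fin n → Fin 2) × B × C × R)) (t : Fin n → Fin 2 → Fin 2) :
    (B × (Fin n → Fin 2 → Fin 2)) × (C × (Fin n → Fin 2 → Fin 2)) × R → ℂ :=
  fun p => if p.1.2 = t ∧ p.2.1.2 = t then
    ∑ a, star (∏ i, breidbartState (t i) (a i)) * v t t (a, p.1.1, p.2.1.1, p.2.2) else 0

/-- Both record registers carry the label t, so distinct t live on disjoint sets of basis vectors.
-/
theorem roundedVector_orthogonalSupports (v : (Fin n → Fin 2 → Fin 2) →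
      (Fin n → Fin 2 → Fin 2) → EuclideanSpace ℂ ((Fin n → Fin 2) × B × C × R)) :
    OrthogonalSupports (roundedVector v) := by
  constructor
  · intro t t' h
    rw [supportLeft_isOrtho_iff]
    intro c r c' r'
    refine Finset.sum_eq_zero fun b _ => ?_
    by_cases hb : b.2 = t
    · have : b.2 ≠ t' := fun hb' => h (hb.symm.trans hb')
      simp [roundedVector, this]
    · simp [roundedVector, hb]
  · intro t t' h
    rw [supportRight_isOrtho_iff]
    intro b r b' r'
    refine Finset.sum_eq_zero fun c _ => ?_
    by_cases hc : c.2 = t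
    · have : c.2 ≠ t' := fun hc' => h (hc.symm.trans hc')
      simp [roundedVector, this]
    · simp [roundedVector, hc]

/-- The projection onto Alice's product state factors as a ket times a bra: `roundedVector` applies
the bra, `wbVector` restores the ket. -/
theorem wbVector_roundedVector (v : (Fin n → Fin 2 → Fin 2) →
      (Fin n → Fin 2 → Fin 2) → EuclideanSpace ℂ ((Fin n → Fin 2) × B × C × R))
    (a : Fin n → Fin 2) (b : B) (t : Fin n → Fin 2 → Fin 2) (c : C) (s : Fin n → Fin 2 → Fin 2)
    (r : R) :
    wbVector (roundedVector v) (a, (b, t), (c, s), r) =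
      (if t = s then liftA (Fin n → Fin 2) B C R (tensor fun i => breidbartProj (t i)) (v t s)
        else 0 : EuclideanSpace ℂ ((Fin n → Fin 2) × B × C × R)) (a, b, c, r) := by
  rw [wbVector, Finset.sum_eq_single t]
  · by_cases h : t = s
    · subst h
      rw [if_pos rfl, liftA_ofLp]
      simp only [roundedVector, and_self, if_true, Finset.mul_sum]
      refine Finset.sum_congr rfl fun a' _ => ?_
      simp only [tensor, of_apply, breidbartProj, vecMulVec_apply, Finset.prod_mul_distrib,
        Pi.star_apply, star_prod, mul_assoc]
      rfl
    · simp [roundedVector, h, Ne.symm h]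
  · intro t' _ ht'
    simp [roundedVector, Ne.symm ht']
  · simp

theorem sum_record (f : (Fin n → Fin 2) × (B × T) × (C × T) × R → ℝ) :
    ∑ p, f p = ∑ t, ∑ s, ∑ q : (Fin n → Fin 2) × B × C × R,
      f (q.1, (q.2.1, t), (q.2.2.1, s), q.2.2.2) := by
  rw [← Fintype.sum_prod_type', ← Fintype.sum_prod_type']
  refine Fintype.sum_equiv
    { toFun := fun p => ((p.2.1.2, p.2.2.1.2), (p.1, p.2.1.1, p.2.2.1.1, p.2.2.2))
      invFun := fun q => (q.2.1, (q.2.2.1, q.1.1), (q.2.2.2.1, q.1.2), q.2.2.2.2)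
      left_inv := fun _ => rfl
      right_inv := fun _ => rfl } _ _ fun _ => rfl

/-- Rigidity of projective strategies, for a purification of the state. -/
theorem projective_rigidity (S : Strategy (tfkw.parallel n) B C)
    (hB : ∀ θ, IsMatrixPVM (S.bob θ)) (hC : ∀ θ, IsMatrixPVM (S.charlie θ))
    (ψ : EuclideanSpace ℂ ((Fin n → Fin 2) × B × C × R)) (hψ1 : ‖ψ‖ = 1)
    (hψ : partialTrace (vecMulVec ψ.ofLp (star ψ.ofLp)) = S.state)
    {ε : ℝ} (hε : 0 ≤ ε) (hn : 1 ≤ n)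
    (hw : ∀ i, Real.cos (Real.pi / 8) ^ 2 - ε ≤ S.winProb i) :
    ∃ (V : Matrix (B × (Fin n → Fin 2 → Fin 2)) B ℂ) (W : Matrix (C × (Fin n → Fin 2 → Fin 2)) C ℂ)
      (φ : (Fin n → Fin 2 → Fin 2) →
        (B × (Fin n → Fin 2 → Fin 2)) × (C × (Fin n → Fin 2 → Fin 2)) × R → ℂ),
      Vᴴ * V = 1 ∧ Wᴴ * W = 1 ∧ OrthogonalSupports φ ∧
      ∑ p, ‖applyLocal V W ψ.ofLp p - wbVector φ p‖ ^ 2 ≤ (157 * n ^ 2 * √ε) ^ 2 := by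
  obtain ⟨θ, hθ⟩ := exists_question_rounding
    (a := fun i e => liftA (Fin n → Fin 2) B C R (siteOp i (qubitObservable e)))
    (P := fun θ x => liftB (Fin n → Fin 2) B C R (S.bob θ x))
    (Q := fun θ x => liftC (Fin n → Fin 2) B C R (S.charlie θ x))
    (fun i e => isReflection_liftA_siteOp i e)
    (fun i e e' h u => liftA_siteOp_anti i h u)
    (fun θ => (hB θ).map _) (fun θ => (hC θ).map _)
    (fun i e θ x u => liftAB_comm _ _ _) (fun i e θ x u => liftAC_comm _ _ _)
    (fun θ x θ' y u => liftBC_comm _ _ _) hψ1 hε hn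
    (fun i => by rw [← winProb_eq S hB hC ψ hψ i]; exact hw i)
    (Γ := fun t => liftA (Fin n → Fin 2) B C R (tensor fun i => breidbartProj (t i)))
    (fun t u => norm_sub_breidbart_sq_le t u)
  let K : (Fin n → Fin 2 → Fin 2) → Matrix B B ℂ := fun t =>
    S.bob (flipAll θ) (outcome (flipAll θ) t) * S.bob θ (outcome θ t)
  let L : (Fin n → Fin 2 → Fin 2) → Matrix C C ℂ := fun t =>
    S.charlie (flipAll θ) (outcome (flipAll θ) t) * S.charlie θ (outcome θ t)
  refine ⟨recordIsometry K, recordIsometry L, roundedVector fun t s =>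
    liftB (Fin n → Fin 2) B C R (K t) (liftC (Fin n → Fin 2) B C R (L s) ψ),
    recordIsometry_isometry ((hB θ).sum_sequential (hB _) θ),
    recordIsometry_isometry ((hC θ).sum_sequential (hC _) θ),
    roundedVector_orthogonalSupports _, ?_⟩
  refine le_trans (le_of_eq ?_) (hθ (fun t => liftB (Fin n → Fin 2) B C R (K t))
    (fun t => liftC (Fin n → Fin 2) B C R (L t)) (fun t u => by
      rw [map_mul, mul_apply_eq_comp]) (fun t u => by
      rw [map_mul, mul_apply_eq_comp]))
  rw [sum_record]
  refine Finset.sum_congr rfl fun t _ => Finset.sum_congr rfl fun s _ => ?_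
  rw [EuclideanSpace.norm_sq_eq]
  refine Finset.sum_congr rfl fun q _ => ?_
  rw [applyLocal_recordIsometry, wbVector_roundedVector]
  rfl

end ApplyLocal

/-! ### Local isometries acting on vectors, states and supports -/

section Isometries

variable {A B C R B' C' B'' C'' : Type*} [Fintype A] [DecidableEq A] [Fintype B]
  [Fintype C] [Fintype R] [Fintype B'] [Fintype C']
  [Fintype B''] [Fintype C'']

/-- The isometry that maps basis states to basis states. -/
def embedMatrix {X I : Type*} [DecidableEq I] (f : X → I) : Matrix I X ℂ :=
  (1 : Matrix I I ℂ).submatrix id f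

theorem embedMatrix_isometry {X I : Type*} [DecidableEq X] [Fintype I] [DecidableEq I]
    {f : X → I} (hf : Function.Injective f) : (embedMatrix f)ᴴ * embedMatrix f = 1 := by
  ext x y
  simp [embedMatrix, mul_apply, conjTranspose_apply, one_apply, hf.eq_iff]

theorem mul_embedMatrix {X I J : Type*} [Fintype I] [DecidableEq I] (U : Matrix J I ℂ)
    (f : X → I) : U * embedMatrix f = U.submatrix id f := by
  ext i x
  simp [embedMatrix, mul_apply, one_apply]

/-- Every isometry is the restriction of a unitary to the range of a given embedding. -/
theorem exists_unitary_mul_embedMatrix {X I : Type*} [Fintype X] [DecidableEq X] [Fintype I]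
    [DecidableEq I] {f : X → I} (hf : Function.Injective f) {V : Matrix I X ℂ}
    (hV : Vᴴ * V = 1) : ∃ U : Matrix I I ℂ, Uᴴ * U = 1 ∧ U * embedMatrix f = V := by
  -- The value 0 outside the range of f is irrelevant: orthonormality is required, and the basis
  -- prescribed, only on that range.
  let v : I → EuclideanSpace ℂ I :=
    Function.extend f (fun x => WithLp.toLp 2 fun i => V i x) 0
  have hv : ∀ x, v (f x) = WithLp.toLp 2 fun i => V i x := fun x => hf.extend_apply _ _ x
  have hort : Orthonormal ℂ ((Set.range f).domRestrict v) := by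
    rw [orthonormal_iff_ite]
    rintro ⟨_, x, rfl⟩ ⟨_, y, rfl⟩
    have := congrFun (congrFun hV x) y
    simp only [mul_apply, conjTranspose_apply, one_apply] at this
    change inner ℂ (v (f x)) (v (f y)) = _
    rw [hv, hv, PiLp.inner_apply]
    refine (Finset.sum_congr rfl fun i _ => mul_comm (G := ℂ) _ _).trans (this.trans ?_)
    exact if_congr ⟨fun h => by subst h; rfl, fun h => hf (congrArg Subtype.val h)⟩ rfl rfl
  obtain ⟨b, hb⟩ := hort.exists_orthonormalBasis_extension_of_card_eq (by simp)
  refine ⟨of fun i j => b j i, ?_, ?_⟩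
  · ext j k
    have := orthonormal_iff_ite.mp b.orthonormal j k
    rw [PiLp.inner_apply] at this
    simp only [mul_apply, conjTranspose_apply, one_apply, of_apply, ← this]
    exact Finset.sum_congr rfl fun i _ => mul_comm _ _
  · rw [mul_embedMatrix]
    ext i x
    simp [hb (f x) ⟨x, rfl⟩, hv]

/-- `(V ⊗ W)|φ⟩` without Alice's register. -/
def applyPair (V : Matrix B' B ℂ) (W : Matrix C' C ℂ) (φ : B × C × R → ℂ) : B' × C' × R → ℂ :=
  fun p => ∑ b, ∑ c, V p.1 b * W p.2.1 c * φ (b, c, p.2.2)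

theorem applyLocal_sub (V : Matrix B' B ℂ) (W : Matrix C' C ℂ) (φ χ : A × B × C × R → ℂ) :
    applyLocal V W (fun p => φ p - χ p) = fun p => applyLocal V W φ p - applyLocal V W χ p := by
  funext p
  simp only [applyLocal, mul_sub, Finset.sum_sub_distrib]

theorem applyLocal_applyLocal (V' : Matrix B'' B' ℂ) (W' : Matrix C'' C' ℂ) (V : Matrix B' B ℂ)
    (W : Matrix C' C ℂ) (ψ : A × B × C × R → ℂ) :
    applyLocal V' W' (applyLocal V W ψ) = applyLocal (V' * V) (W' * W) ψ := by
  funext p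
  simp only [applyLocal, mul_apply, Finset.mul_sum, Finset.sum_mul]
  have h : ∀ f : B → C → B' → C' → ℂ, ∑ b', ∑ c', ∑ b, ∑ c, f b c b' c' =
      ∑ b, ∑ c, ∑ c', ∑ b', f b c b' c' := by
    intro f
    calc _ = ∑ b', ∑ b, ∑ c', ∑ c, f b c b' c' :=
          Finset.sum_congr rfl fun _ _ => Finset.sum_comm
      _ = ∑ b, ∑ b', ∑ c', ∑ c, f b c b' c' := Finset.sum_comm
      _ = ∑ b, ∑ b', ∑ c, ∑ c', f b c b' c' :=
          Finset.sum_congr rfl fun _ _ => Finset.sum_congr rfl fun _ _ => Finset.sum_comm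
      _ = ∑ b, ∑ c, ∑ b', ∑ c', f b c b' c' := Finset.sum_congr rfl fun _ _ => Finset.sum_comm
      _ = _ := Finset.sum_congr rfl fun _ _ => Finset.sum_congr rfl fun _ _ => Finset.sum_comm
  rw [h]
  refine Finset.sum_congr rfl fun b _ => Finset.sum_congr rfl fun c _ =>
    Finset.sum_congr rfl fun c' _ => Finset.sum_congr rfl fun b' _ => ?_
  ring

theorem applyLocal_wbVector {n : ℕ} (V : Matrix B' B ℂ) (W : Matrix C' C ℂ)
    (φ : (Fin n → Fin 2 → Fin 2) → B × C × R → ℂ) :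
    applyLocal V W (wbVector φ) = wbVector fun t => applyPair V W (φ t) := by
  funext p
  simp only [applyLocal, wbVector, applyPair, Finset.mul_sum]
  have h : ∀ f : B → C → (Fin n → Fin 2 → Fin 2) → ℂ, ∑ b, ∑ c, ∑ t, f b c t =
      ∑ t, ∑ b, ∑ c, f b c t := by
    intro f
    rw [Finset.sum_comm (s := (Finset.univ : Finset (Fin n → Fin 2 → Fin 2)))]
    exact Finset.sum_congr rfl fun _ _ => Finset.sum_comm
  rw [h]
  refine Finset.sum_congr rfl fun t _ => Finset.sum_congr rfl fun b _ =>
    Finset.sum_congr rfl fun c _ => ?_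
  ring

/-- A vector in `A ⊗ B ⊗ C ⊗ R` as an operator from `R` to `A ⊗ B ⊗ C`. -/
def registerMatrix {A B C R : Type*} (ψ : A × B × C × R → ℂ) : Matrix (A × B × C) R ℂ :=
  of fun p r => ψ (p.1, p.2.1, p.2.2, r)

theorem partialTrace_vecMulVec {A B C : Type*} (ψ φ : A × B × C × R → ℂ) :
    partialTrace (vecMulVec ψ (star φ)) = registerMatrix ψ * (registerMatrix φ)ᴴ := by
  ext p q
  simp [partialTrace, registerMatrix, mul_apply, vecMulVec_apply]

theorem partialTrace_applyLocal (V : Matrix B' B ℂ) (W : Matrix C' C ℂ)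
    (ψ : A × B × C × R → ℂ) :
    partialTrace (vecMulVec (applyLocal V W ψ) (star (applyLocal V W ψ))) =
      conjLocal V W (partialTrace (vecMulVec ψ (star ψ))) := by
  have h : ∀ (q : A × B' × C') (r : R), applyLocal V W ψ (q.1, q.2.1, q.2.2, r) =
      ((1 : Matrix A A ℂ) ⊗ₖ (V ⊗ₖ W)) q ⬝ᵥ fun p => ψ (p.1, p.2.1, p.2.2, r) := by
    intro q r
    simp only [applyLocal, dotProduct, Fintype.sum_prod_type, kroneckerMap_apply]
    rw [Finset.sum_eq_single q.1]
    · simp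
    · intro a _ ha
      simp [one_apply, Ne.symm ha]
    · simp
  have e : registerMatrix (applyLocal V W ψ) =
      ((1 : Matrix A A ℂ) ⊗ₖ (V ⊗ₖ W)) * registerMatrix ψ := by
    ext q r
    exact h q r
  rw [partialTrace_vecMulVec, partialTrace_vecMulVec, conjLocal, e, conjTranspose_mul]
  simp only [Matrix.mul_assoc]

theorem trace_kronecker_mul_conjLocal (M : Matrix A A ℂ) (N : Matrix B' B' ℂ)
    (O : Matrix C' C' ℂ) (V : Matrix B' B ℂ) (W : Matrix C' C ℂ)
    (ρ : Matrix (A × B × C) (A × B × C) ℂ) :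
    ((M ⊗ₖ (N ⊗ₖ O)) * conjLocal V W ρ).trace =
      ((M ⊗ₖ ((Vᴴ * N * V) ⊗ₖ (Wᴴ * O * W))) * ρ).trace := by
  rw [conjLocal, ← Matrix.mul_assoc, trace_mul_comm, conjTranspose_kronecker, conjTranspose_kronecker,
    conjTranspose_one, ← Matrix.mul_assoc, ← Matrix.mul_assoc, ← mul_kronecker_mul, ← mul_kronecker_mul,
    ← mul_kronecker_mul, ← mul_kronecker_mul, one_mul, mul_one]

theorem trace_conjLocal [DecidableEq B] [DecidableEq C] {V : Matrix B' B ℂ} {W : Matrix C' C ℂ}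
    (hV : Vᴴ * V = 1) (hW : Wᴴ * W = 1)
    (ρ : Matrix (A × B × C) (A × B × C) ℂ) : (conjLocal V W ρ).trace = ρ.trace := by
  rw [conjLocal, trace_mul_comm, conjTranspose_kronecker, conjTranspose_kronecker,
    conjTranspose_one, ← Matrix.mul_assoc, ← mul_kronecker_mul, ← mul_kronecker_mul, hV, hW, one_mul,
    one_kronecker_one, one_kronecker_one, one_mul]

theorem trace_partialTrace (ψ : A × B × C × R → ℂ) :
    (partialTrace (vecMulVec ψ (star ψ))).trace = ((∑ p, ‖ψ p‖ ^ 2 : ℝ) : ℂ) := by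
  simp only [trace, diag_apply, partialTrace, of_apply, vecMulVec_apply, Pi.star_apply,
    Fintype.sum_prod_type, Complex.ofReal_sum, Complex.ofReal_pow]
  simp only [← Complex.mul_conj']
  rfl

theorem sum_norm_sq_applyLocal [DecidableEq B] [DecidableEq C] {V : Matrix B' B ℂ}
    {W : Matrix C' C ℂ} (hV : Vᴴ * V = 1) (hW : Wᴴ * W = 1) (ψ : A × B × C × R → ℂ) :
    ∑ p, ‖applyLocal V W ψ p‖ ^ 2 = ∑ p, ‖ψ p‖ ^ 2 := by
  have h := trace_partialTrace (applyLocal V W ψ)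
  rw [partialTrace_applyLocal, trace_conjLocal hV hW, trace_partialTrace] at h
  exact_mod_cast h.symm

theorem star_mulVec_dotProduct [DecidableEq B] {V : Matrix B' B ℂ} (hV : Vᴴ * V = 1)
    (x y : B → ℂ) : star (V *ᵥ x) ⬝ᵥ (V *ᵥ y) = star x ⬝ᵥ y := by
  rw [star_mulVec, dotProduct_mulVec, vecMul_vecMul, hV, vecMul_one]

theorem OrthogonalSupports.applyPair {T : Type*} [DecidableEq B] [DecidableEq C]
    {φ : T → B × C × R → ℂ} (hφ : OrthogonalSupports φ) {V : Matrix B' B ℂ} {W : Matrix C' C ℂ}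
    (hV : Vᴴ * V = 1) (hW : Wᴴ * W = 1) :
    OrthogonalSupports fun t => MoE.applyPair V W (φ t) := by
  constructor
  · intro t t' h
    have h := (supportLeft_isOrtho_iff _ _).mp (hφ.1 t t' h)
    rw [supportLeft_isOrtho_iff]
    intro c r c' r'
    have e : ∀ t c r, (fun b => MoE.applyPair V W (φ t) (b, c, r)) =
        V *ᵥ fun b => ∑ c₁, W c c₁ * φ t (b, c₁, r) := by
      intro t c r
      funext b
      simp only [MoE.applyPair, mulVec, dotProduct, Finset.mul_sum, mul_assoc]
    have := star_mulVec_dotProduct hV (fun b => ∑ c₁, W c c₁ * φ t (b, c₁, r))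
      (fun b => ∑ c₁, W c' c₁ * φ t' (b, c₁, r'))
    rw [← e, ← e] at this
    refine this.trans ?_
    simp only [dotProduct, Pi.star_apply, star_sum, star_mul', Finset.sum_mul_sum]
    rw [Finset.sum_comm]
    refine Finset.sum_eq_zero fun c₁ _ => ?_
    rw [Finset.sum_comm]
    refine Finset.sum_eq_zero fun c₂ _ => ?_
    simp only [mul_mul_mul_comm, ← Finset.mul_sum, h, mul_zero]
  · intro t t' h
    have h := (supportRight_isOrtho_iff _ _).mp (hφ.2 t t' h)
    rw [supportRight_isOrtho_iff]
    intro b r b' r'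
    have e : ∀ t b r, (fun c => MoE.applyPair V W (φ t) (b, c, r)) =
        W *ᵥ fun c => ∑ b₁, V b b₁ * φ t (b₁, c, r) := by
      intro t b r
      funext c
      simp only [MoE.applyPair, mulVec, dotProduct, Finset.mul_sum]
      rw [Finset.sum_comm]
      refine Finset.sum_congr rfl fun c₁ _ => Finset.sum_congr rfl fun b₁ _ => ?_
      ring
    have := star_mulVec_dotProduct hW (fun c => ∑ b₁, V b b₁ * φ t (b₁, c, r))
      (fun c => ∑ b₁, V b' b₁ * φ t' (b₁, c, r'))
    rw [← e, ← e] at this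
    refine this.trans ?_
    simp only [dotProduct, Pi.star_apply, star_sum, star_mul', Finset.sum_mul_sum]
    rw [Finset.sum_comm]
    refine Finset.sum_eq_zero fun c₁ _ => ?_
    rw [Finset.sum_comm]
    refine Finset.sum_eq_zero fun c₂ _ => ?_
    simp only [mul_mul_mul_comm, ← Finset.mul_sum, h, mul_zero]

end Isometries

/-! ### Dilation of measurements -/

section Naimark

variable {X Y : Type*} [Fintype X] [DecidableEq X] [Fintype Y] [DecidableEq Y]

/-- Naimark's dilation theorem, with a dilation space that does not depend on the measurement. -/
theorem IsPOVM.exists_dilation {P : Y → Matrix X X ℂ} (hP : IsPOVM P) (y₀ : Y) :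
    ∃ Q : Y → Matrix (X × Y) (X × Y) ℂ, IsMatrixPVM Q ∧
      ∀ y, (embedMatrix fun x : X => (x, y₀))ᴴ * Q y * embedMatrix (fun x : X => (x, y₀)) = P y := by
  choose N hN using fun y => CStarAlgebra.nonneg_iff_eq_star_mul_self.mp (hP.1 y).nonneg
  have hf : Function.Injective fun x : X => (x, y₀) := fun x x' h => congrArg Prod.fst h
  have hsum : ∑ y, (N y)ᴴ * N y = 1 := by
    rw [← hP.2]
    exact Finset.sum_congr rfl fun y _ => (hN y).symm
  -- The isometry recording the outcome of the Kraus operators `N y` extends to a unitary on the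
  -- whole fixed dilation space; reading the record and undoing U gives the projective measurement.
  obtain ⟨U, hU, hUV⟩ := exists_unitary_mul_embedMatrix hf (recordIsometry_isometry hsum)
  have hU' : U * Uᴴ = 1 := mul_eq_one_comm.mp hU
  let D : Y → Matrix (X × Y) (X × Y) ℂ := fun y => diagonal fun p => if p.2 = y then 1 else 0
  have hDmul : ∀ y z, D y * D z = if y = z then D y else 0 := by
    intro y z
    rw [diagonal_mul_diagonal]
    split_ifs with h
    · subst h
      congr 1
      funext p
      split_ifs <;> simp
    · rw [← diagonal_zero]
      congr 1
      funext p
      by_cases hp : p.2 = y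
      · simp [hp, h]
      · simp [hp]
  refine ⟨fun y => Uᴴ * D y * U, ⟨fun y => ?_, fun y z => ?_, ?_⟩, fun y => ?_⟩
  · rw [conjTranspose_mul, conjTranspose_mul, conjTranspose_conjTranspose, ← Matrix.mul_assoc]
    congr 2
    rw [diagonal_conjTranspose]
    congr 1
    funext p
    simp only [Pi.star_apply]
    split_ifs <;> simp
  · have : Uᴴ * D y * U * (Uᴴ * D z * U) = Uᴴ * (D y * (U * Uᴴ) * D z) * U := by
      simp only [mul_assoc]
    rw [this, hU', mul_one, hDmul]
    split_ifs <;> simp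
  · rw [← Finset.sum_mul, ← Finset.mul_sum]
    have : ∑ y, D y = 1 := by
      ext p q
      simp [D, Matrix.sum_apply, diagonal_apply, one_apply]
    rw [this, mul_one, hU]
  · have : (embedMatrix fun x : X => (x, y₀))ᴴ * (Uᴴ * D y * U) *
        embedMatrix (fun x : X => (x, y₀)) = (U * embedMatrix fun x : X => (x, y₀))ᴴ * D y *
          (U * embedMatrix fun x : X => (x, y₀)) := by
      rw [conjTranspose_mul]
      simp only [Matrix.mul_assoc]
    rw [this, hUV, hN y]
    ext i j
    rw [mul_apply, mul_apply]
    simp only [D, mul_diagonal, conjTranspose_apply, Fintype.sum_prod_type, recordIsometry,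
      of_apply, star_eq_conjTranspose]
    simp

end Naimark

/-! ### Trace distance and purifications -/

section TraceDistance

variable {A B C I R : Type*} [Fintype A] [DecidableEq A] [Fintype B] [DecidableEq B] [Fintype C]
  [DecidableEq C] [Fintype I] [DecidableEq I] [Fintype R]

open scoped Matrix.Norms.L2Operator in
theorem continuous_sqrt_conjTranspose_mul_self :
    Continuous fun M : Matrix I I ℂ => CFC.sqrt (Mᴴ * M) :=
  CFC.continuous_abs (A := Matrix I I ℂ)

theorem continuous_traceDist {X : Type*} [TopologicalSpace X] {f g : X → Matrix I I ℂ}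
    (hf : Continuous f) (hg : Continuous g) : Continuous fun x => traceDist (f x) (g x) := by
  have h := continuous_sqrt_conjTranspose_mul_self.comp (hf.sub hg)
  exact continuous_const.mul (Complex.continuous_re.comp h.matrix_trace)

theorem traceDist_nonneg (ρ σ : Matrix I I ℂ) : 0 ≤ traceDist ρ σ := by
  have h : (CFC.sqrt ((ρ - σ)ᴴ * (ρ - σ))).PosSemidef := (CFC.sqrt_nonneg _).posSemidef
  have := (Complex.le_def.mp h.trace_nonneg).1
  exact mul_nonneg (by norm_num) this

theorem exists_sign {M : Matrix I I ℂ} (hM : Mᴴ = M) :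
    ∃ E : Matrix I I ℂ, Eᴴ * E = 1 ∧ CFC.sqrt (Mᴴ * M) = E * M := by
  -- The sign is 1 at 0, so the square of `cfc f M` is 1 even for singular M. Continuity on the
  -- spectrum is automatic because the spectrum is finite.
  let f : ℝ → ℝ := fun x => if 0 ≤ x then 1 else -1
  have hsa : IsSelfAdjoint M := hM
  have hfin : (spectrum ℝ M).Finite := Matrix.finite_real_spectrum
  have hf : ContinuousOn f (spectrum ℝ M) := hfin.continuousOn f
  have hE : IsSelfAdjoint (cfc f M) := cfc_predicate f M
  have hEM : cfc f M * M = cfc (fun x => f x * x) M := by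
    rw [cfc_mul f (fun x => x) M hf, cfc_id' ℝ M]
  have hff : cfc f M * cfc f M = 1 := by
    rw [← cfc_mul f f M hf hf, ← cfc_one ℝ M]
    congr 1
    funext x
    simp only [f, Pi.one_apply]
    split_ifs <;> norm_num
  refine ⟨cfc f M, by rw [← star_eq_conjTranspose, hE.star_eq, hff], ?_⟩
  refine CFC.sqrt_unique ?_ ?_
  · rw [hM]
    have hc := (cfc_commute_cfc id f M).eq
    rw [cfc_id ℝ M] at hc
    rw [mul_assoc, ← mul_assoc M, hc, mul_assoc, ← mul_assoc, hff, one_mul]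
  · rw [hEM]
    refine cfc_nonneg fun x _ => ?_
    simp only [f]
    split_ifs <;> linarith

theorem trace_mul_conjTranspose_self (X : Matrix I R ℂ) :
    (X * Xᴴ).trace = ((∑ p : I × R, ‖X p.1 p.2‖ ^ 2 : ℝ) : ℂ) := by
  simp only [trace, diag_apply, mul_apply, conjTranspose_apply, Fintype.sum_prod_type,
    Complex.ofReal_sum, Complex.ofReal_pow, ← Complex.mul_conj']
  rfl

theorem re_trace_mul_conjTranspose_le (X Y : Matrix I R ℂ) :
    (X * Yᴴ).trace.re ≤ √((X * Xᴴ).trace.re) * √((Y * Yᴴ).trace.re) := by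
  let v : Matrix I R ℂ → EuclideanSpace ℂ (I × R) := fun X => WithLp.toLp 2 fun p => X p.1 p.2
  have hv : ∀ X, √((X * Xᴴ).trace.re) = ‖v X‖ := fun X => by
    rw [trace_mul_conjTranspose_self, Complex.ofReal_re, EuclideanSpace.norm_eq]
  have h : (X * Yᴴ).trace = inner ℂ (v Y) (v X) := by
    rw [PiLp.inner_apply]
    simp only [trace, diag_apply, mul_apply, conjTranspose_apply, Fintype.sum_prod_type]
    rfl
  rw [hv, hv, h, mul_comm]
  exact (Complex.re_le_norm _).trans (norm_inner_le_norm _ _)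

/-- The trace distance in terms of purifications. -/
theorem traceDist_mul_conjTranspose_le (X Y : Matrix I R ℂ) :
    traceDist (X * Xᴴ) (Y * Yᴴ) ≤
      1 / 2 * (√(((X - Y) * (X - Y)ᴴ).trace.re) * √(((X + Y) * (X + Y)ᴴ).trace.re)) := by
  have hM : (X * Xᴴ - Y * Yᴴ)ᴴ = X * Xᴴ - Y * Yᴴ := by
    simp [conjTranspose_sub, conjTranspose_mul]
  obtain ⟨E, hE, hEM⟩ := exists_sign hM
  rw [traceDist, hEM]
  refine mul_le_mul_of_nonneg_left ?_ (by norm_num)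
  -- Polarization into `X - Y` and `X + Y`; each term then succumbs to Cauchy–Schwarz for the
  -- Hilbert–Schmidt product, under which E is isometric.
  have hsplit : E * (X * Xᴴ - Y * Yᴴ) = (1 / 2 : ℂ) •
      ((E * (X - Y)) * (X + Y)ᴴ + (E * (X + Y)) * (X - Y)ᴴ) := by
    simp only [conjTranspose_sub, conjTranspose_add, Matrix.mul_add, Matrix.mul_sub,
      Matrix.add_mul, Matrix.sub_mul, Matrix.mul_assoc]
    module
  have hnorm : ∀ Z : Matrix I R ℂ, ((E * Z) * (E * Z)ᴴ).trace = (Z * Zᴴ).trace := fun Z => by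
    rw [conjTranspose_mul, Matrix.mul_assoc, trace_mul_comm, ← Matrix.mul_assoc,
      Matrix.mul_assoc (Z * Zᴴ), hE, mul_one]
  have h1 := re_trace_mul_conjTranspose_le (E * (X - Y)) (X + Y)
  have h2 := re_trace_mul_conjTranspose_le (E * (X + Y)) (X - Y)
  rw [hnorm] at h1 h2
  rw [hsplit, trace_smul, trace_add]
  have : ((1 / 2 : ℂ) • (((E * (X - Y)) * (X + Y)ᴴ).trace +
      ((E * (X + Y)) * (X - Y)ᴴ).trace)).re = 1 / 2 * (((E * (X - Y)) * (X + Y)ᴴ).trace.re +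
      ((E * (X + Y)) * (X - Y)ᴴ).trace.re) := by
    rw [show (1 / 2 : ℂ) = ((1 / 2 : ℝ) : ℂ) by norm_num, smul_eq_mul, Complex.re_ofReal_mul,
      Complex.add_re]
  rw [this]
  linarith [mul_comm √(((X - Y) * (X - Y)ᴴ).trace.re) √(((X + Y) * (X + Y)ᴴ).trace.re)]

theorem traceDist_partialTrace_le (ψ φ : EuclideanSpace ℂ (A × B × C × R)) :
    traceDist (partialTrace (vecMulVec ψ.ofLp (star ψ.ofLp)))
      (partialTrace (vecMulVec φ.ofLp (star φ.ofLp))) ≤ 1 / 2 * (‖ψ - φ‖ * ‖ψ + φ‖) := by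
  have hv : ∀ χ : EuclideanSpace ℂ (A × B × C × R),
      √((registerMatrix χ.ofLp * (registerMatrix χ.ofLp)ᴴ).trace.re) = ‖χ‖ := fun χ => by
    rw [← partialTrace_vecMulVec, trace_partialTrace, Complex.ofReal_re, EuclideanSpace.norm_eq]
  rw [← hv, ← hv, partialTrace_vecMulVec, partialTrace_vecMulVec]
  exact traceDist_mul_conjTranspose_le _ _

/-- A purification of a density operator. -/
theorem exists_purification {ρ : Matrix (A × B × C) (A × B × C) ℂ} (hρ : ρ.PosSemidef)
    (e : R ≃ A × B × C) :
    ∃ ψ : EuclideanSpace ℂ (A × B × C × R), partialTrace (vecMulVec ψ.ofLp (star ψ.ofLp)) = ρ := by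
  obtain ⟨N, hN⟩ := CStarAlgebra.nonneg_iff_eq_star_mul_self.mp hρ.nonneg
  refine ⟨WithLp.toLp 2 fun p => Nᴴ (p.1, p.2.1, p.2.2.1) (e p.2.2.2), ?_⟩
  rw [partialTrace_vecMulVec, hN]
  ext p q
  simp only [mul_apply, registerMatrix, of_apply, conjTranspose_apply, star_star,
    star_eq_conjTranspose]
  exact Equiv.sum_comp e (fun x => star (N x p) * N x q)

theorem norm_purification {ρ : Matrix (A × B × C) (A × B × C) ℂ} (hρ : ρ.trace = 1)
    {ψ : EuclideanSpace ℂ (A × B × C × R)}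
    (hψ : partialTrace (vecMulVec ψ.ofLp (star ψ.ofLp)) = ρ) : ‖ψ‖ = 1 := by
  have h := trace_partialTrace ψ.ofLp
  rw [hψ, hρ] at h
  rw [EuclideanSpace.norm_eq, Real.sqrt_eq_one]
  exact_mod_cast h.symm

end TraceDistance

/-! ### From arbitrary strategies to projective ones, with fixed isometries -/

section Dilation

variable {n : ℕ} {B C R : Type*} [Fintype B] [DecidableEq B] [Fintype C] [DecidableEq C]
  [Fintype R] [DecidableEq R]

theorem IsMatrixPVM.isPOVM {X Y : Type*} [Fintype X] [DecidableEq X] [Fintype Y] [DecidableEq Y]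
    {P : Y → Matrix X X ℂ} (hP : IsMatrixPVM P) : IsPOVM P := by
  refine ⟨fun y => ?_, hP.sum⟩
  have : P y = (P y)ᴴ * P y := by rw [hP.herm, hP.mul, if_pos rfl]
  rw [this]
  exact posSemidef_conjTranspose_mul_self _

theorem isDensity_conjLocal {A B' C' : Type*} [Fintype A] [DecidableEq A] [Fintype B']
    [Fintype C'] {V : Matrix B' B ℂ} {W : Matrix C' C ℂ} (hV : Vᴴ * V = 1) (hW : Wᴴ * W = 1)
    {ρ : Matrix (A × B × C) (A × B × C) ℂ} (hρ : IsDensity ρ) : IsDensity (conjLocal V W ρ) :=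
  ⟨hρ.1.mul_mul_conjTranspose_same _, by rw [trace_conjLocal hV hW, hρ.2]⟩

theorem isometry_mul {X Y Z : Type*} [Fintype X] [DecidableEq X] [Fintype Y] [DecidableEq Y]
    [Fintype Z] {V : Matrix Z Y ℂ} {W : Matrix Y X ℂ} (hV : Vᴴ * V = 1) (hW : Wᴴ * W = 1) :
    (V * W)ᴴ * (V * W) = 1 := by
  rw [conjTranspose_mul, Matrix.mul_assoc, ← Matrix.mul_assoc Vᴴ, hV, Matrix.one_mul, hW]

/-- An isometry becomes a given embedding after another isometry. -/
theorem exists_isometry_mul_eq {X Y Z : Type*} [Fintype X] [DecidableEq X] [Fintype Y]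
    [DecidableEq Y] [Fintype Z] [DecidableEq Z] {V : Matrix Y X ℂ} (hV : Vᴴ * V = 1) (e : Y ↪ Z)
    (f : X ↪ Z) : ∃ D : Matrix Z Y ℂ, Dᴴ * D = 1 ∧ D * V = embedMatrix f := by
  have he := embedMatrix_isometry e.injective
  obtain ⟨U, hU, hUf⟩ := exists_unitary_mul_embedMatrix f.injective (isometry_mul he hV)
  refine ⟨Uᴴ * embedMatrix e, isometry_mul ?_ he, ?_⟩
  · rw [conjTranspose_conjTranspose, mul_eq_one_comm.mp hU]
  · rw [Matrix.mul_assoc, ← hUf, ← Matrix.mul_assoc, hU, Matrix.one_mul]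

theorem conjTranspose_marginal {B' : Type*} [Fintype B'] (V : Matrix B' B ℂ)
    (P : (Fin n → Fin 2) → Matrix B' B' ℂ) (i : Fin n) (y : Fin 2) :
    Vᴴ * marginal P i y * V = marginal (fun x => Vᴴ * P x * V) i y := by
  rw [marginal, marginal, Matrix.mul_sum, Matrix.sum_mul]

theorem Strategy.exists_projective (S : Strategy (tfkw.parallel n) B C) :
    ∃ S' : Strategy (tfkw.parallel n) (B × (Fin n → Fin 2)) (C × (Fin n → Fin 2)),
      (∀ θ, IsMatrixPVM (S'.bob θ)) ∧ (∀ θ, IsMatrixPVM (S'.charlie θ)) ∧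
      S'.state = conjLocal (embedMatrix fun b => (b, 0)) (embedMatrix fun c => (c, 0)) S.state ∧
      ∀ i, S'.winProb i = S.winProb i := by
  choose P hP hP' using fun θ => (S.bob_povm θ).exists_dilation 0
  choose Q hQ hQ' using fun θ => (S.charlie_povm θ).exists_dilation 0
  refine ⟨⟨P, fun θ => (hP θ).isPOVM, Q, fun θ => (hQ θ).isPOVM, _,
    isDensity_conjLocal (embedMatrix_isometry (Prod.mk_left_injective 0)) (embedMatrix_isometry (Prod.mk_left_injective 0))
      S.state_density⟩, hP, hQ, rfl, fun i => ?_⟩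
  simp only [Strategy.winProb, trace_kronecker_mul_conjLocal, conjTranspose_marginal, hP', hQ']

/-- The embeddings f and f' are prescribed, so the isometries do not depend on the strategy. The
embeddings e and e' serve only to make the target registers large enough to hold the dilated and
recorded ones. -/
theorem Strategy.exists_rounding (S : Strategy (tfkw.parallel n) B C)
    (ψ : EuclideanSpace ℂ ((Fin n → Fin 2) × B × C × R))
    (hψ : partialTrace (vecMulVec ψ.ofLp (star ψ.ofLp)) = S.state)
    {ε : ℝ} (hε : 0 ≤ ε) (hn : 1 ≤ n)
    (hw : ∀ i, Real.cos (Real.pi / 8) ^ 2 - ε ≤ S.winProb i)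
    {B' C' : Type*} [Fintype B'] [DecidableEq B'] [Fintype C'] [DecidableEq C']
    (e : (B × (Fin n → Fin 2)) × (Fin n → Fin 2 → Fin 2) ↪ B')
    (e' : (C × (Fin n → Fin 2)) × (Fin n → Fin 2 → Fin 2) ↪ C') (f : B ↪ B') (f' : C ↪ C') :
    ∃ φ : (Fin n → Fin 2 → Fin 2) → B' × C' × R → ℂ, OrthogonalSupports φ ∧
      ∑ p, ‖applyLocal (embedMatrix f) (embedMatrix f') ψ.ofLp p - wbVector φ p‖ ^ 2 ≤
        (157 * n ^ 2 * √ε) ^ 2 := by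
  obtain ⟨S', hB, hC, hS', hwin⟩ := S.exists_projective
  obtain ⟨V, W, φ, hV, hW, hφ, hdist⟩ := projective_rigidity S' hB hC
    (WithLp.toLp 2 (applyLocal (embedMatrix fun b => (b, 0)) (embedMatrix fun c => (c, 0)) ψ.ofLp))
    (norm_purification S'.state_density.2 (by rw [partialTrace_applyLocal, hψ, hS']))
    (by rw [partialTrace_applyLocal, hψ, hS']) hε hn (fun i => by rw [hwin]; exact hw i)
  -- D absorbs dilation and recording into the fixed embedding. Applied to both vectors it preserves
  -- their distance and the orthogonality of the supports.
  obtain ⟨D, hD, hDV⟩ := exists_isometry_mul_eq (V := V * embedMatrix fun b => (b, 0))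
    (isometry_mul hV (embedMatrix_isometry (Prod.mk_left_injective 0))) e f
  obtain ⟨D', hD', hDW⟩ := exists_isometry_mul_eq (V := W * embedMatrix fun c => (c, 0))
    (isometry_mul hW (embedMatrix_isometry (Prod.mk_left_injective 0))) e' f'
  refine ⟨fun t => applyPair D D' (φ t), hφ.applyPair hD hD', le_trans (le_of_eq ?_) hdist⟩
  rw [← applyLocal_wbVector, ← hDV, ← hDW, ← applyLocal_applyLocal, ← applyLocal_applyLocal]
  rw [← sum_norm_sq_applyLocal hD hD', applyLocal_sub]

end Dilation

/-! ### The compact set of admissible vectors -/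

section ValidVectors

variable {n : ℕ} {B C R : Type*} [Fintype B] [Fintype C] [Fintype R]

theorem OrthogonalSupports.sum_mul_star_eq_zero {T : Type*} {φ : T → B × C × R → ℂ}
    (hφ : OrthogonalSupports φ) {t t' : T} (h : t ≠ t') : ∑ q, star (φ t q) * φ t' q = 0 := by
  have h := (supportLeft_isOrtho_iff _ _).mp (hφ.1 t t' h)
  rw [Fintype.sum_prod_type, Finset.sum_comm]
  exact Finset.sum_eq_zero fun q _ => h q.1 q.2 q.1 q.2

theorem sum_star_prod_breidbartState (t : Fin n → Fin 2 → Fin 2) :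
    ∑ a : Fin n → Fin 2, star (∏ i, breidbartState (t i) (a i)) *
      ∏ i, breidbartState (t i) (a i) = 1 := by
  simp only [star_prod, ← Finset.prod_mul_distrib]
  rw [← Fintype.prod_sum (fun i a => star (breidbartState (t i) a) * breidbartState (t i) a)]
  exact Finset.prod_eq_one fun i _ => breidbartState_norm (t i)

/-- Alice's states for distinct t need not be orthogonal; the cross terms vanish because of the
supports on Bob's side. This gives the boundedness behind `isCompact_validVectors`. -/
theorem OrthogonalSupports.sum_norm_sq_wbVector {φ : (Fin n → Fin 2 → Fin 2) → B × C × R → ℂ}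
    (hφ : OrthogonalSupports φ) :
    ∑ p, ‖wbVector φ p‖ ^ 2 = ∑ t, ∑ q, ‖φ t q‖ ^ 2 := by
  let β : (Fin n → Fin 2 → Fin 2) → (Fin n → Fin 2) → ℂ := fun t a =>
    ∏ i, breidbartState (t i) (a i)
  have hwb : ∀ p, wbVector φ p = ∑ t, β t p.1 * φ t p.2 := fun p => rfl
  have h : ∑ p, star (wbVector φ p) * wbVector φ p = ∑ t, ∑ q, star (φ t q) * φ t q := by
    simp only [hwb, star_sum, star_mul', Finset.sum_mul_sum]
    rw [Finset.sum_comm]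
    refine Finset.sum_congr rfl fun t _ => ?_
    rw [Finset.sum_comm]
    have e : ∀ t', ∑ p : (Fin n → Fin 2) × B × C × R,
        star (β t p.1) * star (φ t p.2) * (β t' p.1 * φ t' p.2) =
        (∑ a, star (β t a) * β t' a) * ∑ q, star (φ t q) * φ t' q := by
      intro t'
      rw [Finset.sum_mul_sum, Fintype.sum_prod_type]
      simp only [mul_mul_mul_comm]
    simp only [e]
    rw [Finset.sum_eq_single t]
    · rw [sum_star_prod_breidbartState, one_mul]
    · intro t' _ ht'
      rw [hφ.sum_mul_star_eq_zero (Ne.symm ht'), mul_zero]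
    · simp
  have hn : ∀ z : ℂ, star z * z = ((‖z‖ ^ 2 : ℝ) : ℂ) := fun z => by
    rw [Complex.ofReal_pow, ← Complex.conj_mul']
    rfl
  simp only [hn] at h
  exact_mod_cast h

/-- The families of vectors that describe a normalized state of the required form. -/
def validVectors (n : ℕ) (B C R : Type*) [Fintype B] [Fintype C] [Fintype R] :
    Set ((Fin n → Fin 2 → Fin 2) → B × C × R → ℂ) :=
  {φ | OrthogonalSupports φ ∧ ∑ p, ‖wbVector φ p‖ ^ 2 = 1}

theorem continuous_wbVector :
    Continuous fun φ : (Fin n → Fin 2 → Fin 2) → B × C × R → ℂ => wbVector φ := by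
  unfold wbVector
  fun_prop

theorem isCompact_validVectors : IsCompact (validVectors n B C R) := by
  refine Metric.isCompact_of_isClosed_isBounded ?_ ?_
  · have : validVectors n B C R =
        (⋂ (t) (t') (_ : t ≠ t') (c) (r) (c') (r'),
          {φ | ∑ b, star (φ t (b, c, r)) * φ t' (b, c', r') = 0}) ∩
        (⋂ (t) (t') (_ : t ≠ t') (b) (r) (b') (r'),
          {φ | ∑ c, star (φ t (b, c, r)) * φ t' (b', c, r') = 0}) ∩
        {φ | ∑ p, ‖wbVector φ p‖ ^ 2 = 1} := by
      ext φ
      simp only [validVectors, OrthogonalSupports, supportLeft_isOrtho_iff,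
        supportRight_isOrtho_iff, Set.mem_inter_iff, Set.mem_iInter, Set.mem_ofPred_eq]
    rw [this]
    refine ((isClosed_iInter fun t => isClosed_iInter fun t' => isClosed_iInter fun _ =>
      isClosed_iInter fun c => isClosed_iInter fun r => isClosed_iInter fun c' =>
      isClosed_iInter fun r' => isClosed_eq (by fun_prop) continuous_const).inter
      (isClosed_iInter fun t => isClosed_iInter fun t' => isClosed_iInter fun _ =>
      isClosed_iInter fun c => isClosed_iInter fun r => isClosed_iInter fun c' =>
      isClosed_iInter fun r' => isClosed_eq (by fun_prop) continuous_const)).inter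
      (isClosed_eq ?_ continuous_const)
    exact continuous_finsetSum _ fun p _ =>
      ((continuous_apply p).comp continuous_wbVector).norm.pow 2
  · refine (Metric.isBounded_closedBall (x := 0) (r := 1)).subset fun φ hφ => ?_
    rw [mem_closedBall_zero_iff, pi_norm_le_iff_of_nonneg zero_le_one]
    intro t
    rw [pi_norm_le_iff_of_nonneg zero_le_one]
    intro q
    have h := hφ.2
    rw [hφ.1.sum_norm_sq_wbVector] at h
    have h1 : ‖φ t q‖ ^ 2 ≤ ∑ q, ‖φ t q‖ ^ 2 :=
      Finset.single_le_sum (f := fun q => ‖φ t q‖ ^ 2) (fun _ _ => sq_nonneg _)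
        (Finset.mem_univ q)
    have h2 : ∑ q, ‖φ t q‖ ^ 2 ≤ ∑ t, ∑ q, ‖φ t q‖ ^ 2 :=
      Finset.single_le_sum (f := fun t => ∑ q, ‖φ t q‖ ^ 2)
        (fun _ _ => Finset.sum_nonneg fun _ _ => sq_nonneg _) (Finset.mem_univ t)
    rw [← sq_le_one_iff₀ (norm_nonneg _)]
    linarith

theorem validVectors_nonempty [DecidableEq B] [DecidableEq C] [DecidableEq R] (q₀ : B × C × R) :
    (validVectors n B C R).Nonempty := by
  have ho : OrthogonalSupports fun (t : Fin n → Fin 2 → Fin 2) (q : B × C × R) =>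
      if t = 0 ∧ q = q₀ then (1 : ℂ) else 0 := by
    constructor
    · intro t t' h
      rw [supportLeft_isOrtho_iff]
      intro c r c' r'
      refine Finset.sum_eq_zero fun b _ => ?_
      by_cases ht : t = 0
      · have : t' ≠ 0 := fun h' => h (ht.trans h'.symm)
        simp [this]
      · simp [ht]
    · intro t t' h
      rw [supportRight_isOrtho_iff]
      intro c r c' r'
      refine Finset.sum_eq_zero fun b _ => ?_
      by_cases ht : t = 0
      · have : t' ≠ 0 := fun h' => h (ht.trans h'.symm)
        simp [this]
      · simp [ht]
  refine ⟨_, ho, ?_⟩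
  rw [ho.sum_norm_sq_wbVector, Finset.sum_eq_single 0, Finset.sum_eq_single q₀]
  · simp
  · intro q _ hq
    simp [hq]
  · simp
  · intro t _ ht
    simp [ht]
  · simp

end ValidVectors

/-! ### Distance of a state to the admissible form -/

section Distance

variable {n : ℕ} {B C B' C' R : Type*} [Fintype B] [DecidableEq B] [Fintype C] [DecidableEq C]
  [Fintype B'] [DecidableEq B'] [Fintype C'] [DecidableEq C'] [Fintype R] [DecidableEq R]

/-- The trace distance between a state and a state of the required form. -/
def formDist (V : Matrix B' B ℂ) (W : Matrix C' C ℂ)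
    (ρ : Matrix ((Fin n → Fin 2) × B × C) ((Fin n → Fin 2) × B × C) ℂ)
    (φ : (Fin n → Fin 2 → Fin 2) → B' × C' × R → ℂ) : ℝ :=
  traceDist (conjLocal V W ρ) (partialTrace (vecMulVec (wbVector φ) (star (wbVector φ))))

theorem continuous_formDist_left (V : Matrix B' B ℂ) (W : Matrix C' C ℂ)
    (φ : (Fin n → Fin 2 → Fin 2) → B' × C' × R → ℂ) :
    Continuous fun ρ => formDist V W ρ φ := by
  refine continuous_traceDist ?_ continuous_const
  unfold conjLocal
  fun_prop

theorem continuous_formDist_right (V : Matrix B' B ℂ) (W : Matrix C' C ℂ)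
    (ρ : Matrix ((Fin n → Fin 2) × B × C) ((Fin n → Fin 2) × B × C) ℂ) :
    Continuous fun φ : (Fin n → Fin 2 → Fin 2) → B' × C' × R → ℂ => formDist V W ρ φ := by
  refine continuous_traceDist continuous_const ?_
  refine continuous_matrix fun p q => ?_
  simp only [partialTrace, of_apply, vecMulVec_apply, Pi.star_apply]
  have h : ∀ p, Continuous fun φ : (Fin n → Fin 2 → Fin 2) → B' × C' × R → ℂ => wbVector φ p :=
    fun p => (continuous_apply p).comp continuous_wbVector
  exact continuous_finsetSum _ fun r _ => (h _).mul (h _).star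

theorem norm_mul_norm_le_two {E : Type*} [NormedAddCommGroup E] [InnerProductSpace ℂ E] {x y : E}
    (hx : ‖x‖ = 1) (hy : ‖y‖ = 1) : ‖x - y‖ * ‖x + y‖ ≤ 2 := by
  have := parallelogram_law_with_norm ℂ x y
  rw [hx, hy] at this
  nlinarith [sq_nonneg (‖x - y‖ - ‖x + y‖)]

theorem norm_toLp_eq_one_iff {I : Type*} [Fintype I] (v : I → ℂ) :
    ‖WithLp.toLp 2 v‖ = 1 ↔ ∑ p, ‖v p‖ ^ 2 = 1 := by
  rw [EuclideanSpace.norm_eq, Real.sqrt_eq_one]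

theorem formDist_le {V : Matrix B' B ℂ} {W : Matrix C' C ℂ}
    {ρ : Matrix ((Fin n → Fin 2) × B × C) ((Fin n → Fin 2) × B × C) ℂ}
    {ψ : EuclideanSpace ℂ ((Fin n → Fin 2) × B × C × R)}
    (hψ : partialTrace (vecMulVec ψ.ofLp (star ψ.ofLp)) = ρ)
    (φ : (Fin n → Fin 2 → Fin 2) → B' × C' × R → ℂ) :
    formDist V W ρ φ ≤ 1 / 2 *
      (‖WithLp.toLp 2 (applyLocal V W ψ.ofLp) - WithLp.toLp 2 (wbVector φ)‖ *
        ‖WithLp.toLp 2 (applyLocal V W ψ.ofLp) + WithLp.toLp 2 (wbVector φ)‖) := by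
  rw [formDist, ← hψ, ← partialTrace_applyLocal]
  exact traceDist_partialTrace_le (WithLp.toLp 2 (applyLocal V W ψ.ofLp))
    (WithLp.toLp 2 (wbVector φ))

theorem norm_applyLocal {V : Matrix B' B ℂ} {W : Matrix C' C ℂ} (hV : Vᴴ * V = 1)
    (hW : Wᴴ * W = 1) {ψ : EuclideanSpace ℂ ((Fin n → Fin 2) × B × C × R)} (hψ : ‖ψ‖ = 1) :
    ‖(WithLp.toLp 2 (applyLocal V W ψ.ofLp) :
      EuclideanSpace ℂ ((Fin n → Fin 2) × B' × C' × R))‖ = 1 := by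
  rw [norm_toLp_eq_one_iff, sum_norm_sq_applyLocal hV hW]
  exact (norm_toLp_eq_one_iff _).mp hψ

theorem formDist_le_one {V : Matrix B' B ℂ} {W : Matrix C' C ℂ} (hV : Vᴴ * V = 1)
    (hW : Wᴴ * W = 1) {ρ : Matrix ((Fin n → Fin 2) × B × C) ((Fin n → Fin 2) × B × C) ℂ}
    (hρ : IsDensity ρ) (e : R ≃ (Fin n → Fin 2) × B × C)
    {φ : (Fin n → Fin 2 → Fin 2) → B' × C' × R → ℂ} (hφ : φ ∈ validVectors n B' C' R) :
    formDist V W ρ φ ≤ 1 := by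
  obtain ⟨ψ, hψ⟩ := exists_purification hρ.1 e
  have := norm_mul_norm_le_two (norm_applyLocal hV hW (norm_purification hρ.2 hψ))
    ((norm_toLp_eq_one_iff _).mpr hφ.2)
  linarith [formDist_le (V := V) (W := W) hψ φ]

theorem wbVector_smul (r : ℂ) (φ : (Fin n → Fin 2 → Fin 2) → B × C × R → ℂ) :
    wbVector (fun t => r • φ t) = r • wbVector φ := by
  funext p
  simp only [wbVector, Pi.smul_apply, smul_eq_mul, Finset.mul_sum, mul_left_comm]

theorem OrthogonalSupports.smul {T : Type*} {φ : T → B × C × R → ℂ} (hφ : OrthogonalSupports φ)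
    (r : ℂ) : OrthogonalSupports fun t => r • φ t := by
  constructor
  · intro t t' h
    have h := (supportLeft_isOrtho_iff _ _).mp (hφ.1 t t' h)
    rw [supportLeft_isOrtho_iff]
    intro c r c' r'
    simp only [Pi.smul_apply, smul_eq_mul, star_mul', mul_mul_mul_comm, ← Finset.mul_sum, h,
      mul_zero]
  · intro t t' h
    have h := (supportRight_isOrtho_iff _ _).mp (hφ.2 t t' h)
    rw [supportRight_isOrtho_iff]
    intro c r c' r'
    simp only [Pi.smul_apply, smul_eq_mul, star_mul', mul_mul_mul_comm, ← Finset.mul_sum, h,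
      mul_zero]

theorem norm_sub_normalize_le {E : Type*} [NormedAddCommGroup E] [NormedSpace ℂ E] {x y : E}
    (hx : ‖x‖ = 1) (hy : y ≠ 0) : ‖x - ((‖y‖⁻¹ : ℝ) : ℂ) • y‖ ≤ 2 * ‖x - y‖ := by
  have hy' : ‖y‖ ≠ 0 := norm_ne_zero_iff.mpr hy
  have h1 : ‖y - ((‖y‖⁻¹ : ℝ) : ℂ) • y‖ = |‖y‖ - 1| := by
    have : y - ((‖y‖⁻¹ : ℝ) : ℂ) • y = ((1 - ‖y‖⁻¹ : ℝ) : ℂ) • y := by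
      rw [Complex.ofReal_sub, Complex.ofReal_one, sub_smul, one_smul]
    rw [this, norm_smul, Complex.norm_real, Real.norm_eq_abs, ← abs_of_nonneg (norm_nonneg y),
      ← abs_mul, abs_of_nonneg (norm_nonneg y), sub_mul, one_mul, inv_mul_cancel₀ hy']
  have h2 : |‖y‖ - 1| ≤ ‖x - y‖ := by
    rw [← hx, norm_sub_rev]
    exact abs_norm_sub_norm_le _ _
  have h3 := norm_sub_le_norm_sub_add_norm_sub x y (((‖y‖⁻¹ : ℝ) : ℂ) • y)
  linarith

/-- The rounded vector is not normalized. Normalizing doubles its distance `157n²√ε`, and two unit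
vectors have trace distance at most the norm of their difference. -/
theorem Strategy.exists_formDist_le (S : Strategy (tfkw.parallel n) B C)
    (q : R ≃ (Fin n → Fin 2) × B × C) {ε : ℝ} (hε : 0 ≤ ε) (hn : 1 ≤ n)
    (hw : ∀ i, Real.cos (Real.pi / 8) ^ 2 - ε ≤ S.winProb i)
    (e : (B × (Fin n → Fin 2)) × (Fin n → Fin 2 → Fin 2) ↪ B')
    (e' : (C × (Fin n → Fin 2)) × (Fin n → Fin 2 → Fin 2) ↪ C') (f : B ↪ B') (f' : C ↪ C')
    (hne : (validVectors n B' C' R).Nonempty) :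
    ∃ φ ∈ validVectors n B' C' R,
      formDist (embedMatrix f) (embedMatrix f') S.state φ ≤ 314 * n ^ 2 * √ε := by
  have hV := embedMatrix_isometry f.injective
  have hW := embedMatrix_isometry f'.injective
  -- When the bound is trivial the rounded vector may vanish, so any admissible vector is taken;
  -- otherwise it is within distance less than 1 of a unit vector and hence nonzero.
  by_cases hδ : 1 ≤ 157 * n ^ 2 * √ε
  · obtain ⟨φ, hφ⟩ := hne
    exact ⟨φ, hφ, (formDist_le_one hV hW S.state_density q hφ).trans (by linarith)⟩
  push Not at hδ
  have hδ0 : 0 ≤ 157 * n ^ 2 * √ε := by positivity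
  obtain ⟨ψ, hψ⟩ := exists_purification S.state_density.1 q
  obtain ⟨φ, hφ, hdist⟩ := S.exists_rounding ψ hψ hε hn hw e e' f f'
  have hnorm := norm_applyLocal hV hW (norm_purification S.state_density.2 hψ)
  set x : EuclideanSpace ℂ ((Fin n → Fin 2) × B' × C' × R) :=
    WithLp.toLp 2 (applyLocal (embedMatrix f) (embedMatrix f') ψ.ofLp) with hx
  set y : EuclideanSpace ℂ ((Fin n → Fin 2) × B' × C' × R) := WithLp.toLp 2 (wbVector φ) with hy
  have hxy : ‖x - y‖ ≤ 157 * n ^ 2 * √ε := by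
    refine abs_le_of_sq_le_sq' ?_ hδ0 |>.2
    rw [EuclideanSpace.norm_sq_eq]
    exact hdist
  have hy0 : y ≠ 0 := by
    intro h
    rw [h, sub_zero, hnorm] at hxy
    linarith
  have hyn : (WithLp.toLp 2 (wbVector fun t => ((‖y‖⁻¹ : ℝ) : ℂ) • φ t) :
      EuclideanSpace ℂ ((Fin n → Fin 2) × B' × C' × R)) = ((‖y‖⁻¹ : ℝ) : ℂ) • y := by
    rw [wbVector_smul, hy, WithLp.toLp_smul]
  have hy1 : ‖((‖y‖⁻¹ : ℝ) : ℂ) • y‖ = 1 := by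
    rw [norm_smul, Complex.norm_real, norm_inv, norm_norm,
      inv_mul_cancel₀ (norm_ne_zero_iff.mpr hy0)]
  refine ⟨fun t => ((‖y‖⁻¹ : ℝ) : ℂ) • φ t, ⟨hφ.smul _, ?_⟩, (formDist_le hψ _).trans ?_⟩
  · rw [← norm_toLp_eq_one_iff, hyn, hy1]
  · rw [← hx, hyn]
    have h1 := norm_sub_normalize_le hnorm hy0
    have h2 := norm_add_le x (((‖y‖⁻¹ : ℝ) : ℂ) • y)
    rw [hnorm, hy1] at h2
    nlinarith [norm_nonneg (x - ((‖y‖⁻¹ : ℝ) : ℂ) • y)]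

end Distance

/-! ### Measurability of the minimal distance and the union bound -/

section Measurability

variable {n : ℕ} {B C B' C' R Ω : Type*} [Fintype B] [DecidableEq B] [Fintype C] [DecidableEq C]
  [Fintype B'] [DecidableEq B'] [Fintype C'] [DecidableEq C'] [Fintype R] [DecidableEq R]
  [MeasurableSpace Ω]

theorem measurable_winProb {S : Ω → Strategy (tfkw.parallel n) B C}
    (hB : ∀ θ y b b', Measurable fun ω => (S ω).bob θ y b b')
    (hC : ∀ θ y c c', Measurable fun ω => (S ω).charlie θ y c c')
    (hρ : ∀ p q, Measurable fun ω => (S ω).state p q) (i : Fin n) :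
    Measurable fun ω => (S ω).winProb i := by
  simp only [Strategy.winProb, trace, diag_apply, mul_apply, kroneckerMap_apply]
  refine Finset.measurable_sum _ fun θ _ => Measurable.const_mul
    (Finset.measurable_sum _ fun y _ => Complex.measurable_re.comp
      (Finset.measurable_sum _ fun p _ => Finset.measurable_sum _ fun q _ =>
        ((Measurable.const_mul (Measurable.mul ?_ ?_) _).mul (hρ q p)))) _
  · simp only [marginal, Matrix.sum_apply]
    exact Finset.measurable_sum _ fun x _ => hB θ x _ _
  · simp only [marginal, Matrix.sum_apply]
    exact Finset.measurable_sum _ fun x _ => hC θ x _ _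

/-- The distance of a random state to the closest state of the required form is measurable. -/
theorem measurable_iInf_formDist (V : Matrix B' B ℂ) (W : Matrix C' C ℂ)
    {ρ : Ω → Matrix ((Fin n → Fin 2) × B × C) ((Fin n → Fin 2) × B × C) ℂ}
    (hρ : ∀ p q, Measurable fun ω => ρ ω p q) :
    Measurable fun ω => ⨅ φ : validVectors n B' C' R, formDist V W (ρ ω) φ.1 := by
  have hm : Measurable fun ω p q => ρ ω p q :=
    measurable_pi_iff.mpr fun p => measurable_pi_iff.mpr fun q => hρ p q
  -- An infimum of continuous functions over an uncountable family is still upper semicontinuous,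
  -- hence Borel; no measurable selection is needed.
  have hu : UpperSemicontinuous fun x : (Fin n → Fin 2) × B × C → (Fin n → Fin 2) × B × C → ℂ =>
      ⨅ φ : validVectors n B' C' R, formDist V W (of x) φ.1 :=
    upperSemicontinuous_ciInf (fun x => ⟨0, by rintro _ ⟨φ, rfl⟩; exact traceDist_nonneg _ _⟩)
      fun φ => Continuous.upperSemicontinuous
        ((continuous_formDist_left V W φ.1).comp continuous_id)
  exact hu.measurable.comp hm

theorem exists_formDist_eq_iInf (V : Matrix B' B ℂ) (W : Matrix C' C ℂ)
    (hne : (validVectors n B' C' R).Nonempty)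
    (ρ : Matrix ((Fin n → Fin 2) × B × C) ((Fin n → Fin 2) × B × C) ℂ) :
    ∃ φ ∈ validVectors n B' C' R,
      formDist V W ρ φ = ⨅ φ : validVectors n B' C' R, formDist V W ρ φ.1 := by
  obtain ⟨φ, hφ, hmin⟩ := isCompact_validVectors.exists_isMinOn hne
    (continuous_formDist_right V W ρ).continuousOn
  refine ⟨φ, hφ, ?_⟩
  have : Nonempty (validVectors n B' C' R) := hne.to_subtype
  refine le_antisymm (le_ciInf fun χ => hmin χ.2) (ciInf_le (f := fun χ :
    validVectors n B' C' R => formDist V W ρ χ.1) ⟨0, ?_⟩ ⟨φ, hφ⟩)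
  rintro _ ⟨χ, rfl⟩
  exact traceDist_nonneg _ _

/-- The expectation of a random variable in `[0, 1]` that is small unless one of `n` unlikely
events happens. -/
theorem integral_le_of_forall_event (P : Measure Ω) [IsProbabilityMeasure P] {h : Ω → ℝ}
    (hm : Measurable h) (h0 : ∀ ω, 0 ≤ h ω) (h1 : ∀ ω, h ω ≤ 1) {G : Fin n → Set Ω}
    (hG : ∀ i, MeasurableSet (G i)) {η δ : ℝ} (hη : ∀ i, 1 - η ≤ P.real (G i)) (hδ : 0 ≤ δ)
    (hh : ∀ ω, (∀ i, ω ∈ G i) → h ω ≤ δ) : Integrable h P ∧ ∫ ω, h ω ∂P ≤ δ + n * η := by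
  have hint : Integrable h P := Integrable.of_bound hm.aestronglyMeasurable 1
    (Filter.Eventually.of_forall fun ω => by
      rw [Real.norm_of_nonneg (h0 ω)]
      exact h1 ω)
  refine ⟨hint, ?_⟩
  have hbad : MeasurableSet (⋃ i, (G i)ᶜ) := MeasurableSet.iUnion fun i => (hG i).compl
  have hle : ∀ ω, h ω ≤ δ + (⋃ i, (G i)ᶜ).indicator (fun _ => (1 : ℝ)) ω := by
    intro ω
    by_cases hω : ω ∈ ⋃ i, (G i)ᶜ
    · rw [Set.indicator_of_mem hω]
      linarith [h1 ω]
    · rw [Set.indicator_of_notMem hω, add_zero]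
      refine hh ω fun i => ?_
      by_contra hi
      exact hω (Set.mem_iUnion.mpr ⟨i, hi⟩)
  have hi1 : Integrable ((⋃ i, (G i)ᶜ).indicator fun _ => (1 : ℝ)) P :=
    (integrable_const 1).indicator hbad
  calc ∫ ω, h ω ∂P ≤ ∫ ω, (δ + (⋃ i, (G i)ᶜ).indicator (fun _ => (1 : ℝ)) ω) ∂P :=
        integral_mono hint ((integrable_const δ).add hi1) hle
    _ = δ + P.real (⋃ i, (G i)ᶜ) := by
        rw [integral_add (integrable_const δ) hi1, integral_indicator_const _ hbad]
        simp
    _ ≤ δ + ∑ i, P.real (G i)ᶜ := add_le_add le_rfl (measureReal_iUnion_fintype_le _)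
    _ ≤ δ + n * η := by
        refine add_le_add le_rfl ((Finset.sum_le_card_nsmul _ _ η fun i _ => ?_).trans_eq
          (by simp))
        rw [probReal_compl_eq_one_sub (hG i)]
        linarith [hη i]

end Measurability

end

end MoE

/-! ### The random strategy: fixed registers and expected distance -/

theorem mainTheorem2 :
    ∃ K : ℝ, 0 ≤ K ∧
      ∀ (n : ℕ), 1 ≤ n →
      ∀ (B C : Type*) [Fintype B] [DecidableEq B] [Fintype C] [DecidableEq C]
        (Ω : Type*) [MeasurableSpace Ω] (P : Measure Ω) [IsProbabilityMeasure P]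
        (S : Ω → MoE.Strategy (MoE.tfkw.parallel n) B C),
        (∀ θ y b b', Measurable fun ω => (S ω).bob θ y b b') →
        (∀ θ y c c', Measurable fun ω => (S ω).charlie θ y c c') →
        (∀ p q, Measurable fun ω => (S ω).state p q) →
      ∀ (ε η : ℝ), 0 ≤ ε → ε ≤ 1 → 0 ≤ η → η ≤ 1 →
        (∀ i : Fin n,
          1 - η ≤ P.real {ω | Real.cos (Real.pi / 8) ^ 2 - ε ≤ (S ω).winProb i}) →
        ∃ (dB dC dR : ℕ) (V : Matrix (Fin dB) B ℂ) (W : Matrix (Fin dC) C ℂ)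
          (ψ : Ω → (Fin n → Fin 2 → Fin 2) → Fin dB × Fin dC × Fin dR → ℂ),
          Vᴴ * V = 1 ∧ Wᴴ * W = 1 ∧
          (∀ ω, ∑ p, ‖MoE.wbVector (ψ ω) p‖ ^ 2 = 1) ∧
          (∀ ω t t', t ≠ t' → MoE.supportLeft (ψ ω t) ⟂ MoE.supportLeft (ψ ω t')) ∧
          (∀ ω t t', t ≠ t' → MoE.supportRight (ψ ω t) ⟂ MoE.supportRight (ψ ω t')) ∧
          Integrable (fun ω => MoE.traceDist (MoE.conjLocal V W (S ω).state)
            (MoE.partialTrace (vecMulVec (MoE.wbVector (ψ ω)) (star (MoE.wbVector (ψ ω)))))) P ∧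
          ∫ ω, MoE.traceDist (MoE.conjLocal V W (S ω).state)
            (MoE.partialTrace (vecMulVec (MoE.wbVector (ψ ω)) (star (MoE.wbVector (ψ ω))))) ∂P
              ≤ K * (n : ℝ) ^ 3 * √ε + n * η := by
  refine ⟨314, by norm_num, ?_⟩
  intro n hn B C _ _ _ _ Ω _ P _ S hSB hSC hSρ ε η hε _ _ _ hwin
  let DB := Fin (Fintype.card ((B × (Fin n → Fin 2)) × (Fin n → Fin 2 → Fin 2)))
  let DC := Fin (Fintype.card ((C × (Fin n → Fin 2)) × (Fin n → Fin 2 → Fin 2)))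
  let DR := Fin (Fintype.card ((Fin n → Fin 2) × B × C))
  let e := (Fintype.equivFin ((B × (Fin n → Fin 2)) × (Fin n → Fin 2 → Fin 2))).toEmbedding
  let e' := (Fintype.equivFin ((C × (Fin n → Fin 2)) × (Fin n → Fin 2 → Fin 2))).toEmbedding
  let q := (Fintype.equivFin ((Fin n → Fin 2) × B × C)).symm
  let f : B ↪ DB := ⟨fun b => e ((b, 0), 0), fun b b' h => by
    simpa using e.injective h⟩
  let f' : C ↪ DC := ⟨fun c => e' ((c, 0), 0), fun c c' h => by
    simpa using e'.injective h⟩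
  have hV := MoE.embedMatrix_isometry f.injective
  have hW := MoE.embedMatrix_isometry f'.injective
  -- A basis vector exists because Ω is nonempty and a state of trace 1 rules out empty registers.
  have hne : (MoE.validVectors n DB DC DR).Nonempty := by
    obtain ⟨ω⟩ : Nonempty Ω := P.nonempty_of_neZero
    have : Nonempty ((Fin n → Fin 2) × B × C) := by
      by_contra h
      rw [not_nonempty_iff] at h
      have := (S ω).state_density.2
      simp [trace] at this
    obtain ⟨p⟩ := this
    exact MoE.validVectors_nonempty (f p.2.1, f' p.2.2, q.symm p)
  -- ψ is an arbitrary choice of minimizers. Only its distance to the state has to be measurable,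
  -- and that equals the infimum.
  choose ψ hψ hmin using fun ω =>
    MoE.exists_formDist_eq_iInf (MoE.embedMatrix f) (MoE.embedMatrix f') hne (S ω).state
  have hinf : ∀ ω, ∀ φ ∈ MoE.validVectors n DB DC DR,
      MoE.formDist (MoE.embedMatrix f) (MoE.embedMatrix f') (S ω).state (ψ ω) ≤
        MoE.formDist (MoE.embedMatrix f) (MoE.embedMatrix f') (S ω).state φ := by
    intro ω φ hφ
    rw [hmin]
    refine ciInf_le (f := fun χ : MoE.validVectors n DB DC DR => MoE.formDist (MoE.embedMatrix f)
      (MoE.embedMatrix f') (S ω).state χ.1) ⟨0, ?_⟩ ⟨φ, hφ⟩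
    rintro _ ⟨χ, rfl⟩
    exact MoE.traceDist_nonneg _ _
  have hmeas : Measurable fun ω =>
      MoE.formDist (MoE.embedMatrix f) (MoE.embedMatrix f') (S ω).state (ψ ω) := by
    simp only [hmin]
    exact MoE.measurable_iInf_formDist _ _ hSρ
  have hn' : (1 : ℝ) ≤ n := by exact_mod_cast hn
  have key := MoE.integral_le_of_forall_event P hmeas (fun ω => MoE.traceDist_nonneg _ _)
    (fun ω => MoE.formDist_le_one hV hW (S ω).state_density q (hψ ω))
    (fun i => measurableSet_le measurable_const (MoE.measurable_winProb hSB hSC hSρ i)) hwin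
    (δ := 314 * (n : ℝ) ^ 3 * √ε) (by positivity) (fun ω hω => by
      obtain ⟨φ, hφ, hle⟩ := (S ω).exists_formDist_le q hε hn hω e e' f f' hne
      refine (hinf ω φ hφ).trans (hle.trans ?_)
      -- The argument gives the power `n²`, which is weakened here.
      have : (n : ℝ) ^ 2 ≤ (n : ℝ) ^ 3 := pow_le_pow_right₀ hn' (by norm_num)
      gcongr)
  exact ⟨_, _, _, _, _, ψ, hV, hW, fun ω => (hψ ω).2, fun ω => (hψ ω).1.1, fun ω => (hψ ω).1.2,
    key.1, key.2⟩
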